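/- Setting. Let $n\ge 1$, let $D\subset\mathbb R^n$ be a bounded $C^2$-domain (open, connected), let $H>0$, and let $u\in H_0^1(D)\cap C(\bar D)$, so that $u=0$ on $\partial D$, with $u\ge -H$ in $D$. For $\delta\in(0,1)$ put $$\Omega(u)=\{(x,z): x\in D,\ -H<z<u(x)\},\qquad \Omega_\delta(u)=\{(x,z): x\in D,\ -H-\delta<z<u(x)\},$$ $$\mathcal R_\delta=D\times(-H-\delta,-H),\qquad \mathcal C(u)=\{x\in D: u(x)=-H\}.$$ Suppose that $\Omega(u)$ has the segment property: every $x_0\in\partial\Omega(u)$ has a neighbourhood $U$ and a vector $\xi\neq0$ with $y+t\xi\in\Omega(u)$ for all $y\in\overline{\Omega(u)}\cap U$ and $t\in(0,1)$. Fix $M\ge\|u\|_{L_\infty(D)}+H$ and set $\Omega_M=D\times(-H-1,M)$. Let $\sigma\in C(\bar D\times[-H-1,-H])$ be positive, and let $\sigma_\delta=\delta\sigma$ in $\mathcal R_\delta$ and $\sigma_\delta=1$ in $\Omega(u)$. Let $h_b:\bar D\times[-H-1,-H]\times[-H,\infty)\to\mathbb R$ and $h:\bar D\times[-H,\infty)\times[-H,\infty)\to\mathbb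 R$ be $C^2$-functions of $(x,z,w)$ with $$h_b(x,-H,w)=h(x,-H,w),\qquad \sigma(x,-H)\,\partial_zh_b(x,-H,w)=\partial_zh(x,-H,w),\qquad (x,w)\in D\times[-H,\infty).$$ Set $h_{u,\delta}(x,z)=h_b\big(x,-H+\tfrac{z+H}{\delta},u(x)\big)$ for $-H-\delta<z<-H$, $h_{u,\delta}(x,z)=h_u(x,z)=h(x,z,u(x))$ for $z\ge -H$, and $\mathfrak h_u(x,-H)=h_b(x,-H-1,u(x))$. Let $H_B^1(\Omega(u))$ be the closure in $H^1(\Omega(u))$ of the set of all $\vartheta\in C^1(\overline{\Omega(u)})$ with $\vartheta(x,u(x))=0$ for $x\in D$ and $\vartheta(x,z)=0$ for $(x,z)\in\partial D\times(-H,0]$. For $\vartheta\in H^1_B(\Omega(u))$ let $\vartheta(\cdot,-H)$ be its trace: on $D\setminus\mathcal C(u)$ it is the image of $\vartheta$ under the continuous extension of $\varphi\mapsto\varphi(\cdot,-H)$ from $C^1(\overline{\Omega(u)})$ to an operator $H^1(\Omega(u))\to L_2(D\setminus\mathcal C(u),(H+u)\,dx)$, and it is $0$ on $\mathcal C(u)$.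 Functions in $H_0^1(\Omega_\delta(u))$ and in $H_B^1(\Omega(u))$ are regarded as elements of $L_2(\Omega_M)$ through extension by zero. Define on $L_2(\Omega_M)$ $$G_\delta[\vartheta]=\frac12\int_{\Omega_\delta(u)}\sigma_\delta\,|\nabla(\vartheta+h_{u,\delta})|^2\,d(x,z)\ \text{ if }\vartheta\in H_0^1(\Omega_\delta(u)),\qquad G_\delta[\vartheta]=\infty\ \text{ otherwise},$$ $$G[\vartheta]=\frac12\int_{\Omega(u)}|\nabla(\vartheta+h_u)|^2\,d(x,z)+\frac12\int_D\sigma(x,-H)\,\big|\vartheta(x,-H)+h_u(x,-H)-\mathfrak h_u(x,-H)\big|^2\,dx\ \text{ if }\vartheta\in H_B^1(\Omega(u)),$$ and $G[\vartheta]=\infty$ otherwise. Theorem 3.1. $\Gamma\text{-}\lim_{\delta\to0}G_\delta=G$ in $L_2(\Omega_M)$; that is, for every $\vartheta\in L_2(\Omega_M)$, one has $G[\vartheta]\le\liminf_{\delta\to0}G_\delta[\vartheta_\delta]$ for every family $\vartheta_\delta\to\vartheta$ in $L_2(\Omega_M)$, and there is a family $\vartheta_\delta\to\vartheta$ in $L_2(\Omega_M)$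 with $\limsup_{\delta\to0}G_\delta[\vartheta_\delta]\le G[\vartheta]$. Moreover, $G[\vartheta]<\infty$ if and only if $\vartheta\in H_B^1(\Omega(u))$. -/

import Mathlib

open MeasureTheory Filter Topology Set
open scoped ENNReal ContDiff

namespace MEMS

/-- The space `ℝⁿ` of horizontal variables. Points of `ℝⁿ⁺¹` are pairs `(x, z) : Rn n × ℝ`, with
`volume` the Lebesgue measure of `ℝⁿ⁺¹`. -/
abbrev Rn (n : ℕ) : Type := EuclideanSpace ℝ (Fin n)

/-! ### Sobolev spaces -/

section Sobolev

variable {X : Type*} [NormedAddCommGroup X] [NormedSpace ℝ X] [MeasureSpace X]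

/-- The test functions `C_c^∞(Ω)`. -/
def IsTestFunction (Ω : Set X) (φ : X → ℝ) : Prop :=
  ContDiff ℝ ∞ φ ∧ HasCompactSupport φ ∧ tsupport φ ⊆ Ω

/-- `g` is the weak derivative of `f` in the open set `Ω`; `g x v` is the weak derivative in the
direction `v`, i.e. `∇f(x) · v`. -/
def HasWeakDeriv (Ω : Set X) (f : X → ℝ) (g : X → X →L[ℝ] ℝ) : Prop :=
  LocallyIntegrableOn f Ω ∧ LocallyIntegrableOn g Ω ∧
    ∀ φ : X → ℝ, IsTestFunction Ω φ → ∀ v : X,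
      ∫ x in Ω, f x * fderiv ℝ φ x v = - ∫ x in Ω, φ x * g x v

/-- `f ∈ H¹(Ω)` with weak derivative `g`. -/
def MemH1With (Ω : Set X) (f : X → ℝ) (g : X → X →L[ℝ] ℝ) : Prop :=
  MemLp f 2 (volume.restrict Ω) ∧ HasWeakDeriv Ω f g ∧ MemLp g 2 (volume.restrict Ω)

/-- Convergence in `H¹(Ω)` of functions `φ k` which are `C¹` in the open set `Ω` to the function
`f ∈ H¹(Ω)` with weak derivative `g`. (In finite dimension, the operator norm of linear forms is
equivalent to the Euclidean norm of the gradients.) -/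
def TendstoH1 (Ω : Set X) (φ : ℕ → X → ℝ) (f : X → ℝ) (g : X → X →L[ℝ] ℝ) : Prop :=
  Tendsto (fun k => eLpNorm (fun x => φ k x - f x) 2 (volume.restrict Ω)) atTop (𝓝 0) ∧
    Tendsto (fun k => eLpNorm (fun x => fderiv ℝ (φ k) x - g x) 2 (volume.restrict Ω))
      atTop (𝓝 0)

/-- `f` belongs to the closure in `H¹(Ω)` of a set `S` of functions which are `C¹` in `Ω`. -/
def MemH1Closure (Ω : Set X) (S : Set (X → ℝ)) (f : X → ℝ) : Prop :=
  ∃ g : X → X →L[ℝ] ℝ, MemH1With Ω f g ∧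
    ∃ φ : ℕ → X → ℝ, (∀ k, φ k ∈ S) ∧ TendstoH1 Ω φ f g

/-- `f ∈ H¹₀(Ω)`, the closure of `C_c^∞(Ω)` in `H¹(Ω)`. -/
def MemH10 (Ω : Set X) (f : X → ℝ) : Prop :=
  MemH1Closure Ω {φ | IsTestFunction Ω φ} f

/-- `φ ∈ C¹(closure Ω)`: `φ` is `C¹` in the open set `Ω`, and `φ` and its derivative extend
continuously to `closure Ω`; the values of `φ` on `closure Ω` are those of the extension. -/
def IsC1Closure (Ω : Set X) (φ : X → ℝ) : Prop :=
  ContDiffOn ℝ 1 φ Ω ∧ ContinuousOn φ (closure Ω) ∧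
    ∃ Φ : X → X →L[ℝ] ℝ, ContinuousOn Φ (closure Ω) ∧ ∀ x ∈ Ω, Φ x = fderiv ℝ φ x

end Sobolev

/-! ### Domains -/

/-- Bounded `C²`-domains: bounded, open and connected, and near each boundary point the domain is
the sublevel set of a `C²` function with non-vanishing gradient at that point. -/
structure IsBoundedC2Domain {n : ℕ} (D : Set (Rn n)) : Prop where
  isOpen : IsOpen D
  isConnected : IsConnected D
  isBounded : Bornology.IsBounded D
  boundary : ∀ x₀ ∈ frontier D, ∃ U : Set (Rn n), IsOpen U ∧ x₀ ∈ U ∧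
    ∃ ρ : Rn n → ℝ, ContDiffOn ℝ 2 ρ U ∧ fderiv ℝ ρ x₀ ≠ 0 ∧ D ∩ U = {x ∈ U | ρ x < 0}

/-- The segment property of an open set `Ω`. -/
def SegmentProperty {X : Type*} [NormedAddCommGroup X] [NormedSpace ℝ X] (Ω : Set X) : Prop :=
  ∀ x₀ ∈ frontier Ω, ∃ U ∈ 𝓝 x₀, ∃ ξ : X, ξ ≠ 0 ∧
    ∀ x ∈ closure Ω ∩ U, ∀ t ∈ Ioo (0 : ℝ) 1, x + t • ξ ∈ Ω

section Geometry

variable {n : ℕ}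

/-- `Ω(u) = {(x, z) : x ∈ D, -H < z < u(x)}`. -/
def freeSpace (H : ℝ) (D : Set (Rn n)) (u : Rn n → ℝ) : Set (Rn n × ℝ) :=
  {p | p.1 ∈ D ∧ -H < p.2 ∧ p.2 < u p.1}

/-- `Ω_δ(u) = {(x, z) : x ∈ D, -H-δ < z < u(x)}`. -/
def device (H δ : ℝ) (D : Set (Rn n)) (u : Rn n → ℝ) : Set (Rn n × ℝ) :=
  {p | p.1 ∈ D ∧ -H - δ < p.2 ∧ p.2 < u p.1}

/-- `Ω_M = D × (-H-1, M)`. -/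
def container (H M : ℝ) (D : Set (Rn n)) : Set (Rn n × ℝ) :=
  D ×ˢ Ioo (-H - 1) M

/-- The coincidence set `C(u) = {x ∈ D : u(x) = -H}`. -/
def coincidence (H : ℝ) (D : Set (Rn n)) (u : Rn n → ℝ) : Set (Rn n) :=
  {x ∈ D | u x = -H}

/-- The Hilbert space `L₂(Ω_M)`. -/
abbrev L2M (H M : ℝ) (D : Set (Rn n)) : Type :=
  Lp ℝ 2 ((volume : Measure (Rn n × ℝ)).restrict (container H M D))

/-- The set `C¹_B` of all `φ ∈ C¹(closure Ω(u))` which vanish on the graph of `u` over `D` and on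
`∂D × (-H, 0]`. -/
def C1B (H : ℝ) (D : Set (Rn n)) (u : Rn n → ℝ) : Set (Rn n × ℝ → ℝ) :=
  {φ | IsC1Closure (freeSpace H D u) φ ∧ (∀ x ∈ D, φ (x, u x) = 0) ∧
    ∀ x ∈ frontier D, ∀ z ∈ Ioc (-H) 0, φ (x, z) = 0}

/-- `f ∈ H¹_B(Ω(u))`, the closure of `C¹_B` in `H¹(Ω(u))`. -/
def MemH1B (H : ℝ) (D : Set (Rn n)) (u : Rn n → ℝ) (f : Rn n × ℝ → ℝ) : Prop :=
  MemH1Closure (freeSpace H D u) (C1B H D u) f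

/-- `b` is the trace `f(·, -H)` on `D` of `f ∈ H¹(Ω(u))`: on `D \ C(u)` it is the image of `f` under
the continuous extension of `φ ↦ φ(·, -H)` from `C¹(closure Ω(u))`, dense in `H¹(Ω(u))` by the segment property,
to an operator `H¹(Ω(u)) → L₂(D \ C(u), (H+u)dx)`, and on `C(u)` it is zero by convention.
The trace is unique up to null sets. -/
def IsBottomTrace (H : ℝ) (D : Set (Rn n)) (u : Rn n → ℝ) (f : Rn n × ℝ → ℝ) (b : Rn n → ℝ) :
    Prop :=
  AEStronglyMeasurable b (volume.restrict D) ∧ (∀ x ∈ coincidence H D u, b x = 0) ∧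
    ∃ g, MemH1With (freeSpace H D u) f g ∧
      ∃ φ : ℕ → Rn n × ℝ → ℝ, (∀ k, IsC1Closure (freeSpace H D u) (φ k)) ∧
        TendstoH1 (freeSpace H D u) φ f g ∧
        Tendsto (fun k => ∫⁻ x in D \ coincidence H D u,
          ENNReal.ofReal ((φ k (x, -H) - b x) ^ 2 * (H + u x))) atTop (𝓝 0)

end Geometry

/-! ### The energies -/

section Energies

variable {n : ℕ}

/-- The squared Euclidean norm of the vector in `ℝⁿ⁺¹` that represents the linear form `L`, i.e.
`∑ i, (∂_{x_i} f)² + (∂_z f)²` if `L` is the derivative of `f`. -/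
noncomputable def gradSq (L : Rn n × ℝ →L[ℝ] ℝ) : ℝ :=
  ∑ i, (L (EuclideanSpace.single i 1, 0)) ^ 2 + (L (0, 1)) ^ 2

/-- `∫_Ω s |∇f|² d(x,z)`, where `∇f` is the weak gradient of `f` in `Ω`. The infimum runs over all
representatives of the weak gradient, which give the same value (`dirichletIntegral_eq`); it is
`∞` if there is no weak gradient. -/
noncomputable def dirichletIntegral (Ω : Set (Rn n × ℝ)) (s f : Rn n × ℝ → ℝ) : ℝ≥0∞ :=
  ⨅ (g : Rn n × ℝ → Rn n × ℝ →L[ℝ] ℝ) (_ : HasWeakDeriv Ω f g),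
    ∫⁻ p in Ω, ENNReal.ofReal (s p * gradSq (g p))

/-- The permittivity `σ_δ`: `δσ` in the layer, `1` in `Ω(u)`. -/
noncomputable def permittivity (H δ : ℝ) (σ : Rn n × ℝ → ℝ) (p : Rn n × ℝ) : ℝ :=
  if p.2 < -H then δ * σ p else 1

/-- `h_{u,δ}(x,z) = h_δ(x,z,u(x))`, where `h_δ(x,z,w)` is `h_b(x,-H+(z+H)/δ,w)` for `z < -H` and
`h(x,z,w)` for `z ≥ -H`. -/
noncomputable def boundaryData (H δ : ℝ) (u : Rn n → ℝ) (hb h : Rn n × ℝ × ℝ → ℝ)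
    (p : Rn n × ℝ) : ℝ :=
  if p.2 < -H then hb (p.1, -H + (p.2 + H) / δ, u p.1) else h (p.1, p.2, u p.1)

/-- `ϑ ∈ L₂(Ω_M)` belongs to `H¹₀(Ω_δ(u))`, whose elements are extended by zero to `Ω_M`. -/
def InH10 (H M δ : ℝ) (D : Set (Rn n)) (u : Rn n → ℝ) (θ : L2M H M D) : Prop :=
  MemH10 (device H δ D u) θ ∧
    ∀ᵐ p ∂(volume.restrict (container H M D \ device H δ D u)), θ p = 0

/-- `ϑ ∈ L₂(Ω_M)` belongs to `H¹_B(Ω(u))`, whose elements are extended by zero to `Ω_M`. -/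
def InH1B (H M : ℝ) (D : Set (Rn n)) (u : Rn n → ℝ) (θ : L2M H M D) : Prop :=
  MemH1B H D u θ ∧
    ∀ᵐ p ∂(volume.restrict (container H M D \ freeSpace H D u)), θ p = 0

open Classical in
/-- The functional `G_δ` on `L₂(Ω_M)`. -/
noncomputable def energyDelta (H M δ : ℝ) (D : Set (Rn n)) (u : Rn n → ℝ) (σ : Rn n × ℝ → ℝ)
    (hb h : Rn n × ℝ × ℝ → ℝ) (θ : L2M H M D) : ℝ≥0∞ :=
  if InH10 H M δ D u θ then
    1 / 2 * dirichletIntegral (device H δ D u) (permittivity H δ σ)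
      (fun p => θ p + boundaryData H δ u hb h p)
  else ∞

/-- `∫_D σ(x,-H) |ϑ(x,-H) + h_u(x,-H) - 𝔥_u(x,-H)|² dx` with `h_u(x,z) = h(x,z,u(x))` and
`𝔥_u(x,-H) = h_b(x,-H-1,u(x))`. The infimum runs over all representatives of the trace
`ϑ(·,-H)`, which give the same value; it is `∞` if there is no trace. -/
noncomputable def robinIntegral (H : ℝ) (D : Set (Rn n)) (u : Rn n → ℝ) (σ : Rn n × ℝ → ℝ)
    (hb h : Rn n × ℝ × ℝ → ℝ) (f : Rn n × ℝ → ℝ) : ℝ≥0∞ :=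
  ⨅ (b : Rn n → ℝ) (_ : IsBottomTrace H D u f b),
    ∫⁻ x in D, ENNReal.ofReal
      (σ (x, -H) * (b x + h (x, -H, u x) - hb (x, -H - 1, u x)) ^ 2)

open Classical in
/-- The functional `G` on `L₂(Ω_M)`. -/
noncomputable def energyLimit (H M : ℝ) (D : Set (Rn n)) (u : Rn n → ℝ) (σ : Rn n × ℝ → ℝ)
    (hb h : Rn n × ℝ × ℝ → ℝ) (θ : L2M H M D) : ℝ≥0∞ :=
  if InH1B H M D u θ then
    1 / 2 * dirichletIntegral (freeSpace H D u) (fun _ => 1)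
        (fun p => θ p + h (p.1, p.2, u p.1)) +
      1 / 2 * robinIntegral H D u σ hb h θ
  else ∞

end Energies

/-- `Γ`-convergence along the filter `l` of functionals on a metric space `X`: the liminf
inequality for every convergent family, and the existence of recovery families. -/
def GammaConverges {ι X : Type*} [PseudoMetricSpace X] (l : Filter ι) (F : ι → X → ℝ≥0∞)
    (F₀ : X → ℝ≥0∞) : Prop :=
  ∀ x : X,
    (∀ y : ι → X, Tendsto y l (𝓝 x) → F₀ x ≤ liminf (fun i => F i (y i)) l) ∧
      ∃ y : ι → X, Tendsto y l (𝓝 x) ∧ limsup (fun i => F i (y i)) l ≤ F₀ x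

/-! ### Well-definedness of the Dirichlet integral -/

lemma HasWeakDeriv.ae_eq {n : ℕ} {Ω : Set (Rn n × ℝ)} (hΩ : IsOpen Ω) {f : Rn n × ℝ → ℝ}
    {g₁ g₂ : Rn n × ℝ → Rn n × ℝ →L[ℝ] ℝ} (h₁ : HasWeakDeriv Ω f g₁)
    (h₂ : HasWeakDeriv Ω f g₂) : ∀ᵐ p ∂(volume.restrict Ω), gradSq (g₁ p) = gradSq (g₂ p) := by
  have key : ∀ v : Rn n × ℝ, ∀ᵐ p ∂(volume.restrict Ω), g₁ p v = g₂ p v := by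
    intro v
    have l₁ : LocallyIntegrableOn (fun p => g₁ p v) Ω := by
      intro x hx
      obtain ⟨s, hs, hi⟩ := h₁.2.1 x hx
      exact ⟨s, hs, hi.apply_continuousLinearMap v⟩
    have l₂ : LocallyIntegrableOn (fun p => g₂ p v) Ω := by
      intro x hx
      obtain ⟨s, hs, hi⟩ := h₂.2.1 x hx
      exact ⟨s, hs, hi.apply_continuousLinearMap v⟩
    have := IsOpen.ae_eq_zero_of_integral_contDiff_smul_eq_zero hΩ (l₁.sub l₂) (by
      intro φ h1 h2 h3
      have e₁ := h₁.2.2 φ ⟨h1, h2, h3⟩ v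
      have e₂ := h₂.2.2 φ ⟨h1, h2, h3⟩ v
      have int : ∀ g : Rn n × ℝ → ℝ, LocallyIntegrableOn g Ω →
          Integrable (fun p => φ p * g p) := by
        intro g hg
        have hk : IntegrableOn g (tsupport φ) := hg.integrableOn_compact_subset h3 h2
        have := hk.continuousOn_mul (g := φ) h1.continuous.continuousOn h2
        rw [integrableOn_iff_integrable_of_support_subset] at this
        · exact this
        · exact (Function.support_mul_subset_left _ _).trans (subset_tsupport φ)
      have s : ∀ g : Rn n × ℝ → ℝ, ∫ p in Ω, φ p * g p = ∫ p, φ p * g p := fun g =>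
        setIntegral_eq_integral_of_forall_compl_eq_zero fun p hp => by
          rw [image_eq_zero_of_notMem_tsupport fun h => hp (h3 h), zero_mul]
      rw [s] at e₁ e₂
      have : ∀ p, φ p • ((fun p => g₁ p v) - fun p => g₂ p v) p
          = φ p * g₁ p v - φ p * g₂ p v := fun p => by
        simp [mul_sub]
      simp_rw [this]
      rw [integral_sub (int _ l₁) (int _ l₂)]
      linarith)
    rw [ae_restrict_iff' hΩ.measurableSet]
    filter_upwards [this] with p hp hpΩ
    have := hp hpΩ
    simp only [Pi.sub_apply] at this
    linarith
  have k₁ := ae_all_iff.2 fun i : Fin n => key (EuclideanSpace.single i 1, 0)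
  filter_upwards [k₁, key (0, 1)] with p hp hq
  simp [gradSq, hp, hq]

lemma dirichletIntegral_eq {n : ℕ} {Ω : Set (Rn n × ℝ)} (hΩ : IsOpen Ω) {s f : Rn n × ℝ → ℝ}
    {g : Rn n × ℝ → Rn n × ℝ →L[ℝ] ℝ} (hg : HasWeakDeriv Ω f g) :
    dirichletIntegral Ω s f = ∫⁻ p in Ω, ENNReal.ofReal (s p * gradSq (g p)) := by
  refine le_antisymm (iInf₂_le g hg) (le_iInf₂ fun g' hg' => le_of_eq ?_)
  refine lintegral_congr_ae ?_
  filter_upwards [hg.ae_eq hΩ hg'] with p hp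
  rw [hp]

end MEMS

namespace MEMS

set_option linter.unusedSectionVars false

/-! ### Limits in `L²` -/

section Limits

variable {α : Type*} [MeasurableSpace α] {μ : Measure α}

/-! The layer has thickness `δ` and permittivity of order `δ`. Horizontal derivatives that stay
bounded in `L²` therefore cost order `δ²` there, while a jump `J(x)` of the potential across the
layer costs at least about `∫ σ(x,-H) J² dx`, with near equality for an affine profile. This is the
source of the Robin term.

Liminf inequality. For `ϑ ∈ H¹₀(Ω_δ(u))` the integral of `∂_zϑ` over almost every vertical slice of
`Ω_δ(u)` is zero (`sliceInt_device_eq_zero`). The increment of `ϑ` across the layer is thus minus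
the integral of `∂_zϑ` over the slice of `Ω(u)`, which is the trace of `ϑ` on the plate
(`bottomTrace`). The data add the increment `h_u - 𝔥_u` (`sliceInt_dataGrad`). Cauchy-Schwarz on an
interval of length `δ` then bounds the Robin term by the energy of the layer, up to the ratio of
`σ(x,-H)` to `σ(x,z)`, which tends to `1` uniformly. So the limit energy of `ϑ` restricted to `Ω(u)`
is at most `r` times the `δ`-energy of `ϑ`, with `r > 1` arbitrary and `δ` small
(`energyLimit_cut_le`). Restriction is a contraction of `L₂(Ω_M)` which fixes limits of bounded
energy (`cut_eq_self`), and the limit energy is lower semicontinuous (`energyLimit_le_of_approx`):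
it is half the squared norm of the second component on `energyGraph`, a closed convex subset of the
product of `L₂(Ω_M)` and a Hilbert space.

Recovery families. A function in `C¹_B`, reflected at the plate and extended by zero, is continuous,
lies in `H¹` of the doubled domain and vanishes outside of it; truncation and mollification make it
a limit of test functions (`MemH1With.memH10_of_continuous`). Hence test functions `ψ` of the region
below the graph of `u` are dense in `H¹_B` (`H1ClosureWith.subgraph`). For such a `ψ`, the total
potential is chosen as `h_u + ψ` in `Ω(u)` and, in the layer, affine in `z` between `𝔥_u` and the
value of `h_u + ψ` at the plate. A cutoff `χ` with compact support in `D` switches back to `h_b`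
near `∂D`, so that the lateral boundary values vanish. The error lives on `{χ ≠ 1}`, whose measure
is as small as desired (`exists_cutoff_energyDelta_le`). Continuity of the limit energy in the
gradient and a diagonal argument conclude.

Two technical points support this. First, `u` is only continuous and in `H¹`, so the data are only
weakly differentiable: the chain rule `WeakFormula.comp` treats horizontal slices, and
`weakFormula_of_slices` assembles them across `z = -H`, where the vertical derivative may jump.
Secondly, the energies are infima over weak gradients and over traces; uniqueness of both
(`MemH1With.ae_eq`, `Deflection.ae_eq_bottomTrace`) turns them into explicit integrals. -/

lemma tendsto_integral_mul_of_eLpNorm {f : ℕ → α → ℝ} {f₀ ψ : α → ℝ}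
    (hf : ∀ k, MemLp (f k) 2 μ) (hf₀ : MemLp f₀ 2 μ) (hψ : MemLp ψ 2 μ)
    (h : Tendsto (fun k => eLpNorm (fun x => f k x - f₀ x) 2 μ) atTop (𝓝 0)) :
    Tendsto (fun k => ∫ x, f k x * ψ x ∂μ) atTop (𝓝 (∫ x, f₀ x * ψ x ∂μ)) := by
  have h2 : Tendsto (fun k => eLpNorm (fun x => f k x - f₀ x) 2 μ * eLpNorm ψ 2 μ) atTop (𝓝 0) := by
    have := ENNReal.Tendsto.mul_const h (Or.inr hψ.eLpNorm_ne_top)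
    rwa [zero_mul] at this
  have i₀ : Integrable (fun x => f₀ x * ψ x) μ := hf₀.integrable_mul hψ
  have i : ∀ k, Integrable (fun x => f k x * ψ x) μ := fun k => (hf k).integrable_mul hψ
  refine tendsto_integral_of_L1' (fun x => f₀ x * ψ x) i₀.aestronglyMeasurable
    (Eventually.of_forall i) ?_
  refine tendsto_of_tendsto_of_tendsto_of_le_of_le tendsto_const_nhds h2 (fun _ => zero_le) ?_
  intro k
  have e : ((fun x => f k x * ψ x) - fun x => f₀ x * ψ x) = (fun x => f k x - f₀ x) • ψ := by
    ext x
    simp [sub_mul]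
  have key : eLpNorm ((fun x => f k x - f₀ x) • ψ) 1 μ ≤
      eLpNorm (fun x => f k x - f₀ x) 2 μ * eLpNorm ψ 2 μ :=
    eLpNorm_smul_le_mul_eLpNorm hψ.aestronglyMeasurable
      ((hf k).aestronglyMeasurable.sub hf₀.aestronglyMeasurable)
  rw [← e] at key
  exact key

lemma eLpNorm_triangle_sub {E : Type*} [NormedAddCommGroup E] {f g h : α → E}
    (hfg : AEStronglyMeasurable (fun x => f x - g x) μ)
    (hgh : AEStronglyMeasurable (fun x => g x - h x) μ) :
    eLpNorm (fun x => f x - h x) 2 μ ≤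
      eLpNorm (fun x => f x - g x) 2 μ + eLpNorm (fun x => g x - h x) 2 μ := by
  have := eLpNorm_add_le hfg hgh (p := 2) (by norm_num)
  refine le_trans (le_of_eq ?_) this
  congr 1
  ext x
  simp

/-- A diagonal sequence: if `a` is the limit of `A j` and each `A j` is approximated by elements
of `S`, in the sense of a quasi-metric `d`, then `a` is approximated by elements of `S`. -/
lemma exists_seq_of_approx {β : Type*} {S : Set β} {e : β → ℝ≥0∞}
    (h : ∀ ε : ℝ≥0∞, 0 < ε → ∃ b ∈ S, e b ≤ ε) :
    ∃ φ : ℕ → β, (∀ k, φ k ∈ S) ∧ Tendsto (fun k => e (φ k)) atTop (𝓝 0) := by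
  have h' : ∀ k : ℕ, ∃ b ∈ S, e b ≤ ((k : ℝ≥0∞) + 1)⁻¹ := fun k =>
    h _ (ENNReal.inv_pos.2 (by simp))
  choose φ hφ hφe using h'
  refine ⟨φ, hφ, tendsto_of_tendsto_of_tendsto_of_le_of_le tendsto_const_nhds ?_
    (fun _ => zero_le) hφe⟩
  have := (ENNReal.tendsto_inv_nat_nhds_zero).comp (tendsto_add_atTop_nat 1)
  simpa [Function.comp_def] using this

end Limits

/-! ### Weak derivatives and closures in `H¹` -/

section WeakDerivatives

variable {X : Type*} [NormedAddCommGroup X] [NormedSpace ℝ X] [MeasureSpace X] [BorelSpace X]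
  [FiniteDimensional ℝ X] [(volume : Measure X).IsAddHaarMeasure]

lemma IsTestFunction.mono {Ω Ω' : Set X} {φ : X → ℝ} (h : IsTestFunction Ω φ) (hs : Ω ⊆ Ω') :
    IsTestFunction Ω' φ := ⟨h.1, h.2.1, h.2.2.trans hs⟩

lemma IsTestFunction.eq_zero {Ω : Set X} {φ : X → ℝ} (h : IsTestFunction Ω φ) {x : X}
    (hx : x ∉ Ω) : φ x = 0 :=
  image_eq_zero_of_notMem_tsupport fun h' => hx (h.2.2 h')

lemma IsTestFunction.fderiv_eq_zero {Ω : Set X} {φ : X → ℝ} (h : IsTestFunction Ω φ) {x : X}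
    (hx : x ∉ Ω) : fderiv ℝ φ x = 0 :=
  image_eq_zero_of_notMem_tsupport fun h' => hx (h.2.2 (tsupport_fderiv_subset ℝ h'))

lemma IsTestFunction.continuous_fderiv {Ω : Set X} {φ : X → ℝ} (h : IsTestFunction Ω φ) :
    Continuous (fderiv ℝ φ) := h.1.continuous_fderiv (by simp)

lemma IsTestFunction.memLp {Ω : Set X} {φ : X → ℝ} (h : IsTestFunction Ω φ) {μ : Measure X}
    [IsFiniteMeasureOnCompacts μ] {p : ℝ≥0∞} :
    MemLp φ p μ := h.1.continuous.memLp_of_hasCompactSupport h.2.1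

lemma IsTestFunction.memLp_fderiv {Ω : Set X} {φ : X → ℝ} (h : IsTestFunction Ω φ)
    {μ : Measure X} [IsFiniteMeasureOnCompacts μ] {p : ℝ≥0∞} :
    MemLp (fderiv ℝ φ) p μ := h.continuous_fderiv.memLp_of_hasCompactSupport (h.2.1.fderiv ℝ)

lemma IsTestFunction.memLp_fderiv_apply {Ω : Set X} {φ : X → ℝ} (h : IsTestFunction Ω φ) (v : X)
    {μ : Measure X} [IsFiniteMeasureOnCompacts μ] {p : ℝ≥0∞} :
    MemLp (fun x => fderiv ℝ φ x v) p μ :=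
  (h.continuous_fderiv.clm_apply continuous_const).memLp_of_hasCompactSupport
    (h.2.1.fderiv_apply ℝ v)

lemma MemLp.clm_apply {μ : Measure X} {g : X → X →L[ℝ] ℝ} (hg : MemLp g 2 μ) (v : X) :
    MemLp (fun x => g x v) 2 μ :=
  (ContinuousLinearMap.apply ℝ ℝ v).comp_memLp' hg

lemma locallyIntegrableOn_of_memLp {E : Type*} [NormedAddCommGroup E] {Ω : Set X} {f : X → E}
    (hf : MemLp f 2 (volume.restrict Ω)) : LocallyIntegrableOn f Ω :=
  locallyIntegrableOn_of_locallyIntegrable_restrict (hf.locallyIntegrable (by norm_num))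

/-- The integration by parts formula that defines weak derivatives. -/
def WeakFormula (Ω : Set X) (f : X → ℝ) (g : X → X →L[ℝ] ℝ) : Prop :=
  ∀ φ : X → ℝ, IsTestFunction Ω φ → ∀ v : X,
    ∫ x in Ω, f x * fderiv ℝ φ x v = - ∫ x in Ω, φ x * g x v

lemma MemH1With.of_weakFormula {Ω : Set X} {f : X → ℝ} {g : X → X →L[ℝ] ℝ}
    (hf : MemLp f 2 (volume.restrict Ω)) (hg : MemLp g 2 (volume.restrict Ω))
    (h : WeakFormula Ω f g) : MemH1With Ω f g :=
  ⟨hf, ⟨locallyIntegrableOn_of_memLp hf, locallyIntegrableOn_of_memLp hg, h⟩, hg⟩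

lemma MemH1With.weakFormula {Ω : Set X} {f : X → ℝ} {g : X → X →L[ℝ] ℝ}
    (h : MemH1With Ω f g) : WeakFormula Ω f g := h.2.1.2.2

lemma WeakFormula.congr {Ω : Set X} {f f' : X → ℝ} {g g' : X → X →L[ℝ] ℝ}
    (h : WeakFormula Ω f g) (hf : f =ᵐ[volume.restrict Ω] f')
    (hg : g =ᵐ[volume.restrict Ω] g') : WeakFormula Ω f' g' := by
  intro φ hφ v
  have e1 : ∫ x in Ω, f' x * fderiv ℝ φ x v = ∫ x in Ω, f x * fderiv ℝ φ x v :=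
    integral_congr_ae (by filter_upwards [hf] with x hx; rw [hx])
  have e2 : ∫ x in Ω, φ x * g' x v = ∫ x in Ω, φ x * g x v :=
    integral_congr_ae (by filter_upwards [hg] with x hx; rw [hx])
  rw [e1, e2, h φ hφ v]

lemma HasWeakDeriv.congr {Ω : Set X} {f f' : X → ℝ} {g g' : X → X →L[ℝ] ℝ}
    (h : HasWeakDeriv Ω f g) (hf : f =ᵐ[volume.restrict Ω] f')
    (hg : g =ᵐ[volume.restrict Ω] g') : HasWeakDeriv Ω f' g' :=
  ⟨h.1.congr hf, h.2.1.congr hg, WeakFormula.congr h.2.2 hf hg⟩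

lemma MemH1With.congr {Ω : Set X} {f f' : X → ℝ} {g g' : X → X →L[ℝ] ℝ}
    (h : MemH1With Ω f g) (hf : f =ᵐ[volume.restrict Ω] f')
    (hg : g =ᵐ[volume.restrict Ω] g') : MemH1With Ω f' g' :=
  ⟨h.1.ae_eq hf, h.2.1.congr hf hg, h.2.2.ae_eq hg⟩

lemma WeakFormula.mono {Ω Ω' : Set X} {f : X → ℝ} {g : X → X →L[ℝ] ℝ}
    (h : WeakFormula Ω f g) (hs : Ω' ⊆ Ω) : WeakFormula Ω' f g := by
  intro φ hφ v
  have key := h φ (hφ.mono hs) v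
  rw [setIntegral_eq_integral_of_forall_compl_eq_zero,
    setIntegral_eq_integral_of_forall_compl_eq_zero] at key ⊢
  · exact key
  all_goals intro x hx
  · rw [hφ.eq_zero hx, zero_mul]
  · rw [hφ.eq_zero (fun h => hx (hs h)), zero_mul]
  · rw [hφ.fderiv_eq_zero hx]; simp
  · rw [hφ.fderiv_eq_zero (fun h => hx (hs h))]; simp

lemma MemH1With.mono {Ω Ω' : Set X} {f : X → ℝ} {g : X → X →L[ℝ] ℝ}
    (h : MemH1With Ω f g) (hs : Ω' ⊆ Ω) : MemH1With Ω' f g :=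
  MemH1With.of_weakFormula (h.1.mono_measure (Measure.restrict_mono hs le_rfl))
    (h.2.2.mono_measure (Measure.restrict_mono hs le_rfl)) (h.weakFormula.mono hs)

lemma MemH1With.linearComb {Ω : Set X} {f₁ f₂ : X → ℝ} {g₁ g₂ : X → X →L[ℝ] ℝ}
    (h₁ : MemH1With Ω f₁ g₁) (h₂ : MemH1With Ω f₂ g₂) (a b : ℝ) :
    MemH1With Ω (fun x => a * f₁ x + b * f₂ x) (fun x => a • g₁ x + b • g₂ x) := by
  refine MemH1With.of_weakFormula ((h₁.1.const_mul a).add (h₂.1.const_mul b))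
    ((h₁.2.2.const_smul a).add (h₂.2.2.const_smul b)) ?_
  intro φ hφ v
  have e₁ := h₁.weakFormula φ hφ v
  have e₂ := h₂.weakFormula φ hφ v
  have i₁ := h₁.1.integrable_mul (hφ.memLp_fderiv_apply v (p := 2) (μ := volume.restrict Ω))
  have i₂ := h₂.1.integrable_mul (hφ.memLp_fderiv_apply v (p := 2) (μ := volume.restrict Ω))
  have j₁ := (hφ.memLp (p := 2) (μ := volume.restrict Ω)).integrable_mul (MemLp.clm_apply h₁.2.2 v)
  have j₂ := (hφ.memLp (p := 2) (μ := volume.restrict Ω)).integrable_mul (MemLp.clm_apply h₂.2.2 v)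
  have l : ∫ x in Ω, (a * f₁ x + b * f₂ x) * fderiv ℝ φ x v =
      a * (∫ x in Ω, f₁ x * fderiv ℝ φ x v) + b * ∫ x in Ω, f₂ x * fderiv ℝ φ x v := by
    rw [← integral_const_mul, ← integral_const_mul, ← integral_add]
    · congr 1; ext x; ring
    · exact i₁.const_mul a
    · exact i₂.const_mul b
  have r : ∫ x in Ω, φ x * (a • g₁ x + b • g₂ x) v =
      a * (∫ x in Ω, φ x * g₁ x v) + b * ∫ x in Ω, φ x * g₂ x v := by
    rw [← integral_const_mul, ← integral_const_mul, ← integral_add]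
    · congr 1; ext x; simp; ring
    · exact j₁.const_mul a
    · exact j₂.const_mul b
  rw [l, r, e₁, e₂]
  ring

lemma MemH1With.add {Ω : Set X} {f₁ f₂ : X → ℝ} {g₁ g₂ : X → X →L[ℝ] ℝ}
    (h₁ : MemH1With Ω f₁ g₁) (h₂ : MemH1With Ω f₂ g₂) :
    MemH1With Ω (fun x => f₁ x + f₂ x) (fun x => g₁ x + g₂ x) := by
  simpa using h₁.linearComb h₂ 1 1

lemma MemH1With.sub {Ω : Set X} {f₁ f₂ : X → ℝ} {g₁ g₂ : X → X →L[ℝ] ℝ}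
    (h₁ : MemH1With Ω f₁ g₁) (h₂ : MemH1With Ω f₂ g₂) :
    MemH1With Ω (fun x => f₁ x - f₂ x) (fun x => g₁ x - g₂ x) := by
  refine (h₁.linearComb h₂ 1 (-1)).congr (ae_of_all _ fun x => ?_) (ae_of_all _ fun x => ?_)
  · simp only
    ring
  · ext v
    simp
    ring

/-- The weak gradient is a closed operator: for a fixed test function, both sides of the integration
by parts formula are pairings with a fixed `L²` function and pass to the limit. -/
lemma MemH1With.of_tendsto {Ω : Set X} {f : ℕ → X → ℝ} {g : ℕ → X → X →L[ℝ] ℝ} {f₀ : X → ℝ}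
    {g₀ : X → X →L[ℝ] ℝ} (h : ∀ k, MemH1With Ω (f k) (g k))
    (hf₀ : MemLp f₀ 2 (volume.restrict Ω)) (hg₀ : MemLp g₀ 2 (volume.restrict Ω))
    (hf : Tendsto (fun k => eLpNorm (fun x => f k x - f₀ x) 2 (volume.restrict Ω)) atTop (𝓝 0))
    (hg : Tendsto (fun k => eLpNorm (fun x => g k x - g₀ x) 2 (volume.restrict Ω)) atTop (𝓝 0)) :
    MemH1With Ω f₀ g₀ := by
  refine MemH1With.of_weakFormula hf₀ hg₀ ?_
  intro φ hφ v
  have t₁ := tendsto_integral_mul_of_eLpNorm (fun k => (h k).1) hf₀ (hφ.memLp_fderiv_apply v) hf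
  have hgv : Tendsto (fun k => eLpNorm (fun x => g k x v - g₀ x v) 2 (volume.restrict Ω))
      atTop (𝓝 0) := by
    have h2 : Tendsto (fun k => ENNReal.ofReal ‖v‖ *
        eLpNorm (fun x => g k x - g₀ x) 2 (volume.restrict Ω)) atTop (𝓝 0) := by
      have := ENNReal.Tendsto.const_mul (a := ENNReal.ofReal ‖v‖) hg (Or.inr ENNReal.ofReal_ne_top)
      simpa using this
    refine tendsto_of_tendsto_of_tendsto_of_le_of_le tendsto_const_nhds h2 (fun _ => zero_le) ?_
    intro k
    refine eLpNorm_le_mul_eLpNorm_of_ae_le_mul (Eventually.of_forall fun x => ?_) 2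
    have := (g k x - g₀ x).le_opNorm v
    rw [mul_comm]
    simpa using this
  have t₂ := tendsto_integral_mul_of_eLpNorm (fun k => MemLp.clm_apply (h k).2.2 v)
    (MemLp.clm_apply hg₀ v) (hφ.memLp (p := 2)) hgv
  have e : ∀ k, ∫ x in Ω, f k x * fderiv ℝ φ x v = - ∫ x in Ω, g k x v * φ x := by
    intro k
    rw [(h k).weakFormula φ hφ v]
    simp_rw [mul_comm]
  simp_rw [e] at t₁
  rw [tendsto_nhds_unique t₁ t₂.neg]
  simp_rw [mul_comm]

/-- `f` is the limit in `H¹(Ω)` of functions in `S`, and `g` is its weak derivative. -/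
def H1ClosureWith (Ω : Set X) (S : Set (X → ℝ)) (f : X → ℝ) (g : X → X →L[ℝ] ℝ) : Prop :=
  MemH1With Ω f g ∧ ∃ φ : ℕ → X → ℝ, (∀ k, φ k ∈ S) ∧ TendstoH1 Ω φ f g

lemma memH1Closure_iff {Ω : Set X} {S : Set (X → ℝ)} {f : X → ℝ} :
    MemH1Closure Ω S f ↔ ∃ g, H1ClosureWith Ω S f g := Iff.rfl

lemma TendstoH1.congr {Ω : Set X} {φ : ℕ → X → ℝ} {f f' : X → ℝ} {g g' : X → X →L[ℝ] ℝ}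
    (h : TendstoH1 Ω φ f g) (hf : f =ᵐ[volume.restrict Ω] f')
    (hg : g =ᵐ[volume.restrict Ω] g') : TendstoH1 Ω φ f' g' := by
  constructor
  · refine h.1.congr fun k => eLpNorm_congr_ae ?_
    filter_upwards [hf] with x hx; rw [hx]
  · refine h.2.congr fun k => eLpNorm_congr_ae ?_
    filter_upwards [hg] with x hx; rw [hx]

lemma TendstoH1.mono {Ω Ω' : Set X} {φ : ℕ → X → ℝ} {f : X → ℝ} {g : X → X →L[ℝ] ℝ}
    (h : TendstoH1 Ω φ f g) (hs : Ω' ⊆ Ω) : TendstoH1 Ω' φ f g :=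
  ⟨tendsto_of_tendsto_of_tendsto_of_le_of_le tendsto_const_nhds h.1 (fun _ => zero_le)
    fun _ => eLpNorm_mono_measure _ (Measure.restrict_mono hs le_rfl),
  tendsto_of_tendsto_of_tendsto_of_le_of_le tendsto_const_nhds h.2 (fun _ => zero_le)
    fun _ => eLpNorm_mono_measure _ (Measure.restrict_mono hs le_rfl)⟩

lemma H1ClosureWith.congr {Ω : Set X} {S : Set (X → ℝ)} {f f' : X → ℝ} {g g' : X → X →L[ℝ] ℝ}
    (h : H1ClosureWith Ω S f g) (hf : f =ᵐ[volume.restrict Ω] f')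
    (hg : g =ᵐ[volume.restrict Ω] g') : H1ClosureWith Ω S f' g' := by
  obtain ⟨h, φ, hφ, ht⟩ := h
  exact ⟨h.congr hf hg, φ, hφ, ht.congr hf hg⟩

/-- `H¹(Ω)`-closures are characterised by approximation up to `ε`, provided that the functions in
`S` are continuously differentiable in `Ω`. -/
lemma exists_tendstoH1 {Ω : Set X} {S : Set (X → ℝ)} {f : X → ℝ} {g : X → X →L[ℝ] ℝ}
    (h : ∀ ε : ℝ≥0∞, 0 < ε → ∃ φ ∈ S, eLpNorm (fun x => φ x - f x) 2 (volume.restrict Ω) ≤ ε ∧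
      eLpNorm (fun x => fderiv ℝ φ x - g x) 2 (volume.restrict Ω) ≤ ε) :
    ∃ φ : ℕ → X → ℝ, (∀ k, φ k ∈ S) ∧ TendstoH1 Ω φ f g := by
  obtain ⟨φ, hφ, ht⟩ := exists_seq_of_approx (S := S)
    (e := fun φ => max (eLpNorm (fun x => φ x - f x) 2 (volume.restrict Ω))
      (eLpNorm (fun x => fderiv ℝ φ x - g x) 2 (volume.restrict Ω)))
    fun ε hε => by
      obtain ⟨φ, hφ, h1, h2⟩ := h ε hε
      exact ⟨φ, hφ, max_le h1 h2⟩
  exact ⟨φ, hφ, tendsto_of_tendsto_of_tendsto_of_le_of_le tendsto_const_nhds ht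
      (fun _ => zero_le) fun _ => le_max_left _ _,
    tendsto_of_tendsto_of_tendsto_of_le_of_le tendsto_const_nhds ht
      (fun _ => zero_le) fun _ => le_max_right _ _⟩

lemma aestronglyMeasurable_of_contDiffOn {Ω : Set X} (hΩ : IsOpen Ω) {φ : X → ℝ}
    (h : ContDiffOn ℝ 1 φ Ω) : AEStronglyMeasurable φ (volume.restrict Ω) ∧
      AEStronglyMeasurable (fderiv ℝ φ) (volume.restrict Ω) :=
  ⟨h.continuousOn.aestronglyMeasurable hΩ.measurableSet,
    (h.continuousOn_fderiv_of_isOpen hΩ le_rfl).aestronglyMeasurable hΩ.measurableSet⟩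

/-- A closure is closed, by an `ε/2` argument. That elements of `S` are `C¹` serves only to make
them and their derivatives measurable for the triangle inequality. -/
lemma H1ClosureWith.of_tendsto {Ω : Set X} (hΩ : IsOpen Ω) {S : Set (X → ℝ)}
    (hS : ∀ φ ∈ S, ContDiffOn ℝ 1 φ Ω) {f : ℕ → X → ℝ}
    {g : ℕ → X → X →L[ℝ] ℝ} {f₀ : X → ℝ} {g₀ : X → X →L[ℝ] ℝ}
    (h : ∀ k, H1ClosureWith Ω S (f k) (g k))
    (hf₀ : MemLp f₀ 2 (volume.restrict Ω)) (hg₀ : MemLp g₀ 2 (volume.restrict Ω))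
    (hf : Tendsto (fun k => eLpNorm (fun x => f k x - f₀ x) 2 (volume.restrict Ω)) atTop (𝓝 0))
    (hg : Tendsto (fun k => eLpNorm (fun x => g k x - g₀ x) 2 (volume.restrict Ω)) atTop (𝓝 0)) :
    H1ClosureWith Ω S f₀ g₀ := by
  refine ⟨MemH1With.of_tendsto (fun k => (h k).1) hf₀ hg₀ hf hg, exists_tendstoH1 fun ε hε => ?_⟩
  have hε2 : 0 < ε / 2 := ENNReal.half_pos hε.ne'
  obtain ⟨k, hk1, hk2⟩ := ((ENNReal.tendsto_nhds_zero.1 hf _ hε2).and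
    (ENNReal.tendsto_nhds_zero.1 hg _ hε2)).exists
  obtain ⟨hm, φ, hφ, ht⟩ := h k
  obtain ⟨j, hj1, hj2⟩ := ((ENNReal.tendsto_nhds_zero.1 ht.1 _ hε2).and
    (ENNReal.tendsto_nhds_zero.1 ht.2 _ hε2)).exists
  obtain ⟨m1, m2⟩ := aestronglyMeasurable_of_contDiffOn hΩ (hS _ (hφ j))
  refine ⟨φ j, hφ j, ?_, ?_⟩
  · refine (eLpNorm_triangle_sub (m1.sub hm.1.1) (hm.1.1.sub hf₀.1)).trans ?_
    exact (add_le_add hj1 hk1).trans (ENNReal.add_halves ε).le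
  · refine (eLpNorm_triangle_sub (m2.sub hm.2.2.1) (hm.2.2.1.sub hg₀.1)).trans ?_
    exact (add_le_add hj2 hk2).trans (ENNReal.add_halves ε).le

lemma tendsto_eLpNorm_linearComb {α E : Type*} [MeasurableSpace α] {μ : Measure α}
    [NormedAddCommGroup E] [NormedSpace ℝ E] {p₁ p₂ : ℕ → α → E} {h : ℕ → α → E} (a b : ℝ)
    (m₁ : ∀ k, AEStronglyMeasurable (p₁ k) μ) (m₂ : ∀ k, AEStronglyMeasurable (p₂ k) μ)
    (t₁ : Tendsto (fun k => eLpNorm (p₁ k) 2 μ) atTop (𝓝 0))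
    (t₂ : Tendsto (fun k => eLpNorm (p₂ k) 2 μ) atTop (𝓝 0))
    (hh : ∀ k, h k =ᵐ[μ] fun x => a • p₁ k x + b • p₂ k x) :
    Tendsto (fun k => eLpNorm (h k) 2 μ) atTop (𝓝 0) := by
  have t := (ENNReal.Tendsto.const_mul (a := ‖a‖ₑ) t₁ (Or.inr enorm_ne_top)).add
    (ENNReal.Tendsto.const_mul (a := ‖b‖ₑ) t₂ (Or.inr enorm_ne_top))
  rw [mul_zero, mul_zero, add_zero] at t
  refine tendsto_of_tendsto_of_tendsto_of_le_of_le tendsto_const_nhds t (fun _ => zero_le) ?_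
  intro k
  have := eLpNorm_add_le ((m₁ k).const_smul a) ((m₂ k).const_smul b) (p := 2) (by norm_num)
  rw [eLpNorm_const_smul, eLpNorm_const_smul] at this
  exact (eLpNorm_congr_ae (hh k)).trans_le this

lemma H1ClosureWith.linearComb {Ω : Set X} (hΩ : IsOpen Ω) {S : Set (X → ℝ)}
    (hS : ∀ φ ∈ S, ContDiffOn ℝ 1 φ Ω) {a b : ℝ}
    (hS' : ∀ φ ∈ S, ∀ ψ ∈ S, (fun x => a * φ x + b * ψ x) ∈ S)
    {f₁ f₂ : X → ℝ} {g₁ g₂ : X → X →L[ℝ] ℝ}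
    (h₁ : H1ClosureWith Ω S f₁ g₁) (h₂ : H1ClosureWith Ω S f₂ g₂) :
    H1ClosureWith Ω S (fun x => a * f₁ x + b * f₂ x) (fun x => a • g₁ x + b • g₂ x) := by
  obtain ⟨m₁, φ₁, hφ₁, t₁⟩ := h₁
  obtain ⟨m₂, φ₂, hφ₂, t₂⟩ := h₂
  refine ⟨m₁.linearComb m₂ a b, fun k x => a * φ₁ k x + b * φ₂ k x,
    fun k => hS' _ (hφ₁ k) _ (hφ₂ k), ?_, ?_⟩
  · refine tendsto_eLpNorm_linearComb a b
      (fun k => (aestronglyMeasurable_of_contDiffOn hΩ (hS _ (hφ₁ k))).1.sub m₁.1.1)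
      (fun k => (aestronglyMeasurable_of_contDiffOn hΩ (hS _ (hφ₂ k))).1.sub m₂.1.1) t₁.1 t₂.1
      fun k => Eventually.of_forall fun x => ?_
    simp only [Pi.sub_apply, smul_eq_mul]
    ring
  · refine tendsto_eLpNorm_linearComb a b
      (fun k => (aestronglyMeasurable_of_contDiffOn hΩ (hS _ (hφ₁ k))).2.sub m₁.2.2.1)
      (fun k => (aestronglyMeasurable_of_contDiffOn hΩ (hS _ (hφ₂ k))).2.sub m₂.2.2.1) t₁.2 t₂.2
      fun k => (ae_restrict_iff' hΩ.measurableSet).2 (Eventually.of_forall fun x hx => ?_)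
    have d₁ : DifferentiableAt ℝ (φ₁ k) x :=
      ((hS _ (hφ₁ k)).differentiableOn one_ne_zero).differentiableAt (hΩ.mem_nhds hx)
    have d₂ : DifferentiableAt ℝ (φ₂ k) x :=
      ((hS _ (hφ₂ k)).differentiableOn one_ne_zero).differentiableAt (hΩ.mem_nhds hx)
    simp only [Pi.sub_apply]
    rw [fderiv_fun_add (d₁.const_mul a) (d₂.const_mul b), fderiv_const_mul d₁, fderiv_const_mul d₂]
    module

end WeakDerivatives

end MEMS

/-! ### Mollification -/

namespace MEMS

set_option linter.unusedSectionVars false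

lemma eLpNorm_two_sq {α E : Type*} [MeasurableSpace α] {μ : Measure α} [NormedAddCommGroup E]
    (f : α → E) : eLpNorm f 2 μ ^ 2 = ∫⁻ x, ‖f x‖ₑ ^ 2 ∂μ := by
  have := eLpNorm_nnreal_pow_eq_lintegral (p := 2) (f := f) (μ := μ) (by norm_num)
  simpa only [NNReal.coe_ofNat, ENNReal.rpow_two, ENNReal.coe_ofNat] using this

lemma tendsto_eLpNorm_two_iff {ι α E : Type*} [MeasurableSpace α] {μ : Measure α}
    [NormedAddCommGroup E] {l : Filter ι} {f : ι → α → E} :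
    Tendsto (fun k => eLpNorm (f k) 2 μ) l (𝓝 0) ↔
      Tendsto (fun k => ∫⁻ x, ‖f k x‖ₑ ^ 2 ∂μ) l (𝓝 0) := by
  simp_rw [← eLpNorm_two_sq]
  constructor
  · intro h
    have := ENNReal.Tendsto.pow (n := 2) h
    simpa using this
  · intro h
    have := h.ennrpow_const (1 / 2)
    rw [ENNReal.zero_rpow_of_pos (by norm_num)] at this
    refine this.congr fun k => ?_
    rw [← ENNReal.rpow_natCast, ← ENNReal.rpow_mul]
    norm_num

section Mollification

variable {X : Type*} [NormedAddCommGroup X] [NormedSpace ℝ X] [MeasureSpace X] [BorelSpace X]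
  [FiniteDimensional ℝ X] [(volume : Measure X).IsAddHaarMeasure]
  {E : Type*} [NormedAddCommGroup E] [NormedSpace ℝ E] [CompleteSpace E]

/-- The mollification of `g` with the normalised bump function `η`. -/
noncomputable def mollify (η : ContDiffBump (0 : X)) (g : X → E) : X → E :=
  convolution (η.normed volume) g (ContinuousLinearMap.lsmul ℝ ℝ) volume

lemma mollify_apply (η : ContDiffBump (0 : X)) (g : X → E) (x : X) :
    mollify η g x = ∫ t, η.normed volume t • g (x - t) := rfl

lemma quasiMeasurePreserving_sub_left_volume (x : X) :
    Measure.QuasiMeasurePreserving (fun t : X => x - t) volume volume :=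
  quasiMeasurePreserving_sub_left volume x

lemma mollify_congr (η : ContDiffBump (0 : X)) {g g' : X → E} (h : g =ᵐ[volume] g') :
    mollify η g = mollify η g' := by
  ext x
  rw [mollify_apply, mollify_apply]
  refine integral_congr_ae ?_
  filter_upwards [(quasiMeasurePreserving_sub_left_volume x).ae_eq_comp h] with t ht
  simp only [Function.comp_def] at ht
  rw [ht]

/-- Translations are continuous in `L²`. -/
lemma tendsto_eLpNorm_translate {g : X → E} (hg : MemLp g 2 volume) :
    Tendsto (fun t : X => eLpNorm (fun x => g (x - t) - g x) 2 volume) (𝓝 0) (𝓝 0) := by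
  -- Currying makes the translations depend continuously on `t` in the compact-open topology, which
  -- is the form of continuity that composition on `Lp` requires.
  let F : C(X, C(X, X)) := ContinuousMap.curry ⟨fun p : X × X => p.2 - p.1, by fun_prop⟩
  have hF : ∀ t x, F t x = x - t := fun t x => rfl
  have hmp : ∀ t, MeasurePreserving (F t) volume volume := fun t =>
    measurePreserving_sub_right volume t
  have := Filter.Tendsto.compMeasurePreservingLp (f := fun _ : X => hg.toLp g) (l := 𝓝 0)
    tendsto_const_nhds (F.continuous.tendsto 0) hmp (hmp 0) (by norm_num)
  rw [Lp.tendsto_Lp_iff_tendsto_eLpNorm'] at this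
  refine this.congr fun t => eLpNorm_congr_ae ?_
  have e : ∀ t, (Lp.compMeasurePreserving (F t) (hmp t) (hg.toLp g) : X → E) =ᵐ[volume]
      fun x => g (x - t) := by
    intro t
    refine (Lp.coeFn_compMeasurePreserving _ (hmp t)).trans ?_
    exact (hmp t).quasiMeasurePreserving.ae_eq_comp hg.coeFn_toLp
  filter_upwards [e t, e 0] with x h1 h2
  simp only [Pi.sub_apply, h1, h2, sub_zero]

/-- Jensen's inequality for the square, obtained from the monotonicity of the `Lᵖ` norms over a
probability measure. -/
lemma enorm_integral_sq_le {α : Type*} [MeasurableSpace α] {ν : Measure α}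
    [IsProbabilityMeasure ν] {f : α → E} (hf : AEStronglyMeasurable f ν) :
    ‖∫ t, f t ∂ν‖ₑ ^ 2 ≤ ∫⁻ t, ‖f t‖ₑ ^ 2 ∂ν := by
  rw [← eLpNorm_two_sq]
  gcongr
  refine (enorm_integral_le_lintegral_enorm _).trans ?_
  rw [← eLpNorm_one_eq_lintegral_enorm]
  exact eLpNorm_le_eLpNorm_of_exponent_le (by norm_num) hf

/-- The probability measure with density `η`. -/
noncomputable def bumpMeasure (η : ContDiffBump (0 : X)) : Measure X :=
  volume.withDensity fun t => ENNReal.ofReal (η.normed volume t)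

lemma measurable_bump (η : ContDiffBump (0 : X)) :
    Measurable fun t => ENNReal.ofReal (η.normed volume t) :=
  (η.continuous_normed.measurable).ennreal_ofReal

instance (η : ContDiffBump (0 : X)) : IsProbabilityMeasure (bumpMeasure η) := by
  constructor
  rw [bumpMeasure, withDensity_apply _ MeasurableSet.univ, Measure.restrict_univ,
    ← ofReal_integral_eq_lintegral_ofReal η.integrable_normed
      (Eventually.of_forall fun x => η.nonneg_normed x), η.integral_normed, ENNReal.ofReal_one]

lemma integral_bumpMeasure (η : ContDiffBump (0 : X)) (f : X → E) :
    ∫ t, f t ∂(bumpMeasure η) = ∫ t, η.normed volume t • f t := by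
  rw [bumpMeasure, integral_withDensity_eq_integral_toReal_smul (measurable_bump η)
    (Eventually.of_forall fun _ => ENNReal.ofReal_lt_top)]
  simp_rw [ENNReal.toReal_ofReal (η.nonneg_normed _)]

lemma integrable_bumpMeasure (η : ContDiffBump (0 : X)) {f : X → E} (hf : LocallyIntegrable f) :
    Integrable f (bumpMeasure η) := by
  rw [bumpMeasure, integrable_withDensity_iff_integrable_smul' (measurable_bump η)
    (Eventually.of_forall fun _ => ENNReal.ofReal_lt_top)]
  simp_rw [ENNReal.toReal_ofReal (η.nonneg_normed _)]
  exact hf.integrable_smul_left_of_hasCompactSupport η.continuous_normed η.hasCompactSupport_normed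

lemma ae_bumpMeasure_mem_ball (η : ContDiffBump (0 : X)) :
    ∀ᵐ t ∂(bumpMeasure η), t ∈ Metric.ball (0 : X) η.rOut := by
  rw [bumpMeasure, ae_withDensity_iff (measurable_bump η)]
  refine Eventually.of_forall fun t ht => ?_
  rw [← η.support_normed_eq (μ := volume)]
  intro h
  exact ht (by rw [h, ENNReal.ofReal_zero])

lemma locallyIntegrable_of_memLp {g : X → E} (hg : MemLp g 2 volume) : LocallyIntegrable g :=
  hg.locallyIntegrable (by norm_num)

lemma locallyIntegrable_sub_left {g : X → E} (hg : MemLp g 2 volume) (x : X) :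
    LocallyIntegrable fun t => g (x - t) :=
  locallyIntegrable_of_memLp (hg.comp_measurePreserving (volume.measurePreserving_sub_left x))

/-- The error of mollification is an average of translation differences `g(x - t) - g(x)`. Jensen
inside and Tonelli outside bound its `L²` norm by that of the worst translation in the support of
the bump. -/
lemma mollify_sub_sq_le (η : ContDiffBump (0 : X)) {g : X → E} (hg : MemLp g 2 volume)
    (hgm : StronglyMeasurable g) {c : ℝ≥0∞}
    (hc : ∀ t ∈ Metric.ball (0 : X) η.rOut, eLpNorm (fun x => g (x - t) - g x) 2 volume ≤ c) :
    eLpNorm (fun x => mollify η g x - g x) 2 volume ≤ c := by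
  have key : eLpNorm (fun x => mollify η g x - g x) 2 volume ^ 2 ≤ c ^ 2 := by
    rw [eLpNorm_two_sq]
    have p : ∀ x, mollify η g x - g x = ∫ t, (g (x - t) - g x) ∂(bumpMeasure η) := by
      intro x
      rw [integral_sub (integrable_bumpMeasure η (locallyIntegrable_sub_left hg x))
        (integrable_const _), integral_bumpMeasure, mollify_apply]
      simp
    have hm : StronglyMeasurable fun p : X × X => g (p.1 - p.2) - g p.1 :=
      (hgm.comp_measurable (measurable_fst.sub measurable_snd)).sub
        (hgm.comp_measurable measurable_fst)
    calc ∫⁻ x, ‖mollify η g x - g x‖ₑ ^ 2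
        ≤ ∫⁻ x, ∫⁻ t, ‖g (x - t) - g x‖ₑ ^ 2 ∂(bumpMeasure η) := by
          refine lintegral_mono fun x => ?_
          simp only
          rw [p]
          exact enorm_integral_sq_le
            (hm.comp_measurable (measurable_const.prodMk measurable_id)).aestronglyMeasurable
      _ = ∫⁻ t, (∫⁻ x, ‖g (x - t) - g x‖ₑ ^ 2) ∂(bumpMeasure η) := by
          rw [lintegral_lintegral_swap]
          exact (hm.enorm.pow_const 2).aemeasurable
      _ ≤ ∫⁻ t, c ^ 2 ∂(bumpMeasure η) := by
          refine lintegral_mono_ae ?_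
          filter_upwards [ae_bumpMeasure_mem_ball η] with t ht
          rw [← eLpNorm_two_sq]
          gcongr
          exact hc t ht
      _ = c ^ 2 := by simp
  exact (ENNReal.pow_le_pow_left_iff two_ne_zero).1 key

lemma tendsto_mollify {g : X → E} (hg : MemLp g 2 volume) {η : ℕ → ContDiffBump (0 : X)}
    (hη : Tendsto (fun k => (η k).rOut) atTop (𝓝 0)) :
    Tendsto (fun k => eLpNorm (fun x => mollify (η k) g x - g x) 2 volume) atTop (𝓝 0) := by
  -- Tonelli needs joint measurability of `(x, t) ↦ g(x - t) - g(x)`, hence a strongly measurable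
  -- representative; the mollification does not see the change.
  set g' := hg.1.mk g with hg'
  have hgg : g =ᵐ[volume] g' := hg.1.ae_eq_mk
  have hm : MemLp g' 2 volume := hg.ae_eq hgg
  have e : ∀ k, eLpNorm (fun x => mollify (η k) g x - g x) 2 volume =
      eLpNorm (fun x => mollify (η k) g' x - g' x) 2 volume := by
    intro k
    rw [mollify_congr _ hgg]
    refine eLpNorm_congr_ae ?_
    filter_upwards [hgg] with x hx
    rw [hx]
  simp_rw [e]
  rw [ENNReal.tendsto_nhds_zero]
  intro ε hε
  obtain ⟨r, hr, hball⟩ := Metric.eventually_nhds_iff_ball.1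
    (ENNReal.tendsto_nhds_zero.1 (tendsto_eLpNorm_translate hm) ε hε)
  filter_upwards [(tendsto_order.1 hη).2 r hr] with k hk
  exact mollify_sub_sq_le _ hm hg.1.stronglyMeasurable_mk fun t ht =>
    hball t (Metric.ball_subset_ball hk.le ht)

lemma contDiff_mollify (η : ContDiffBump (0 : X)) {g : X → E} (hg : MemLp g 2 volume) :
    ContDiff ℝ ∞ (mollify η g) :=
  η.hasCompactSupport_normed.contDiff_convolution_left (n := (⊤ : ℕ∞)) _ η.contDiff_normed
    (locallyIntegrable_of_memLp hg)

lemma isTestFunction_bump_sub (η : ContDiffBump (0 : X)) (x : X) :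
    IsTestFunction univ fun y => η.normed volume (x - y) := by
  refine ⟨η.contDiff_normed.comp (contDiff_const.sub contDiff_id), ?_, subset_univ _⟩
  exact η.hasCompactSupport_normed.comp_homeomorph (Homeomorph.subLeft x)

/-- The derivative of the convolution falls on the bump. As a function of `y`, `η(x - y)` is a test
function, so the weak formula moves the derivative to `f`; the sign of the formula cancels that of
`x - y`. -/
lemma fderiv_mollify (η : ContDiffBump (0 : X)) {f : X → ℝ} {g : X → X →L[ℝ] ℝ}
    (h : MemH1With univ f g) (x : X) :
    fderiv ℝ (mollify η f) x = mollify η g x := by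
  have hf : MemLp f 2 volume := by simpa using h.1
  have hg : MemLp g 2 volume := by simpa using h.2.2
  have hd := η.hasCompactSupport_normed.hasFDerivAt_convolution_left
    (ContinuousLinearMap.lsmul ℝ ℝ) (η.contDiff_normed (μ := volume) (n := 1))
    (locallyIntegrable_of_memLp hf) x
  rw [mollify, hd.fderiv]
  ext v
  have hcont : Continuous (fderiv ℝ (η.normed volume)) :=
    (η.contDiff_normed (μ := volume) (n := 1)).continuous_fderiv one_ne_zero
  have hcs : HasCompactSupport (fderiv ℝ (η.normed volume)) :=
    η.hasCompactSupport_normed.fderiv ℝ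
  have hint := (hcs.convolutionExists_left (ContinuousLinearMap.precompL X
    (ContinuousLinearMap.lsmul ℝ ℝ : ℝ →L[ℝ] ℝ →L[ℝ] ℝ)) hcont
    (locallyIntegrable_of_memLp hf)) x
  have hintg := (η.hasCompactSupport_normed.convolutionExists_left
    (ContinuousLinearMap.lsmul ℝ ℝ : ℝ →L[ℝ] (X →L[ℝ] ℝ) →L[ℝ] (X →L[ℝ] ℝ))
    (η.continuous_normed (μ := volume)) (locallyIntegrable_of_memLp hg)) x
  have key := h.weakFormula _ (isTestFunction_bump_sub η x) v
  rw [Measure.restrict_univ] at key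
  have hfd : ∀ y, fderiv ℝ (fun y => η.normed volume (x - y)) y v =
      - fderiv ℝ (η.normed volume) (x - y) v := by
    intro y
    have h1 : HasFDerivAt (η.normed volume) (fderiv ℝ (η.normed volume) (x - y)) (x - y) :=
      ((η.contDiff_normed (μ := volume) (n := 1)).differentiable one_ne_zero _).hasFDerivAt
    have h2 : HasFDerivAt (fun y => x - y) (-(ContinuousLinearMap.id ℝ X)) y :=
      (hasFDerivAt_id y).const_sub x
    have h3 : HasFDerivAt (fun y => η.normed volume (x - y)) _ y := h1.comp y h2
    rw [h3.fderiv]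
    simp
  simp_rw [hfd] at key
  have lhs : (convolution (fderiv ℝ (η.normed volume)) f
      (ContinuousLinearMap.precompL X (ContinuousLinearMap.lsmul ℝ ℝ)) volume x) v =
      ∫ y, f y * fderiv ℝ (η.normed volume) (x - y) v := by
    rw [convolution_def, ContinuousLinearMap.integral_apply hint, ← integral_sub_left_eq_self _ _ x]
    refine integral_congr_ae (Eventually.of_forall fun y => ?_)
    simp [mul_comm]
  have rhs : (mollify η g x) v = ∫ y, η.normed volume (x - y) * g y v := by
    rw [mollify, convolution_def, ContinuousLinearMap.integral_apply hintg,
      ← integral_sub_left_eq_self _ _ x]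
    refine integral_congr_ae (Eventually.of_forall fun y => ?_)
    simp
  rw [rhs]
  refine lhs.trans ?_
  simp only [mul_neg, integral_neg] at key
  linarith

lemma tsupport_mollify_subset (η : ContDiffBump (0 : X)) (g : X → E) {K : Set X}
    (hK : Function.support g ⊆ K) : tsupport (mollify η g) ⊆ Metric.cthickening η.rOut K := by
  refine closure_minimal ?_ Metric.isClosed_cthickening
  intro x hx
  obtain ⟨a, ha, b, hb, rfl⟩ := support_convolution_subset _ hx
  rw [η.support_normed_eq] at ha
  refine Metric.mem_cthickening_of_dist_le _ b _ _ (hK hb) ?_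
  rw [dist_eq_norm, add_sub_cancel_right]
  exact (mem_ball_zero_iff.1 ha).le

lemma dist_mollify_le (η : ContDiffBump (0 : X)) {g : X → E} (hg : MemLp g 2 volume) {x : X} {ε : ℝ}
    (h : ∀ y ∈ Metric.ball x η.rOut, dist (g y) (g x) ≤ ε) : dist (mollify η g x) (g x) ≤ ε :=
  η.dist_normed_convolution_le hg.1 h

lemma exists_bump_seq (X : Type*) [NormedAddCommGroup X] [NormedSpace ℝ X] :
    ∃ η : ℕ → ContDiffBump (0 : X), Tendsto (fun k => (η k).rOut) atTop (𝓝 0) := by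
  refine ⟨fun k => ⟨1 / (k + 1) / 2, 1 / (k + 1), by positivity, half_lt_self (by positivity)⟩, ?_⟩
  exact tendsto_one_div_add_atTop_nhds_zero_nat

end Mollification

end MEMS

/-! ### Cutoffs and the chain rule for continuous `H¹` functions -/

namespace MEMS

set_option linter.unusedSectionVars false

section ChainRule

variable {X : Type*} [NormedAddCommGroup X] [NormedSpace ℝ X] [MeasureSpace X] [BorelSpace X]
  [FiniteDimensional ℝ X] [(volume : Measure X).IsAddHaarMeasure]

lemma exists_cutoff {K Ω : Set X} (hK : IsCompact K) (hΩ : IsOpen Ω) (hKΩ : K ⊆ Ω) :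
    ∃ ζ : X → ℝ, IsTestFunction Ω ζ ∧ (∀ᶠ x in 𝓝ˢ K, ζ x = 1) ∧ ∀ x, ζ x ∈ Icc (0 : ℝ) 1 := by
  obtain ⟨L, hL, hKL, hLΩ⟩ := exists_compact_between hK hΩ hKΩ
  obtain ⟨f, hf1, hf0, hf⟩ := exists_contMDiffMap_one_nhds_of_subset_interior
    (modelWithCornersSelf ℝ X) (n := (⊤ : ℕ∞)) hK.isClosed hKL
  have hts : tsupport f ⊆ L := closure_minimal
    (fun x hx => by_contra fun h => hx (hf0 x h)) hL.isClosed
  exact ⟨f, ⟨f.contMDiff.contDiff, hL.of_isClosed_subset (isClosed_tsupport _) hts,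
    hts.trans hLΩ⟩, hf1, hf⟩

lemma IsTestFunction.mul {Ω Ω' : Set X} {ζ φ : X → ℝ} (hζ : IsTestFunction Ω ζ)
    (hφ : IsTestFunction Ω' φ) : IsTestFunction Ω fun x => ζ x * φ x :=
  ⟨hζ.1.mul hφ.1, hζ.2.1.mul_right, (tsupport_mul_subset_left).trans hζ.2.2⟩

lemma memLp_univ_of_eq_zero {E : Type*} [NormedAddCommGroup E] {Ω : Set X} (hΩ : IsOpen Ω)
    {f : X → E} (hf : MemLp f 2 (volume.restrict Ω)) (h0 : ∀ x ∉ Ω, f x = 0) :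
    MemLp f 2 volume := by
  rw [← memLp_indicator_iff_restrict hΩ.measurableSet] at hf
  convert hf using 1
  ext x
  by_cases hx : x ∈ Ω
  · rw [indicator_of_mem hx]
  · rw [indicator_of_notMem hx, h0 x hx]

lemma memLp_fun_add {α E : Type*} [MeasurableSpace α] {μ : Measure α} [NormedAddCommGroup E]
    {f g : α → E} (hf : MemLp f 2 μ) (hg : MemLp g 2 μ) : MemLp (fun x => f x + g x) 2 μ :=
  hf.add hg

/-- The product rule, from the weak formula tested with `ζφ`. Since `ζ` has compact support in `Ω`,
the product lives on the whole space, where mollification is available. -/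
lemma MemH1With.cutoff {Ω : Set X} (hΩ : IsOpen Ω) {f : X → ℝ} {g : X → X →L[ℝ] ℝ}
    (h : MemH1With Ω f g) {ζ : X → ℝ} (hζ : IsTestFunction Ω ζ) :
    MemH1With univ (fun x => ζ x * f x) (fun x => ζ x • g x + f x • fderiv ℝ ζ x) := by
  have m1 : MemLp (fun x => ζ x * f x) 2 (volume.restrict Ω) :=
    MemLp.mul (p := ∞) (q := 2) h.1 (hζ.memLp (p := ∞))
  have m2 : MemLp (fun x => ζ x • g x) 2 (volume.restrict Ω) :=
    MemLp.smul (p := ∞) (q := 2) h.2.2 (hζ.memLp (p := ∞))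
  have m3 : MemLp (fun x => f x • fderiv ℝ ζ x) 2 (volume.restrict Ω) :=
    MemLp.smul (p := 2) (q := ∞) (hζ.memLp_fderiv (p := ∞)) h.1
  have m4 : MemLp (fun x => ζ x • g x + f x • fderiv ℝ ζ x) 2 (volume.restrict Ω) :=
    memLp_fun_add m2 m3
  have z1 : ∀ x ∉ Ω, ζ x * f x = 0 := fun x hx => by rw [hζ.eq_zero hx, zero_mul]
  have z2 : ∀ x ∉ Ω, ζ x • g x + f x • fderiv ℝ ζ x = 0 := fun x hx => by
    rw [hζ.eq_zero hx, hζ.fderiv_eq_zero hx, zero_smul, smul_zero, add_zero]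
  refine MemH1With.of_weakFormula ?_ ?_ ?_
  · rw [Measure.restrict_univ]
    exact memLp_univ_of_eq_zero hΩ m1 z1
  · rw [Measure.restrict_univ]
    exact memLp_univ_of_eq_zero hΩ m4 z2
  · intro φ hφ v
    have r1 : ∫ x in Ω, ζ x * f x * fderiv ℝ φ x v = ∫ x, ζ x * f x * fderiv ℝ φ x v :=
      setIntegral_eq_integral_of_forall_compl_eq_zero fun x hx => by rw [z1 x hx, zero_mul]
    have r2 : ∫ x in Ω, φ x * (ζ x • g x + f x • fderiv ℝ ζ x) v =
        ∫ x, φ x * (ζ x • g x + f x • fderiv ℝ ζ x) v :=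
      setIntegral_eq_integral_of_forall_compl_eq_zero fun x hx => by rw [z2 x hx]; simp
    rw [Measure.restrict_univ]
    simp only
    rw [← r1, ← r2]
    have key := h.weakFormula _ (hζ.mul hφ) v
    have hd : ∀ x, fderiv ℝ (fun x => ζ x * φ x) x v =
        ζ x * fderiv ℝ φ x v + φ x * fderiv ℝ ζ x v := by
      intro x
      rw [fderiv_fun_mul ((hζ.1.differentiable (by simp)) x) ((hφ.1.differentiable (by simp)) x)]
      simp
    simp_rw [hd] at key
    have i1 : Integrable (fun x => f x * (ζ x * fderiv ℝ φ x v)) (volume.restrict Ω) :=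
      h.1.integrable_mul (MemLp.mul (p := ∞) (q := 2) (r := 2) (hφ.memLp_fderiv_apply v (p := 2))
        (hζ.memLp (p := ∞)))
    have i2 : Integrable (fun x => f x * (φ x * fderiv ℝ ζ x v)) (volume.restrict Ω) :=
      h.1.integrable_mul (MemLp.mul (p := ∞) (q := 2) (r := 2) (hζ.memLp_fderiv_apply v (p := 2))
        (hφ.memLp (p := ∞)))
    have i3 : Integrable (fun x => ζ x * φ x * g x v) (volume.restrict Ω) :=
      ((hζ.mul hφ).memLp (p := 2)).integrable_mul (MemLp.clm_apply h.2.2 v)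
    have e1 : ∫ x in Ω, f x * (ζ x * fderiv ℝ φ x v + φ x * fderiv ℝ ζ x v) =
        (∫ x in Ω, f x * (ζ x * fderiv ℝ φ x v)) + ∫ x in Ω, f x * (φ x * fderiv ℝ ζ x v) := by
      rw [← integral_add i1 i2]
      simp_rw [mul_add]
    have e2 : ∫ x in Ω, φ x * (ζ x • g x + f x • fderiv ℝ ζ x) v =
        (∫ x in Ω, ζ x * φ x * g x v) + ∫ x in Ω, f x * (φ x * fderiv ℝ ζ x v) := by
      rw [← integral_add i3 i2]
      refine integral_congr_ae (Eventually.of_forall fun x => ?_)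
      simp
      ring
    have e3 : ∫ x in Ω, ζ x * f x * fderiv ℝ φ x v = ∫ x in Ω, f x * (ζ x * fderiv ℝ φ x v) :=
      integral_congr_ae (Eventually.of_forall fun x => by simp; ring)
    rw [e1] at key
    rw [e2, e3]
    linarith

lemma IsTestFunction.continuous_mul {Ω : Set X} (hΩ : IsOpen Ω) {f ζ : X → ℝ}
    (hf : ContinuousOn f Ω) (hζ : IsTestFunction Ω ζ) : Continuous fun x => ζ x * f x := by
  refine continuous_of_tsupport fun x hx => ?_
  have hx' : x ∈ Ω := hζ.2.2 (tsupport_mul_subset_left hx)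
  exact hζ.1.continuous.continuousAt.mul (hf.continuousAt (hΩ.mem_nhds hx'))

/-- Local approximation by smooth functions. -/
lemma MemH1With.exists_smooth_approx {Ω : Set X} (hΩ : IsOpen Ω) {f : X → ℝ} {g : X → X →L[ℝ] ℝ}
    (h : MemH1With Ω f g) (hf : ContinuousOn f Ω) {K : Set X} (hK : IsCompact K) (hKΩ : K ⊆ Ω)
    {ε : ℝ} (hε : 0 < ε) : ∃ w : X → ℝ, ContDiff ℝ ∞ w ∧ (∀ x ∈ K, dist (w x) (f x) ≤ ε) ∧
      eLpNorm (fun x => fderiv ℝ w x - g x) 2 (volume.restrict K) ≤ ENNReal.ofReal ε := by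
  obtain ⟨ζ, hζ, hζ1, -⟩ := exists_cutoff hK hΩ hKΩ
  have hc := h.cutoff hΩ hζ
  set f' : X → ℝ := fun x => ζ x * f x
  set g' : X → X →L[ℝ] ℝ := fun x => ζ x • g x + f x • fderiv ℝ ζ x
  have hf' : Continuous f' := hζ.continuous_mul hΩ hf
  have hcs : HasCompactSupport f' := hζ.2.1.mul_right
  have hu := hcs.uniformContinuous_of_continuous hf'
  obtain ⟨r, hr, hru⟩ := Metric.uniformContinuous_iff.1 hu ε hε
  have mf : MemLp f' 2 volume := by simpa using hc.1
  have mg : MemLp g' 2 volume := by simpa using hc.2.2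
  obtain ⟨η, hη⟩ := exists_bump_seq X
  obtain ⟨k, hk1, hk2⟩ := (((tendsto_order.1 hη).2 r hr).and
    (ENNReal.tendsto_nhds_zero.1 (tendsto_mollify mg hη) (ENNReal.ofReal ε)
      (ENNReal.ofReal_pos.2 hε))).exists
  refine ⟨mollify (η k) f', contDiff_mollify _ mf, fun x hx => ?_, ?_⟩
  · have e : f x = f' x := by
      have := hζ1.self_of_nhdsSet x hx
      simp [f', this]
    rw [e]
    refine dist_mollify_le _ mf fun y hy => (hru ?_).le
    exact (Metric.mem_ball.1 hy).trans hk1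
  · refine le_trans ?_ hk2
    refine le_trans (le_of_eq (eLpNorm_congr_ae ?_)) (eLpNorm_mono_measure _ Measure.restrict_le_self)
    refine (ae_restrict_iff' hK.measurableSet).2 (Eventually.of_forall fun x hx => ?_)
    have h1 : ζ =ᶠ[𝓝 x] fun _ => 1 := (eventually_nhdsSet_iff_forall.1 hζ1) x hx
    have e : g' x = g x := by
      simp only [g']
      rw [h1.fderiv_eq, h1.self_of_nhds]
      simp
    simp only
    rw [fderiv_mollify _ hc, e]

lemma integrable_of_continuousOn_tsupport {φ f : X → ℝ} (hφ : HasCompactSupport φ)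
    (hf : ContinuousOn f (tsupport φ)) (h0 : ∀ x ∉ tsupport φ, f x = 0) : Integrable f := by
  rw [← integrableOn_iff_integrable_of_support_subset (s := tsupport φ)]
  · exact hf.integrableOn_compact hφ
  · exact fun x hx => by_contra fun h => hx (h0 x h)

/-- The classical chain rule, tested with a test function. -/
lemma integral_comp_smooth {Ω : Set X} (hΩ : IsOpen Ω) {a : ℝ} {F : X × ℝ → ℝ}
    (hF : ContDiffOn ℝ 1 F (Ω ×ˢ Ici a)) {w : X → ℝ} (hw : ContDiff ℝ ∞ w) {φ : X → ℝ}
    (hφ : IsTestFunction Ω φ) (haw : ∀ x ∈ tsupport φ, a < w x) (v : X) :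
    ∫ x in tsupport φ, F (x, w x) * fderiv ℝ φ x v = - ∫ x in tsupport φ,
      φ x * fderivWithin ℝ F (Ω ×ˢ Ici a) (x, w x) (v, fderiv ℝ w x v) := by
  -- The strict inequality `a < w` puts the graph of `w` over `O` into the interior of `Ω × [a, ∞)`,
  -- so that the derivative within this set is the ordinary one and the classical chain rule
  -- applies.
  set O : Set X := Ω ∩ {x | a < w x} with hO
  have hOo : IsOpen O := hΩ.inter (isOpen_lt continuous_const hw.continuous)
  have hKO : tsupport φ ⊆ O := fun x hx => ⟨hφ.2.2 hx, haw x hx⟩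
  set P : X → ℝ := fun x => F (x, w x)
  have hFi : ∀ x ∈ O, Ω ×ˢ Ici a ∈ 𝓝 (x, w x) := fun x hx =>
    prod_mem_nhds (hΩ.mem_nhds hx.1) (Ici_mem_nhds hx.2)
  have hP : ContDiffOn ℝ 1 P O := by
    refine hF.comp (contDiff_id.prodMk (hw.of_le (by simp))).contDiffOn ?_
    exact fun x hx => ⟨hx.1, (le_of_lt hx.2 : a ≤ w x)⟩
  have hPd : ∀ x ∈ O, fderiv ℝ P x v =
      fderivWithin ℝ F (Ω ×ˢ Ici a) (x, w x) (v, fderiv ℝ w x v) := by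
    intro x hx
    have h1 : HasFDerivAt F (fderiv ℝ F (x, w x)) (x, w x) :=
      ((hF.contDiffAt (hFi x hx)).differentiableAt one_ne_zero).hasFDerivAt
    have h2 : HasFDerivAt (fun x => (x, w x)) ((ContinuousLinearMap.id ℝ X).prod (fderiv ℝ w x)) x :=
      (hasFDerivAt_id x).prodMk (hw.differentiable (by simp) x).hasFDerivAt
    have h3 : HasFDerivAt P _ x := h1.comp x h2
    rw [h3.fderiv, fderivWithin_of_mem_nhds (hFi x hx)]
    simp
  have z0 : ∀ x ∉ tsupport φ, φ x = 0 := fun x hx => image_eq_zero_of_notMem_tsupport hx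
  have z1 : ∀ x ∉ tsupport φ, fderiv ℝ φ x v = 0 := fun x hx => by
    rw [image_eq_zero_of_notMem_tsupport fun h' => hx (tsupport_fderiv_subset ℝ h')]
    rfl
  have hφc : Continuous φ := hφ.1.continuous
  have hφd : Continuous fun x => fderiv ℝ φ x v := hφ.continuous_fderiv.clm_apply continuous_const
  have hPc : ContinuousOn P (tsupport φ) := hP.continuousOn.mono hKO
  have hPdc : ContinuousOn (fun x => fderiv ℝ P x v) (tsupport φ) :=
    ((hP.continuousOn_fderiv_of_isOpen hOo le_rfl).mono hKO).clm_apply continuousOn_const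
  have key := integral_mul_fderiv_eq_neg_fderiv_mul_of_integrable (μ := volume) (f := P) (g := φ)
    (v := v)
    (integrable_of_continuousOn_tsupport hφ.2.1 (hPdc.mul hφc.continuousOn)
      fun x hx => by rw [z0 x hx, mul_zero])
    (integrable_of_continuousOn_tsupport hφ.2.1 (hPc.mul hφd.continuousOn)
      fun x hx => by rw [z1 x hx, mul_zero])
    (integrable_of_continuousOn_tsupport hφ.2.1 (hPc.mul hφc.continuousOn)
      fun x hx => by rw [z0 x hx, mul_zero])
    (fun x hx => (hP.contDiffAt (hOo.mem_nhds (hKO hx))).differentiableAt one_ne_zero)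
    (fun x _ => hφ.1.differentiable (by simp) x)
  rw [setIntegral_eq_integral_of_forall_compl_eq_zero, key,
    ← setIntegral_eq_integral_of_forall_compl_eq_zero (s := tsupport φ)]
  · congr 1
    refine setIntegral_congr_fun (isClosed_tsupport φ).measurableSet fun x hx => ?_
    simp only [hPd x (hKO hx), mul_comm]
  · exact fun x hx => by rw [z0 x hx, mul_zero]
  · exact fun x hx => by rw [z1 x hx, mul_zero]

end ChainRule

end MEMS

namespace MEMS

set_option linter.unusedSectionVars false

section ChainRule

variable {X : Type*} [NormedAddCommGroup X] [NormedSpace ℝ X] [MeasureSpace X] [BorelSpace X]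
  [FiniteDimensional ℝ X] [(volume : Measure X).IsAddHaarMeasure]

/-- Over a finite measure the `L²` norm controls the `L¹` norm. -/
lemma tendsto_integral_zero_of_eLpNorm_two {α : Type*} [MeasurableSpace α] {μ : Measure α}
    [IsFiniteMeasure μ] {E : Type*} [NormedAddCommGroup E] {f : ℕ → α → ℝ} {G : ℕ → α → E} {C : ℝ}
    (hG : ∀ k, AEStronglyMeasurable (G k) μ)
    (h : Tendsto (fun k => eLpNorm (G k) 2 μ) atTop (𝓝 0))
    (hf : ∀ k, ∀ᵐ x ∂μ, ‖f k x‖ ≤ C * ‖G k x‖) :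
    Tendsto (fun k => ∫ x, f k x ∂μ) atTop (𝓝 0) := by
  rw [tendsto_zero_iff_enorm_tendsto_zero]
  have hlim : Tendsto (fun k => ENNReal.ofReal C * (eLpNorm (G k) 2 μ *
      μ univ ^ (1 / (1 : ℝ≥0∞).toReal - 1 / (2 : ℝ≥0∞).toReal))) atTop (𝓝 0) := by
    have hfin : μ univ ^ (1 / (1 : ℝ≥0∞).toReal - 1 / (2 : ℝ≥0∞).toReal) ≠ ⊤ :=
      ENNReal.rpow_ne_top_of_nonneg (by norm_num) (measure_ne_top _ _)
    have := ENNReal.Tendsto.const_mul (a := ENNReal.ofReal C)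
      (ENNReal.Tendsto.mul_const h (Or.inr hfin)) (Or.inr ENNReal.ofReal_ne_top)
    rwa [zero_mul, mul_zero] at this
  refine tendsto_of_tendsto_of_tendsto_of_le_of_le tendsto_const_nhds hlim (fun _ => zero_le) ?_
  intro k
  refine (enorm_integral_le_lintegral_enorm _).trans ?_
  rw [← eLpNorm_one_eq_lintegral_enorm]
  refine (eLpNorm_le_mul_eLpNorm_of_ae_le_mul (hf k) 1).trans ?_
  exact mul_le_mul_right (eLpNorm_le_eLpNorm_mul_rpow_measure_univ (by norm_num) (hG k)) _

/-- The chain rule for the composition of a `C¹` function with a continuous function which has a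
weak derivative in `L²`. -/
lemma WeakFormula.comp {Ω : Set X} (hΩ : IsOpen Ω) {u : X → ℝ} {γ : X → X →L[ℝ] ℝ}
    (h : MemH1With Ω u γ) (hu : ContinuousOn u Ω) {a : ℝ} (ha : ∀ x ∈ Ω, a ≤ u x)
    {F : X × ℝ → ℝ} (hF : ContDiffOn ℝ 1 F (Ω ×ˢ Ici a)) :
    WeakFormula Ω (fun x => F (x, u x)) fun x =>
      (fderivWithin ℝ F (Ω ×ˢ Ici a) (x, u x)).comp ((ContinuousLinearMap.id ℝ X).prod (γ x)) := by
  intro φ hφ v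
  set S := Ω ×ˢ Ici a with hS
  set DF := fderivWithin ℝ F S with hDF
  set K := tsupport φ with hKdef
  have hK : IsCompact K := hφ.2.1
  have hKΩ : K ⊆ Ω := hφ.2.2
  have hKm : MeasurableSet K := hK.measurableSet
  have hDFc : ContinuousOn DF S :=
    hF.continuousOn_fderivWithin (hΩ.uniqueDiffOn.prod (uniqueDiffOn_Ici a)) le_rfl
  have z0 : ∀ x ∉ K, φ x = 0 := fun x hx => image_eq_zero_of_notMem_tsupport hx
  have z1 : ∀ x ∉ K, fderiv ℝ φ x v = 0 := fun x hx => by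
    rw [image_eq_zero_of_notMem_tsupport fun h' => hx (tsupport_fderiv_subset ℝ h')]
    rfl
  have red : ∀ f : X → ℝ, (∀ x ∉ K, f x = 0) → ∫ x in Ω, f x = ∫ x in K, f x := by
    intro f hf
    rw [setIntegral_eq_integral_of_forall_compl_eq_zero hf,
      setIntegral_eq_integral_of_forall_compl_eq_zero fun x hx => hf x fun h' => hx (hKΩ h')]
  rw [red _ fun x hx => by rw [z1 x hx, mul_zero], red _ fun x hx => by rw [z0 x hx, zero_mul]]
  -- the approximating sequence
  have hε : ∀ k : ℕ, (0 : ℝ) < 1 / (k + 1) := fun k => by positivity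
  choose w' hw' hwd' hwg' using fun k => h.exists_smooth_approx hΩ hu hK hKΩ (hε k)
  -- `F` is only given on `[a, ∞)` and `u` may attain `a`. As `w'` is within `1/(k+1)` of `u` on
  -- `K`, this shift places `w` between `u + 1/(k+1)` and `u + 3/(k+1)`: strictly above `a`, and in
  -- a fixed compact strip of height `3` above the graph of `u`.
  set w : ℕ → X → ℝ := fun k x => w' k x + 2 * (1 / ((k : ℝ) + 1)) with hw_def
  have hw : ∀ k, ContDiff ℝ ∞ (w k) := fun k => (hw' k).add contDiff_const
  have hwf : ∀ k x, fderiv ℝ (w k) x = fderiv ℝ (w' k) x := fun k x => by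
    simp only [hw_def]
    rw [fderiv_add_const]
  have hb : ∀ k : ℕ, ∀ x ∈ K, u x + 1 / ((k : ℝ) + 1) ≤ w k x ∧ w k x ≤ u x + 3 * (1 / ((k : ℝ) + 1)) := by
    intro k x hx
    have := abs_le.1 (hwd' k x hx)
    simp only [hw_def]
    constructor <;> linarith [this.1, this.2]
  have haw : ∀ k, ∀ x ∈ K, a < w k x := fun k x hx => by
    linarith [(hb k x hx).1, hε k, ha x (hKΩ hx)]
  have hlim : ∀ x ∈ K, Tendsto (fun k => w k x) atTop (𝓝 (u x)) := by
    intro x hx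
    have l : Tendsto (fun k : ℕ => 1 / ((k : ℝ) + 1)) atTop (𝓝 0) :=
      tendsto_one_div_add_atTop_nhds_zero_nat
    refine tendsto_of_tendsto_of_tendsto_of_le_of_le (g := fun k : ℕ => u x + 1 / ((k : ℝ) + 1))
      (h := fun k : ℕ => u x + 3 * (1 / ((k : ℝ) + 1))) ?_ ?_ (fun k => (hb k x hx).1)
      fun k => (hb k x hx).2
    · simpa using l.const_add (u x)
    · simpa using (l.const_mul 3).const_add (u x)
  have hmem : ∀ k, ∀ x ∈ K, (x, w k x) ∈ S := fun k x hx => ⟨hKΩ hx, (haw k x hx).le⟩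
  have hmemu : ∀ x ∈ K, (x, u x) ∈ S := fun x hx => ⟨hKΩ hx, ha x (hKΩ hx)⟩
  have htend : ∀ x ∈ K, Tendsto (fun k => ((x, w k x) : X × ℝ)) atTop (𝓝[S] (x, u x)) := by
    intro x hx
    rw [tendsto_nhdsWithin_iff]
    exact ⟨tendsto_const_nhds.prodMk_nhds (hlim x hx), Eventually.of_forall fun k => hmem k x hx⟩
  -- bounds
  set C : Set (X × ℝ) := (fun p : X × ℝ => (p.1, u p.1 + p.2)) '' (K ×ˢ Icc 0 3) with hC
  have hCc : IsCompact C := by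
    refine (hK.prod isCompact_Icc).image_of_continuousOn ?_
    refine continuousOn_fst.prodMk ((((hu.mono hKΩ).comp continuousOn_fst ?_)).add continuousOn_snd)
    exact fun p hp => hp.1
  have hCS : C ⊆ S := by
    rintro _ ⟨p, hp, rfl⟩
    exact ⟨hKΩ hp.1, (by linarith [ha _ (hKΩ hp.1), hp.2.1] : a ≤ u p.1 + p.2)⟩
  have hwC : ∀ k, ∀ x ∈ K, (x, w k x) ∈ C := by
    intro k x hx
    refine ⟨(x, w k x - u x), ⟨hx, ?_, ?_⟩, by simp⟩
    · change 0 ≤ w k x - u x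
      linarith [(hb k x hx).1, hε k]
    · change w k x - u x ≤ 3
      have : (1 : ℝ) / (k + 1) ≤ 1 := by
        rw [div_le_one (by positivity)]
        linarith [(Nat.cast_nonneg k : (0 : ℝ) ≤ k)]
      linarith [(hb k x hx).2]
  obtain ⟨B₁, hB₁⟩ := hCc.exists_bound_of_continuousOn (hF.continuousOn.mono hCS)
  obtain ⟨B₂, hB₂⟩ := hCc.exists_bound_of_continuousOn (hDFc.mono hCS)
  obtain ⟨B₃, hB₃⟩ := hK.exists_bound_of_continuousOn hφ.1.continuous.continuousOn
  have hφd : Continuous fun x => fderiv ℝ φ x v := hφ.continuous_fderiv.clm_apply continuous_const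
  have hmap : ∀ k, ContinuousOn (fun x => ((x, w k x) : X × ℝ)) K := fun k =>
    (continuous_id.prodMk (hw k).continuous).continuousOn
  have cF : ∀ k, ContinuousOn (fun x => F (x, w k x)) K := fun k =>
    hF.continuousOn.comp (hmap k) (hmem k)
  have cDF : ∀ k, ContinuousOn (fun x => DF (x, w k x)) K := fun k =>
    hDFc.comp (hmap k) (hmem k)
  have : IsFiniteMeasure ((volume : Measure X).restrict K) :=
    ⟨by rw [Measure.restrict_apply_univ]; exact hK.measure_lt_top⟩
  have mγ : MemLp γ 2 (volume.restrict K) :=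
    h.2.2.mono_measure (Measure.restrict_mono hKΩ le_rfl)
  have iγ : Integrable γ (volume.restrict K) := mγ.integrable (by norm_num)
  -- the left-hand sides converge
  have L : Tendsto (fun k => ∫ x in K, F (x, w k x) * fderiv ℝ φ x v) atTop
      (𝓝 (∫ x in K, F (x, u x) * fderiv ℝ φ x v)) := by
    refine tendsto_integral_of_dominated_convergence (fun x => B₁ * ‖fderiv ℝ φ x v‖) ?_ ?_ ?_ ?_
    · exact fun k => ((cF k).mul hφd.continuousOn).aestronglyMeasurable hKm
    · exact (hφd.norm.const_mul B₁).continuousOn.integrableOn_compact hK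
    · intro k
      refine (ae_restrict_iff' hKm).2 (Eventually.of_forall fun x hx => ?_)
      rw [norm_mul]
      gcongr
      exact hB₁ _ (hwC k x hx)
    · refine (ae_restrict_iff' hKm).2 (Eventually.of_forall fun x hx => ?_)
      exact ((hF.continuousOn _ (hmemu x hx)).tendsto.comp (htend x hx)).mul_const _
  -- the right-hand sides
  set A : ℕ → X → ℝ := fun k x => φ x * DF (x, w k x) (v, γ x v) with hA
  -- `T` is the integrand of the smooth chain rule; `A` has the weak gradient in place of that of
  -- `w`. `T - A` tends to zero because the gradients converge in `L²` and the other factors are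
  -- bounded; the integrals of `A` converge by dominated convergence.
  set T : ℕ → X → ℝ := fun k x => φ x * DF (x, w k x) (v, fderiv ℝ (w k) x v) with hT
  have mA : ∀ k, AEStronglyMeasurable (A k) (volume.restrict K) := by
    intro k
    refine (hφ.1.continuous.aestronglyMeasurable).mul ?_
    have h1 := (cDF k).aestronglyMeasurable (μ := volume) hKm
    have h2 : AEStronglyMeasurable (fun x => ((v, γ x v) : X × ℝ)) (volume.restrict K) :=
      aestronglyMeasurable_const.prodMk (MemLp.clm_apply mγ v).1
    exact (isBoundedBilinearMap_apply.continuous.comp_aestronglyMeasurable (h1.prodMk h2))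
  have bA : ∀ k, ∀ x ∈ K, ‖A k x‖ ≤ B₃ * (B₂ * (‖v‖ + ‖γ x‖ * ‖v‖)) := by
    intro k x hx
    simp only [hA, norm_mul]
    have hB₂0 : 0 ≤ B₂ := (norm_nonneg _).trans (hB₂ _ (hwC k x hx))
    refine mul_le_mul (hB₃ x hx) ?_ (norm_nonneg _) ((norm_nonneg _).trans (hB₃ x hx))
    refine ((DF (x, w k x)).le_opNorm _).trans ?_
    refine mul_le_mul (hB₂ _ (hwC k x hx)) ?_ (norm_nonneg _) hB₂0
    refine (norm_prod_le_iff.2 ⟨?_, ?_⟩)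
    · exact le_add_of_nonneg_right (by positivity)
    · exact ((γ x).le_opNorm v).trans (le_add_of_nonneg_left (norm_nonneg _))
  have ibA : Integrable (fun x => B₃ * (B₂ * (‖v‖ + ‖γ x‖ * ‖v‖))) (volume.restrict K) :=
    (((integrable_const _).add (iγ.norm.mul_const _)).const_mul _).const_mul _
  have iA : ∀ k, Integrable (A k) (volume.restrict K) := fun k =>
    ibA.mono' (mA k) ((ae_restrict_iff' hKm).2 (Eventually.of_forall (bA k)))
  have iT : ∀ k, Integrable (T k) (volume.restrict K) := by
    intro k
    refine ContinuousOn.integrableOn_compact hK (hφ.1.continuous.continuousOn.mul ?_)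
    refine (cDF k).clm_apply (continuous_const.prodMk ?_).continuousOn
    exact ((hw k).continuous_fderiv (by simp)).clm_apply continuous_const
  have RA : Tendsto (fun k => ∫ x in K, A k x) atTop
      (𝓝 (∫ x in K, φ x * DF (x, u x) (v, γ x v))) := by
    refine tendsto_integral_of_dominated_convergence _ mA ibA
      (fun k => (ae_restrict_iff' hKm).2 (Eventually.of_forall (bA k)))
      ((ae_restrict_iff' hKm).2 (Eventually.of_forall fun x hx => ?_))
    refine Tendsto.const_mul _ ?_
    have := (hDFc _ (hmemu x hx)).tendsto.comp (htend x hx)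
    exact ((ContinuousLinearMap.apply ℝ ℝ ((v, γ x v) : X × ℝ)).continuous.tendsto _).comp this
  have RB : Tendsto (fun k => ∫ x in K, (T k x - A k x)) atTop (𝓝 0) := by
    refine tendsto_integral_zero_of_eLpNorm_two (G := fun k x => fderiv ℝ (w k) x - γ x)
      (C := B₃ * (B₂ * ‖v‖)) ?_ ?_ ?_
    · exact fun k => ((hw k).continuous_fderiv (by simp)).aestronglyMeasurable.sub mγ.1
    · simp_rw [hwf]
      refine tendsto_of_tendsto_of_tendsto_of_le_of_le tendsto_const_nhds ?_ (fun _ => zero_le) hwg'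
      rw [← ENNReal.ofReal_zero]
      exact ENNReal.tendsto_ofReal tendsto_one_div_add_atTop_nhds_zero_nat
    · intro k
      refine (ae_restrict_iff' hKm).2 (Eventually.of_forall fun x hx => ?_)
      have e : T k x - A k x = φ x * DF (x, w k x) (0, (fderiv ℝ (w k) x - γ x) v) := by
        simp only [hT, hA]
        rw [← mul_sub, ← map_sub]
        simp
      have hB₂0 : 0 ≤ B₂ := (norm_nonneg _).trans (hB₂ _ (hwC k x hx))
      rw [e, norm_mul, mul_assoc, mul_assoc]
      refine mul_le_mul (hB₃ x hx) ?_ (norm_nonneg _) ((norm_nonneg _).trans (hB₃ x hx))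
      refine ((DF (x, w k x)).le_opNorm _).trans ?_
      refine mul_le_mul (hB₂ _ (hwC k x hx)) ?_ (norm_nonneg _) hB₂0
      refine (norm_prod_le_iff.2 ⟨by simpa using by positivity, ?_⟩)
      rw [mul_comm]
      exact ContinuousLinearMap.le_opNorm _ v
  have RT : Tendsto (fun k => ∫ x in K, T k x) atTop
      (𝓝 (∫ x in K, φ x * DF (x, u x) (v, γ x v))) := by
    have := RB.add RA
    rw [zero_add] at this
    refine this.congr fun k => ?_
    rw [integral_sub (iT k) (iA k)]
    ring
  have eq : ∀ k, ∫ x in K, F (x, w k x) * fderiv ℝ φ x v = - ∫ x in K, T k x := fun k =>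
    integral_comp_smooth hΩ hF (hw k) hφ (haw k) v
  simp_rw [eq] at L
  rw [tendsto_nhds_unique L RT.neg]
  simp [hDF]

end ChainRule

end MEMS

/-! ### Continuous functions with zero boundary values belong to `H¹₀` -/

namespace MEMS

set_option linter.unusedSectionVars false

lemma tendsto_eLpNorm_of_dominated {α E : Type*} [MeasurableSpace α] {μ : Measure α}
    [NormedAddCommGroup E] {F : ℕ → α → E} {b : α → ℝ} (hb : MemLp b 2 μ)
    (hF : ∀ k, AEStronglyMeasurable (F k) μ) (hFb : ∀ k, ∀ᵐ x ∂μ, ‖F k x‖ ≤ b x)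
    (h : ∀ᵐ x ∂μ, Tendsto (fun k => F k x) atTop (𝓝 0)) :
    Tendsto (fun k => eLpNorm (F k) 2 μ) atTop (𝓝 0) := by
  rw [tendsto_eLpNorm_two_iff]
  have e : ∫⁻ _ : α, (0 : ℝ≥0∞) ∂μ = 0 := lintegral_zero
  rw [← e]
  refine tendsto_lintegral_of_dominated_convergence' (fun x => ‖b x‖ₑ ^ 2)
    (fun k => (hF k).enorm.pow_const 2) (fun k => ?_) ?_ ?_
  · filter_upwards [hFb k] with x hx
    gcongr
    rw [enorm_le_iff_norm_le]
    exact hx.trans (le_abs_self _)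
  · rw [← eLpNorm_two_sq]
    exact ENNReal.pow_ne_top hb.eLpNorm_ne_top
  · filter_upwards [h] with x hx
    have := ENNReal.Tendsto.pow (n := 2) hx.enorm
    simpa using this

lemma memLp_set_indicator {α E : Type*} [MeasurableSpace α] {μ : Measure α}
    [NormedAddCommGroup E] {f : α → E} {s : Set α} (hs : MeasurableSet s) (hf : MemLp f 2 μ) :
    MemLp (s.indicator f) 2 μ :=
  hf.indicator hs

/-- A smooth approximation of the identity which vanishes near zero. -/
lemma exists_truncation : ∃ (T : ℝ → ℝ) (C : ℝ), ContDiff ℝ 1 T ∧ (∀ s, |s| < 1 → T s = 0) ∧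
    (∀ s, |s| < 1 → deriv T s = 0) ∧ (∀ s, 2 < |s| → deriv T s = 1) ∧ (∀ s, |T s - s| ≤ 2) ∧
    ∀ s, |deriv T s| ≤ C := by
  let b : ContDiffBump (0 : ℝ) := ⟨1, 2, one_pos, one_lt_two⟩
  have hT : ContDiff ℝ 1 fun s => s * (1 - b s) :=
    contDiff_id.mul (contDiff_const.sub b.contDiff)
  have h0 : ∀ s, |s| < 1 → (fun s => s * (1 - b s)) =ᶠ[𝓝 s] fun _ => 0 := by
    intro s hs
    have : Metric.ball (0 : ℝ) 1 ∈ 𝓝 s := Metric.isOpen_ball.mem_nhds (by simpa using hs)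
    filter_upwards [this] with t ht
    rw [b.one_of_mem_closedBall (Metric.ball_subset_closedBall ht)]
    simp
  have h1 : ∀ s, 2 < |s| → (fun s => s * (1 - b s)) =ᶠ[𝓝 s] fun s => s := by
    intro s hs
    have ho : IsOpen {s : ℝ | 2 < |s|} := isOpen_lt continuous_const continuous_abs
    filter_upwards [ho.mem_nhds hs] with t ht
    rw [b.zero_of_le_dist (by rw [dist_zero_right]; exact (show 2 < |t| from ht).le)]
    simp
  have hd1 : ∀ s, 2 < |s| → deriv (fun s => s * (1 - b s)) s = 1 := fun s hs => by
    rw [(h1 s hs).deriv_eq]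
    simp
  obtain ⟨C, hC⟩ := (isCompact_Icc (a := (-2 : ℝ)) (b := 2)).exists_bound_of_continuousOn
    (hT.continuous_deriv le_rfl).continuousOn
  refine ⟨fun s => s * (1 - b s), max C 1, hT, fun s hs => (h0 s hs).self_of_nhds,
    fun s hs => ?_, hd1, fun s => ?_, fun s => ?_⟩
  · rw [(h0 s hs).deriv_eq]
    simp
  · have e : s * (1 - b s) - s = -(s * b s) := by ring
    rw [e, abs_neg, abs_mul, abs_of_nonneg b.nonneg]
    rcases le_or_gt (|s|) 2 with h | h
    · exact (mul_le_mul h b.le_one b.nonneg zero_le_two).trans (by norm_num)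
    · rw [b.zero_of_le_dist (by rw [dist_zero_right]; exact h.le)]
      norm_num
  · rcases le_or_gt (|s|) 2 with h | h
    · exact (hC s (abs_le.1 h)).trans (le_max_left _ _)
    · rw [hd1 s h, abs_one]
      exact le_max_right _ _

section H10

variable {X : Type*} [NormedAddCommGroup X] [NormedSpace ℝ X] [MeasureSpace X] [BorelSpace X]
  [FiniteDimensional ℝ X] [(volume : Measure X).IsAddHaarMeasure]

lemma contDiffOn_of_isTestFunction {Ω : Set X} :
    ∀ φ ∈ {φ : X → ℝ | IsTestFunction Ω φ}, ContDiffOn ℝ 1 φ Ω :=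
  fun _ h => (h.1.of_le (by simp)).contDiffOn

/-- A compact support keeps a positive distance from the complement of `Ω`, so mollifications with
small radius are test functions of `Ω`. -/
lemma MemH1With.h10_of_compact {Ω : Set X} (hΩ : IsOpen Ω) {f : X → ℝ} {g : X → X →L[ℝ] ℝ}
    (h : MemH1With Ω f g) {K : Set X} (hK : IsCompact K) (hKΩ : K ⊆ Ω) (hf : ∀ x ∉ K, f x = 0)
    (hg : ∀ x ∉ K, g x = 0) : H1ClosureWith Ω {φ | IsTestFunction Ω φ} f g := by
  refine ⟨h, ?_⟩
  obtain ⟨ζ, hζ, hζ1, -⟩ := exists_cutoff hK hΩ hKΩ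
  have hc := h.cutoff hΩ hζ
  have e1 : (fun x => ζ x * f x) = f := by
    ext x
    by_cases hx : x ∈ K
    · rw [hζ1.self_of_nhdsSet x hx, one_mul]
    · rw [hf x hx, mul_zero]
  have e2 : (fun x => ζ x • g x + f x • fderiv ℝ ζ x) = g := by
    ext1 x
    by_cases hx : x ∈ K
    · have h1 : ζ =ᶠ[𝓝 x] fun _ => 1 := (eventually_nhdsSet_iff_forall.1 hζ1) x hx
      rw [h1.fderiv_eq, h1.self_of_nhds]
      simp
    · rw [hf x hx, hg x hx]
      simp
  rw [e1, e2] at hc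
  have mf : MemLp f 2 volume := by simpa using hc.1
  have mg : MemLp g 2 volume := by simpa using hc.2.2
  obtain ⟨r, hr, hrΩ⟩ := hK.exists_cthickening_subset_open hΩ hKΩ
  obtain ⟨η, hη⟩ := exists_bump_seq X
  refine exists_tendstoH1 fun ε hε => ?_
  obtain ⟨k, hk1, hk2, hk3⟩ := (((tendsto_order.1 hη).2 r hr).and
    ((ENNReal.tendsto_nhds_zero.1 (tendsto_mollify mf hη) ε hε).and
    (ENNReal.tendsto_nhds_zero.1 (tendsto_mollify mg hη) ε hε))).exists
  have hts : tsupport (mollify (η k) f) ⊆ Metric.cthickening (η k).rOut K :=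
    tsupport_mollify_subset _ _ fun x hx => by_contra fun h => hx (hf x h)
  refine ⟨mollify (η k) f, ⟨contDiff_mollify _ mf, ?_, ?_⟩, ?_, ?_⟩
  · exact hK.cthickening.of_isClosed_subset (isClosed_tsupport _) hts
  · exact hts.trans ((Metric.cthickening_mono hk1.le K).trans hrΩ)
  · exact (eLpNorm_mono_measure _ Measure.restrict_le_self).trans hk2
  · simp_rw [fderiv_mollify _ hc]
    exact (eLpNorm_mono_measure _ Measure.restrict_le_self).trans hk3

/-- A continuous `H¹`-function that vanishes outside a bounded open set belongs to `H¹₀`. -/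
lemma MemH1With.memH10_of_continuous {Ω : Set X} (hΩ : IsOpen Ω) (hb : Bornology.IsBounded Ω)
    {f : X → ℝ} {g : X → X →L[ℝ] ℝ} (h : MemH1With Ω f g) (hf : Continuous f)
    (h0 : ∀ x ∉ Ω, f x = 0) : MemH10 Ω f := by
  obtain ⟨T, C, hT, hT0, hTd0, hTd1, hTs, hTC⟩ := exists_truncation
  have hcl : IsCompact (closure Ω) := hb.isCompact_closure
  have hcs : HasCompactSupport f := HasCompactSupport.of_support_subset_isCompact hcl
    fun x hx => subset_closure (by_contra fun h => hx (h0 x h))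
  obtain ⟨a, ha⟩ := hcl.exists_bound_of_continuousOn hf.continuousOn
  have ha' : ∀ x ∈ Ω, -a ≤ f x := fun x hx => (abs_le.1 (ha x (subset_closure hx))).1
  have hfin : IsFiniteMeasure ((volume : Measure X).restrict Ω) :=
    ⟨by rw [Measure.restrict_apply_univ]; exact hb.measure_lt_top⟩
  set ε : ℕ → ℝ := fun k => 1 / ((k : ℝ) + 1) with hε
  have hε0 : ∀ k, 0 < ε k := fun k => by positivity
  have hεlim : Tendsto ε atTop (𝓝 0) := tendsto_one_div_add_atTop_nhds_zero_nat
  -- The truncation vanishes where `|f| < ε` and differs from `f` by at most `2ε`. Since `f` is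
  -- continuous and zero outside `Ω`, the set `{ε ≤ |f|}` is a compact subset of `Ω`.
  set f' : ℕ → X → ℝ := fun k x => ε k * T (f x / ε k) with hf'
  set g' : ℕ → X → X →L[ℝ] ℝ := fun k x => deriv T (f x / ε k) • g x with hg'
  have hdc : Continuous (deriv T) := hT.continuous_deriv le_rfl
  have c1 : ∀ k, Continuous (f' k) := fun k => by
    have := hT.continuous
    fun_prop
  have c2 : ∀ k, Continuous fun x => deriv T (f x / ε k) := fun k => by fun_prop
  have mg' : ∀ k, AEStronglyMeasurable (g' k) (volume.restrict Ω) := fun k =>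
    (c2 k).aestronglyMeasurable.smul h.2.2.1
  have bg' : ∀ k x, ‖g' k x‖ ≤ C * ‖g x‖ := fun k x => by
    simp only [hg', norm_smul]
    gcongr
    exact hTC _
  have bg : MemLp (fun x => C * ‖g x‖) 2 (volume.restrict Ω) := h.2.2.norm.const_mul C
  have m : ∀ k, MemH1With Ω (f' k) (g' k) := by
    intro k
    have hF : ContDiff ℝ 1 fun p : X × ℝ => ε k * T (p.2 / ε k) :=
      contDiff_const.mul (hT.comp (contDiff_snd.div_const _))
    have key := WeakFormula.comp hΩ h hf.continuousOn ha' (F := fun p => ε k * T (p.2 / ε k))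
      hF.contDiffOn
    refine MemH1With.of_weakFormula ?_ ?_ ?_
    · exact (((c1 k).memLp_of_hasCompactSupport (p := 2)
        (hcs.comp_left (g := fun s => ε k * T (s / ε k)) (by simp [hT0 0]))).restrict Ω)
    · exact bg.mono' (mg' k) (Eventually.of_forall (bg' k))
    · refine key.congr (ae_eq_refl _) ?_
      refine (ae_restrict_iff' hΩ.measurableSet).2 (Eventually.of_forall fun x hx => ?_)
      have hd : HasFDerivAt (fun p : X × ℝ => ε k * T (p.2 / ε k))
          (deriv T (f x / ε k) • ContinuousLinearMap.snd ℝ X ℝ) (x, f x) := by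
        have h1 : HasFDerivAt (fun p : X × ℝ => p.2 / ε k)
            ((ε k)⁻¹ • ContinuousLinearMap.snd ℝ X ℝ) (x, f x) := by
          simp_rw [div_eq_inv_mul]
          exact (hasFDerivAt_snd).const_mul _
        have h2 := ((hT.differentiable one_ne_zero (f x / ε k)).hasDerivAt).comp_hasFDerivAt
          (x, f x) h1
        have h3 := h2.const_mul (ε k)
        rw [smul_comm (deriv T _), smul_inv_smul₀ (hε0 k).ne'] at h3
        exact h3
      have e := hd.hasFDerivWithinAt.fderivWithin
        ((hΩ.uniqueDiffOn.prod (uniqueDiffOn_Ici (-a))) (x, f x) ⟨hx, ha' x hx⟩)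
      refine (congrArg (fun L => L.comp ((ContinuousLinearMap.id ℝ X).prod (g x))) e).trans ?_
      ext v
      simp [hg']
  have hK : ∀ k, IsCompact {x | ε k ≤ |f x|} := by
    intro k
    refine hcs.isCompact.of_isClosed_subset (isClosed_le continuous_const hf.abs) ?_
    intro x hx
    by_contra hx'
    simp only [mem_ofPred_eq, image_eq_zero_of_notMem_tsupport hx', abs_zero] at hx
    exact absurd hx (not_le.2 (hε0 k))
  have hsm : ∀ k, ∀ x ∉ {x | ε k ≤ |f x|}, |f x / ε k| < 1 := by
    intro k x hx
    rw [abs_div, abs_of_pos (hε0 k), div_lt_one (hε0 k)]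
    exact not_le.1 hx
  have hc : ∀ k, H1ClosureWith Ω {φ | IsTestFunction Ω φ} (f' k) (g' k) := fun k =>
    (m k).h10_of_compact hΩ (hK k)
      (fun x hx => by_contra fun hxΩ => by
        simp only [mem_ofPred_eq, h0 x hxΩ, abs_zero] at hx
        exact absurd hx (not_le.2 (hε0 k)))
      (fun x hx => by simp only [hf', hT0 _ (hsm k x hx), mul_zero])
      (fun x hx => by simp only [hg', hTd0 _ (hsm k x hx), zero_smul])
  have hs : MeasurableSet {x | f x ≠ 0} := (isOpen_ne_fun hf continuous_const).measurableSet
  have hind : MemLp ({x | f x ≠ 0}.indicator g) 2 (volume.restrict Ω) :=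
    memLp_set_indicator hs h.2.2
  -- The truncated gradients vanish where `f = 0`, so their limit is `g` cut off there. Being a
  -- limit it is automatically a weak gradient of `f`, and no separate proof that `g = 0` almost
  -- everywhere on `{f = 0}` is needed.
  refine memH1Closure_iff.2 ⟨{x | f x ≠ 0}.indicator g,
    H1ClosureWith.of_tendsto hΩ contDiffOn_of_isTestFunction hc h.1 hind ?_ ?_⟩
  · refine tendsto_eLpNorm_of_dominated (b := fun _ => 2) (memLp_const _)
      (fun k => (c1 k).aestronglyMeasurable.sub hf.aestronglyMeasurable) (fun k => ?_) ?_
    all_goals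
      have bd : ∀ k x, ‖f' k x - f x‖ ≤ ε k * 2 := by
        intro k x
        have : f' k x - f x = ε k * (T (f x / ε k) - f x / ε k) := by
          simp only [hf']
          field_simp [(hε0 k).ne']
        rw [this, norm_mul, Real.norm_of_nonneg (hε0 k).le]
        gcongr
        exact hTs _
    · refine Eventually.of_forall fun x => (bd k x).trans ?_
      have : ε k ≤ 1 := by
        simp only [hε]
        rw [div_le_one (by positivity)]
        linarith [(Nat.cast_nonneg k : (0 : ℝ) ≤ k)]
      linarith
    · refine Eventually.of_forall fun x => squeeze_zero_norm (bd · x) ?_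
      simpa using hεlim.mul_const 2
  · have mb : MemLp (fun x => C * ‖g x‖ + ‖g x‖) 2 (volume.restrict Ω) :=
      memLp_fun_add bg h.2.2.norm
    have md : ∀ k, AEStronglyMeasurable (fun x => g' k x - {x | f x ≠ 0}.indicator g x)
        (volume.restrict Ω) := fun k => (mg' k).sub hind.1
    refine tendsto_eLpNorm_of_dominated mb md
      (fun k => Eventually.of_forall fun x => ?_) (Eventually.of_forall fun x => ?_)
    · refine (norm_sub_le _ _).trans (add_le_add (bg' k x) ?_)
      exact norm_indicator_le_norm_self _ _
    · refine tendsto_const_nhds.congr' ?_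
      by_cases hx : f x = 0
      · refine Eventually.of_forall fun k => ?_
        simp [hg', hx, hTd0 0]
      · have : ∀ᶠ k in atTop, ε k < |f x| / 2 :=
          (tendsto_order.1 hεlim).2 _ (by positivity)
        filter_upwards [this] with k hk
        have h2 : 2 < |f x / ε k| := by
          rw [abs_div, abs_of_pos (hε0 k), lt_div_iff₀ (hε0 k)]
          linarith
        rw [indicator_of_mem (by exact hx)]
        simp only [hg']
        rw [hTd1 _ h2, one_smul, sub_self]

end H10

end MEMS

/-! ### Weak derivatives from horizontal and vertical slices -/

namespace MEMS

section Slices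

variable {n : ℕ}

instance instIsAddHaarMeasureVolumeProd :
    (volume : Measure (Rn n × ℝ)).IsAddHaarMeasure :=
  inferInstanceAs ((volume : Measure (Rn n)).prod (volume : Measure ℝ)).IsAddHaarMeasure

lemma IsTestFunction.slice_fst {W : Set (Rn n × ℝ)} {φ : Rn n × ℝ → ℝ} (h : IsTestFunction W φ)
    (z : ℝ) : IsTestFunction {x | (x, z) ∈ W} fun x => φ (x, z) := by
  have hcl : IsClosed {x : Rn n | (x, z) ∈ tsupport φ} :=
    (isClosed_tsupport φ).preimage (by fun_prop : Continuous fun x : Rn n => (x, z))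
  refine ⟨h.1.comp (contDiff_id.prodMk contDiff_const), ?_, ?_⟩
  · refine HasCompactSupport.intro (h.2.1.isCompact.image continuous_fst) fun x hx => ?_
    exact image_eq_zero_of_notMem_tsupport fun h' => hx ⟨_, h', rfl⟩
  · refine (closure_minimal ?_ hcl).trans fun x hx => h.2.2 hx
    exact fun x hx => subset_tsupport _ hx

lemma fderiv_slice_fst {φ : Rn n × ℝ → ℝ} {x : Rn n} {z : ℝ} (h : DifferentiableAt ℝ φ (x, z))
    (ξ : Rn n) : fderiv ℝ (fun x => φ (x, z)) x ξ = fderiv ℝ φ (x, z) (ξ, 0) := by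
  have h1 : HasFDerivAt (fun x : Rn n => (x, z)) (ContinuousLinearMap.inl ℝ (Rn n) ℝ) x :=
    hasFDerivAt_prodMk_left x z
  have h2 : HasFDerivAt (fun x => φ (x, z)) _ x := h.hasFDerivAt.comp x h1
  rw [h2.fderiv]
  simp

lemma hasDerivAt_slice_snd {φ : Rn n × ℝ → ℝ} {x : Rn n} {z : ℝ}
    (h : DifferentiableAt ℝ φ (x, z)) :
    HasDerivAt (fun z => φ (x, z)) (fderiv ℝ φ (x, z) (0, 1)) z := by
  have h1 : HasFDerivAt (fun z : ℝ => (x, z)) (ContinuousLinearMap.inr ℝ (Rn n) ℝ) z :=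
    hasFDerivAt_prodMk_right x z
  have h2 : HasFDerivAt (fun z => φ (x, z)) _ z := h.hasFDerivAt.comp z h1
  have := h2.hasDerivAt
  simpa using this

/-- A continuous function has a weak derivative if it is weakly differentiable in `x` for all but
countably many `z` and differentiable in `z` except for countably many `z`. -/
lemma weakFormula_of_slices {W : Set (Rn n × ℝ)} (hW : IsOpen W) {P : Rn n × ℝ → ℝ}
    {G : Rn n × ℝ → Rn n × ℝ →L[ℝ] ℝ} (hP : ContinuousOn P W) (hG : IntegrableOn G W) {s : Set ℝ}
    (hs : s.Countable)
    (hz : ∀ p ∈ W, p.2 ∉ s → HasDerivAt (fun z => P (p.1, z)) (G p (0, 1)) p.2)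
    (hx : ∀ z ∉ s, WeakFormula {x | (x, z) ∈ W} (fun x => P (x, z))
      fun x => (G (x, z)).comp (ContinuousLinearMap.inl ℝ (Rn n) ℝ)) : WeakFormula W P G := by
  intro φ hφ v
  have hφc := hφ.1.continuous
  have hφdiff : Differentiable ℝ φ := hφ.1.differentiable (by simp)
  have z0 : ∀ p ∉ tsupport φ, φ p = 0 := fun p hp => image_eq_zero_of_notMem_tsupport hp
  have z1 : ∀ p ∉ tsupport φ, fderiv ℝ φ p = 0 := fun p hp =>
    image_eq_zero_of_notMem_tsupport fun h' => hp (tsupport_fderiv_subset ℝ h')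
  have cont : Continuous fun p => φ p * P p := hφ.continuous_mul hW hP
  have i1 : ∀ v, Integrable fun p => P p * fderiv ℝ φ p v := fun v =>
    integrable_of_continuousOn_tsupport hφ.2.1 ((hP.mono hφ.2.2).mul
      (hφ.continuous_fderiv.clm_apply continuous_const).continuousOn)
      fun p hp => by rw [z1 p hp]; simp
  have i2 : ∀ v, Integrable fun p => φ p * G p v := fun v => by
    rw [← integrableOn_iff_integrable_of_support_subset (s := W)]
    · obtain ⟨B, hB⟩ := hφc.bounded_above_of_compact_support hφ.2.1
      exact Integrable.bdd_mul (hG.apply_continuousLinearMap v) hφc.aestronglyMeasurable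
        (Eventually.of_forall hB)
    · exact fun p hp => by_contra fun h => hp (by simp [hφ.eq_zero h])
  have caseX : ∀ ξ : Rn n, ∫ p, (P p * fderiv ℝ φ p (ξ, 0) + φ p * G p (ξ, 0)) = 0 := by
    intro ξ
    have hint : Integrable fun p => P p * fderiv ℝ φ p (ξ, 0) + φ p * G p (ξ, 0) :=
      (i1 (ξ, 0)).add (i2 (ξ, 0))
    rw [Measure.volume_eq_prod] at hint ⊢
    refine (integral_prod_symm _ hint).trans ?_
    refine integral_eq_zero_of_ae ?_
    have i1' := i1 (ξ, 0)
    have i2' := i2 (ξ, 0)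
    rw [Measure.volume_eq_prod] at i1' i2'
    filter_upwards [i1'.prod_left_ae, i2'.prod_left_ae, hs.ae_notMem volume] with z h1 h2 hzs
    simp only [Pi.zero_apply]
    rw [integral_add h1 h2]
    have key := hx z hzs _ (hφ.slice_fst z) ξ
    rw [setIntegral_eq_integral_of_forall_compl_eq_zero,
      setIntegral_eq_integral_of_forall_compl_eq_zero] at key
    · simp_rw [fderiv_slice_fst (hφdiff _)] at key
      simp only [ContinuousLinearMap.comp_apply, ContinuousLinearMap.inl_apply] at key
      rw [key]
      ring
    · exact fun x hx => by rw [hφ.eq_zero hx, zero_mul]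
    · exact fun x hx => by rw [fderiv_slice_fst (hφdiff _), hφ.fderiv_eq_zero hx]; simp
  -- On a vertical line, `φP` is continuous with bounded support, and the fundamental theorem of
  -- calculus tolerates countably many heights without a derivative.
  have caseZ : ∫ p, (P p * fderiv ℝ φ p (0, 1) + φ p * G p (0, 1)) = 0 := by
    have hint : Integrable fun p => P p * fderiv ℝ φ p (0, 1) + φ p * G p (0, 1) :=
      (i1 (0, 1)).add (i2 (0, 1))
    rw [Measure.volume_eq_prod] at hint ⊢
    refine (integral_prod _ hint).trans ?_
    refine integral_eq_zero_of_ae ?_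
    obtain ⟨R, hR⟩ := (hφ.2.1.isCompact.image continuous_snd).isBounded.subset_closedBall 0
    have hRz : ∀ x z, (x, z) ∈ tsupport φ → z ∈ Icc (-R) R := by
      intro x z h
      have := hR ⟨_, h, rfl⟩
      rwa [Metric.mem_closedBall, dist_zero_right, Real.norm_eq_abs, abs_le] at this
    filter_upwards [hint.prod_right_ae] with x h1
    simp only [Pi.zero_apply]
    -- `R` may be negative when the support is empty; this choice ensures `-R' < R'` and puts both
    -- endpoints off the support.
    set R' := max R 0 + 1
    have hR' : R < R' := (le_max_left R 0).trans_lt (lt_add_one _)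
    have hR0 : 0 < R' := (le_max_right R 0).trans_lt (lt_add_one _)
    have hzero : ∀ z, z ∉ Ioo (-R') R' → (x, z) ∉ tsupport φ := by
      intro z hz h
      have := hRz x z h
      exact hz ⟨by linarith [this.1], by linarith [this.2]⟩
    have e := MeasureTheory.integral_eq_of_hasDerivAt_off_countable_of_le
      (fun z => φ (x, z) * P (x, z))
      (fun z => P (x, z) * fderiv ℝ φ (x, z) (0, 1) + φ (x, z) * G (x, z) (0, 1))
      (by linarith : -R' ≤ R') hs
      (cont.comp (continuous_const.prodMk continuous_id)).continuousOn ?_ ?_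
    · rw [z0 _ (hzero R' (by simp)), z0 _ (hzero (-R') (by simp)), zero_mul, zero_mul, sub_zero,
        intervalIntegral.integral_of_le (by linarith), integral_Ioc_eq_integral_Ioo,
        setIntegral_eq_integral_of_forall_compl_eq_zero] at e
      · exact e
      · exact fun z hz => by rw [z1 _ (hzero z hz), z0 _ (hzero z hz)]; simp
    · intro z hz'
      by_cases hm : (x, z) ∈ tsupport φ
      · have d1 := hz (x, z) (hφ.2.2 hm) hz'.2
        have d2 := hasDerivAt_slice_snd (hφdiff (x, z))
        have := d2.mul d1
        rw [mul_comm (fderiv ℝ φ (x, z) (0, 1))] at this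
        exact this
      · rw [z1 _ hm, z0 _ hm]
        have ho : IsOpen {z : ℝ | (x, z) ∉ tsupport φ} :=
          (isClosed_tsupport φ).isOpen_compl.preimage (by fun_prop : Continuous fun z : ℝ => (x, z))
        have : (fun z => φ (x, z) * P (x, z)) =ᶠ[𝓝 z] fun _ => 0 := by
          filter_upwards [ho.mem_nhds hm] with t ht
          rw [z0 _ ht, zero_mul]
        simpa using (hasDerivAt_const z (0 : ℝ)).congr_of_eventuallyEq this
    · exact h1.intervalIntegrable
  have split : ∀ p, P p * fderiv ℝ φ p v + φ p * G p v =
      (P p * fderiv ℝ φ p (v.1, 0) + φ p * G p (v.1, 0)) +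
        v.2 * (P p * fderiv ℝ φ p (0, 1) + φ p * G p (0, 1)) := by
    intro p
    have hv : v = (v.1, 0) + v.2 • ((0, 1) : Rn n × ℝ) := by ext <;> simp
    have e1 : fderiv ℝ φ p v = fderiv ℝ φ p (v.1, 0) + v.2 * fderiv ℝ φ p (0, 1) := by
      conv_lhs => rw [hv, map_add, map_smul, smul_eq_mul]
    have e2 : G p v = G p (v.1, 0) + v.2 * G p (0, 1) := by
      conv_lhs => rw [hv, map_add, map_smul, smul_eq_mul]
    rw [e1, e2]
    ring
  have total : ∫ p, (P p * fderiv ℝ φ p v + φ p * G p v) = 0 := by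
    have j1 : Integrable fun p => P p * fderiv ℝ φ p (v.1, 0) + φ p * G p (v.1, 0) :=
      (i1 _).add (i2 _)
    have j2 : Integrable fun p => P p * fderiv ℝ φ p (0, 1) + φ p * G p (0, 1) :=
      (i1 _).add (i2 _)
    simp_rw [split]
    rw [integral_add j1 (j2.const_mul _), integral_const_mul, caseX, caseZ]
    simp
  rw [integral_add (i1 v) (i2 v)] at total
  rw [setIntegral_eq_integral_of_forall_compl_eq_zero,
    setIntegral_eq_integral_of_forall_compl_eq_zero]
  · linarith
  · exact fun p hp => by rw [hφ.eq_zero hp, zero_mul]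
  · exact fun p hp => by rw [hφ.fderiv_eq_zero hp]; simp

end Slices

end MEMS

/-! ### The deflection and the geometry of its domains -/

namespace MEMS

variable {n : ℕ} {H M δ : ℝ} {D : Set (Rn n)} {u : Rn n → ℝ} {γ : Rn n → Rn n →L[ℝ] ℝ}

/-- The standing assumptions on the deflection `u` with weak derivative `γ`. -/
structure Deflection (H M : ℝ) (D : Set (Rn n)) (u : Rn n → ℝ) (γ : Rn n → Rn n →L[ℝ] ℝ) :
    Prop where
  isOpen : IsOpen D
  isBounded : Bornology.IsBounded D
  pos : 0 < H
  memH1 : MemH1With D u γ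
  meas : StronglyMeasurable γ
  cont : ContinuousOn u (closure D)
  bdry : ∀ x ∈ frontier D, u x = 0
  lower : ∀ x ∈ D, -H ≤ u x
  upper : ∀ x ∈ D, |u x| + H ≤ M

lemma Deflection.contD (hu : Deflection H M D u γ) : ContinuousOn u D :=
  hu.cont.mono subset_closure

lemma Deflection.le_M (hu : Deflection H M D u γ) {x : Rn n} (hx : x ∈ D) : u x ≤ M := by
  linarith [hu.upper x hx, le_abs_self (u x), hu.pos]

lemma Deflection.isOpen_device (hu : Deflection H M D u γ) (δ : ℝ) : IsOpen (device H δ D u) := by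
  have h1 : IsOpen (D ×ˢ (univ : Set ℝ)) := hu.isOpen.prod isOpen_univ
  have h2 : ContinuousOn (fun p : Rn n × ℝ => u p.1 - p.2) (D ×ˢ univ) :=
    (hu.contD.comp continuousOn_fst fun p hp => hp.1).sub continuousOn_snd
  have h3 := (h2.isOpen_inter_preimage h1 isOpen_Ioi (t := Ioi 0)).inter
    (isOpen_lt (continuous_const (y := -H - δ)) (continuous_snd (X := Rn n) (Y := ℝ)))
  convert h3 using 1
  ext p
  simp only [device, mem_ofPred_eq, mem_inter_iff, mem_prod, mem_univ, and_true, mem_preimage,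
    mem_Ioi, sub_pos]
  tauto

lemma device_zero : device H 0 D u = freeSpace H D u := by
  simp [device, freeSpace]

lemma Deflection.isOpen_freeSpace (hu : Deflection H M D u γ) : IsOpen (freeSpace H D u) := by
  rw [← device_zero]
  exact hu.isOpen_device 0

lemma freeSpace_subset_device (hδ : 0 ≤ δ) : freeSpace H D u ⊆ device H δ D u :=
  fun _ hp => ⟨hp.1, by linarith [hp.2.1], hp.2.2⟩

lemma Deflection.device_subset (hu : Deflection H M D u γ) (hδ : δ ≤ 1) :
    device H δ D u ⊆ container H M D :=
  fun _ hp => ⟨hp.1, by linarith [hp.2.1], hp.2.2.trans_le (hu.le_M hp.1)⟩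

lemma Deflection.freeSpace_subset (hu : Deflection H M D u γ) :
    freeSpace H D u ⊆ container H M D :=
  fun _ hp => ⟨hp.1, by linarith [hp.2.1], hp.2.2.trans_le (hu.le_M hp.1)⟩

lemma Deflection.isBounded_container (hu : Deflection H M D u γ) :
    Bornology.IsBounded (container H M D) :=
  hu.isBounded.prod (Metric.isBounded_Ioo _ _)

lemma isFiniteMeasure_restrict_of_isBounded {X : Type*} [NormedAddCommGroup X] [ProperSpace X]
    [MeasureSpace X] [IsFiniteMeasureOnCompacts (volume : Measure X)] {W : Set X}
    (h : Bornology.IsBounded W) : IsFiniteMeasure ((volume : Measure X).restrict W) :=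
  ⟨by rw [Measure.restrict_apply_univ]; exact h.measure_lt_top⟩

lemma Deflection.memLp_grad (hu : Deflection H M D u γ) {W : Set (Rn n × ℝ)}
    (hW : W ⊆ container H M D) : MemLp (fun p : Rn n × ℝ => ‖γ p.1‖) 2 (volume.restrict W) := by
  have : IsFiniteMeasure ((volume : Measure ℝ).restrict (Ioo (-H - 1) M)) :=
    isFiniteMeasure_restrict_of_isBounded (Metric.isBounded_Ioo _ _)
  have h := (hu.memH1.2.2.norm).comp_fst ((volume : Measure ℝ).restrict (Ioo (-H - 1) M))
  rw [Measure.prod_restrict, ← Measure.volume_eq_prod] at h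
  exact h.mono_measure (Measure.restrict_mono hW le_rfl)

/-! ### Pulling back along the graph of `u` -/

/-- The linear map `(ξ, ζ) ↦ (ξ, c ζ, L ξ)`. -/
noncomputable def liftMap (c : ℝ) (L : Rn n →L[ℝ] ℝ) : Rn n × ℝ →L[ℝ] Rn n × ℝ × ℝ :=
  (ContinuousLinearMap.fst ℝ (Rn n) ℝ).prod ((c • ContinuousLinearMap.snd ℝ (Rn n) ℝ).prod 0) +
    ((ContinuousLinearMap.inr ℝ (Rn n) (ℝ × ℝ)).comp (ContinuousLinearMap.inr ℝ ℝ ℝ)).comp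
      (L.comp (ContinuousLinearMap.fst ℝ (Rn n) ℝ))

@[simp] lemma liftMap_apply (c : ℝ) (L : Rn n →L[ℝ] ℝ) (v : Rn n × ℝ) :
    liftMap c L v = (v.1, c * v.2, L v.1) := by
  simp [liftMap]

lemma continuous_liftMap (c : ℝ) : Continuous (liftMap (n := n) c) :=
  continuous_const.add (continuous_const.clm_comp (continuous_id.clm_comp continuous_const))

lemma norm_liftMap_le (c : ℝ) (L : Rn n →L[ℝ] ℝ) : ‖liftMap c L‖ ≤ 1 + |c| + ‖L‖ := by
  refine ContinuousLinearMap.opNorm_le_bound _ (by positivity) fun v => ?_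
  rw [liftMap_apply]
  have h1 : ‖v.1‖ ≤ ‖v‖ := norm_fst_le v
  have h2 : ‖v.2‖ ≤ ‖v‖ := norm_snd_le v
  have h3 := L.le_opNorm v.1
  refine norm_prod_le_iff.2 ⟨?_, norm_prod_le_iff.2 ⟨?_, ?_⟩⟩
  · simp only
    nlinarith [norm_nonneg v, abs_nonneg c, norm_nonneg L]
  · simp only [norm_mul, Real.norm_eq_abs c]
    nlinarith [norm_nonneg v, abs_nonneg c, norm_nonneg L,
      mul_le_mul_of_nonneg_left h2 (abs_nonneg c)]
  · simp only
    nlinarith [norm_nonneg v, abs_nonneg c, norm_nonneg L,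
      mul_le_mul_of_nonneg_left h1 (norm_nonneg L)]

/-- The weak derivative of `(x, z) ↦ F (x, s z, u x)`, where `c` is the derivative of `s` and the
first variables of `F` are in `S`. -/
noncomputable def pullGrad (S : Set (Rn n × ℝ × ℝ)) (F : Rn n × ℝ × ℝ → ℝ) (s : ℝ → ℝ) (c : ℝ)
    (u : Rn n → ℝ) (γ : Rn n → Rn n →L[ℝ] ℝ) (p : Rn n × ℝ) : Rn n × ℝ →L[ℝ] ℝ :=
  (fderivWithin ℝ F S (p.1, s p.2, u p.1)).comp (liftMap c (γ p.1))

/-- `S` involves `closure D`, where derivatives within the set are not known to be unique, so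
continuity of `fderivWithin` up to the boundary is not available. Smoothness on `S` provides near
each point some continuous choice of derivative; on the smaller set `S'`, uniqueness identifies it
with `fderivWithin`. Compactness makes the bound uniform. -/
lemma exists_bound_fderivWithin {Y : Type*} [NormedAddCommGroup Y] [NormedSpace ℝ Y]
    {S S' K : Set Y} {F : Y → ℝ} (hF : ContDiffOn ℝ 1 F S) (hS : S' ⊆ S)
    (hud : UniqueDiffOn ℝ S') (hK : IsCompact K) (hKS : K ⊆ S) :
    ∃ B, ∀ y ∈ K ∩ S', ‖fderivWithin ℝ F S' y‖ ≤ B := by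
  refine hK.induction_on (p := fun K => ∃ B, ∀ y ∈ K ∩ S', ‖fderivWithin ℝ F S' y‖ ≤ B)
    ⟨0, by simp⟩ ?_ ?_ ?_
  · rintro s t hst ⟨B, hB⟩
    exact ⟨B, fun y hy => hB y ⟨hst hy.1, hy.2⟩⟩
  · rintro s t ⟨B₁, h₁⟩ ⟨B₂, h₂⟩
    refine ⟨max B₁ B₂, ?_⟩
    rintro y ⟨hy | hy, hy'⟩
    · exact (h₁ y ⟨hy, hy'⟩).trans (le_max_left _ _)
    · exact (h₂ y ⟨hy, hy'⟩).trans (le_max_right _ _)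
  · intro y hy
    have hyS := hKS hy
    have h1 : ContDiffWithinAt ℝ (0 + 1) F S y := by simpa using hF y hyS
    rw [contDiffWithinAt_succ_iff_hasFDerivWithinAt' (by simp)] at h1
    obtain ⟨w, hw, -, -, F', hF', hF'c⟩ := h1
    rw [insert_eq_of_mem hyS] at hw
    have hcont : ContinuousWithinAt F' S y := hF'c.continuousWithinAt
    have hbd : ∀ᶠ t in 𝓝[S] y, ‖F' t‖ < ‖F' y‖ + 1 :=
      (tendsto_order.1 hcont.norm.tendsto).2 _ (lt_add_one _)
    have hev : {t | t ∈ w ∧ ‖F' t‖ < ‖F' y‖ + 1} ∈ 𝓝[S] y := by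
      filter_upwards [hw, hbd] with t h1 h2 using ⟨h1, h2⟩
    refine ⟨_, nhdsWithin_mono y hKS hev, ‖F' y‖ + 1, ?_⟩
    rintro t ⟨⟨ht1, ht2⟩, htS⟩
    rw [((hF' t ht1).mono hS).fderivWithin (hud t htS)]
    exact ht2.le

section Pull

variable {I J : Set ℝ} {F : Rn n × ℝ × ℝ → ℝ} {s : ℝ → ℝ} {c : ℝ}

lemma Deflection.uniqueDiffOn (hu : Deflection H M D u γ) (hI : UniqueDiffOn ℝ I) :
    UniqueDiffOn ℝ (D ×ˢ I ×ˢ Ici (-H)) :=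
  hu.isOpen.uniqueDiffOn.prod (hI.prod (uniqueDiffOn_Ici _))

lemma Deflection.mapsTo (hu : Deflection H M D u γ) (hs : MapsTo s J I) :
    MapsTo (fun p : Rn n × ℝ => (p.1, s p.2, u p.1)) (D ×ˢ J) (D ×ˢ I ×ˢ Ici (-H)) :=
  fun _ hp => ⟨hp.1, hs hp.2, hu.lower _ hp.1⟩

lemma Deflection.continuousOn_graph (hu : Deflection H M D u γ) (hs : Continuous s) :
    ContinuousOn (fun p : Rn n × ℝ => (p.1, s p.2, u p.1)) (D ×ˢ J) :=
  continuousOn_fst.prodMk ((hs.comp continuous_snd).continuousOn.prodMk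
    (hu.contD.comp continuousOn_fst fun _ hp => hp.1))

lemma Deflection.continuousOn_pull (hu : Deflection H M D u γ)
    (hF : ContinuousOn F (D ×ˢ I ×ˢ Ici (-H))) (hs : Continuous s) (hsJ : MapsTo s J I) :
    ContinuousOn (fun p : Rn n × ℝ => F (p.1, s p.2, u p.1)) (D ×ˢ J) :=
  hF.comp (hu.continuousOn_graph hs) (hu.mapsTo hsJ)

lemma Deflection.exists_bound_pull (hu : Deflection H M D u γ)
    (hF : ContinuousOn F (closure D ×ˢ I ×ˢ Ici (-H))) (hI : IsCompact I) :
    ∃ B, ∀ p ∈ D ×ˢ I, |F (p.1, p.2, u p.1)| ≤ B := by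
  have hK : IsCompact (closure D ×ˢ I ×ˢ Icc (-H) M) :=
    hu.isBounded.isCompact_closure.prod (hI.prod isCompact_Icc)
  obtain ⟨B, hB⟩ := hK.exists_bound_of_continuousOn (hF.mono
    (prod_mono le_rfl (prod_mono le_rfl Icc_subset_Ici_self)))
  exact ⟨B, fun p hp => hB _ ⟨subset_closure hp.1, hp.2, hu.lower _ hp.1, hu.le_M hp.1⟩⟩

lemma Deflection.aestronglyMeasurable_pullGrad (hu : Deflection H M D u γ)
    (hF : ContDiffOn ℝ 1 F (closure D ×ˢ I ×ˢ Ici (-H))) (hI : UniqueDiffOn ℝ I)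
    (hs : Continuous s) (hJ : MeasurableSet J) (hsJ : MapsTo s J I) :
    AEStronglyMeasurable (pullGrad (D ×ˢ I ×ˢ Ici (-H)) F s c u γ)
      (volume.restrict (D ×ˢ J)) := by
  have h1 : ContinuousOn (fun p : Rn n × ℝ =>
      fderivWithin ℝ F (D ×ˢ I ×ˢ Ici (-H)) (p.1, s p.2, u p.1)) (D ×ˢ J) :=
    ((hF.mono (prod_mono subset_closure le_rfl)).continuousOn_fderivWithin
      (hu.uniqueDiffOn hI) le_rfl).comp (hu.continuousOn_graph hs) (hu.mapsTo hsJ)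
  have h2 := h1.aestronglyMeasurable (μ := volume) (hu.isOpen.measurableSet.prod hJ)
  have h3 : AEStronglyMeasurable (fun p : Rn n × ℝ => liftMap c (γ p.1))
      (volume.restrict (D ×ˢ J)) :=
    (continuous_liftMap c).comp_aestronglyMeasurable
      (hu.meas.comp_measurable measurable_fst).aestronglyMeasurable
  have hc : Continuous fun q : (Rn n × ℝ × ℝ →L[ℝ] ℝ) × (Rn n × ℝ →L[ℝ] Rn n × ℝ × ℝ) =>
      q.1.comp q.2 := continuous_fst.clm_comp continuous_snd
  exact hc.comp_aestronglyMeasurable (h2.prodMk h3)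

lemma Deflection.exists_bound_fderivWithin (hu : Deflection H M D u γ)
    (hF : ContDiffOn ℝ 1 F (closure D ×ˢ I ×ˢ Ici (-H))) (hI : UniqueDiffOn ℝ I) {I' : Set ℝ}
    (hI' : IsCompact I') (hII' : I' ⊆ I) :
    ∃ B, 0 ≤ B ∧ ∀ x ∈ D, ∀ t ∈ I', ‖fderivWithin ℝ F (D ×ˢ I ×ˢ Ici (-H)) (x, t, u x)‖ ≤ B := by
  have hK : IsCompact (closure D ×ˢ I' ×ˢ Icc (-H) M) :=
    hu.isBounded.isCompact_closure.prod (hI'.prod isCompact_Icc)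
  obtain ⟨B, hB⟩ := MEMS.exists_bound_fderivWithin hF (prod_mono subset_closure le_rfl)
    (hu.uniqueDiffOn hI) hK (prod_mono le_rfl (prod_mono hII' Icc_subset_Ici_self))
  refine ⟨max B 0, le_max_right _ _, fun x hx t ht => (hB _ ⟨?_, ?_⟩).trans (le_max_left _ _)⟩
  · exact ⟨subset_closure hx, ht, hu.lower x hx, hu.le_M hx⟩
  · exact ⟨hx, hII' ht, hu.lower x hx⟩

lemma norm_pullGrad_le {S : Set (Rn n × ℝ × ℝ)} {B : ℝ} (hB0 : 0 ≤ B) {p : Rn n × ℝ}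
    (hB : ‖fderivWithin ℝ F S (p.1, s p.2, u p.1)‖ ≤ B) :
    ‖pullGrad S F s c u γ p‖ ≤ B * (1 + |c| + ‖γ p.1‖) :=
  (ContinuousLinearMap.opNorm_comp_le _ _).trans
    (mul_le_mul hB (norm_liftMap_le _ _) (norm_nonneg _) hB0)

lemma Deflection.hasDerivAt_pull (hu : Deflection H M D u γ)
    (hF : ContDiffOn ℝ 1 F (closure D ×ˢ I ×ˢ Ici (-H))) {x : Rn n} (hx : x ∈ D) {z : ℝ}
    (hs : HasDerivAt s c z) (hsI : ∀ᶠ t in 𝓝 z, s t ∈ I) :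
    HasDerivAt (fun t => F (x, s t, u x))
      (pullGrad (D ×ˢ I ×ˢ Ici (-H)) F s c u γ (x, z) (0, 1)) z := by
  have hmem : ∀ t, s t ∈ I → ((x, s t, u x) : Rn n × ℝ × ℝ) ∈ D ×ˢ I ×ˢ Ici (-H) :=
    fun t ht => ⟨hx, ht, hu.lower x hx⟩
  have h1 : HasFDerivWithinAt F (fderivWithin ℝ F (D ×ˢ I ×ˢ Ici (-H)) (x, s z, u x))
      (D ×ˢ I ×ˢ Ici (-H)) (x, s z, u x) :=
    (((hF.mono (prod_mono subset_closure le_rfl)).differentiableOn one_ne_zero) _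
      (hmem z hsI.self_of_nhds)).hasFDerivWithinAt
  have h2 : HasDerivAt (fun t => ((x, s t, u x) : Rn n × ℝ × ℝ)) (0, c, 0) z :=
    (hasDerivAt_const z x).prodMk (hs.prodMk (hasDerivAt_const z (u x)))
  have h3 := h1.comp_hasDerivAt z h2 (hsI.mono hmem)
  have h4 : pullGrad (D ×ˢ I ×ˢ Ici (-H)) F s c u γ (x, z) (0, 1) =
      fderivWithin ℝ F (D ×ˢ I ×ˢ Ici (-H)) (x, s z, u x) (0, c, 0) := by
    simp [pullGrad]
  rw [h4]
  exact h3

/-- At a fixed height this is the chain rule `WeakFormula.comp` for `(x, w) ↦ F(x, s(z), w)`. -/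
lemma Deflection.weakFormula_pull (hu : Deflection H M D u γ)
    (hF : ContDiffOn ℝ 1 F (closure D ×ˢ I ×ˢ Ici (-H))) {z : ℝ}
    (hz : s z ∈ I) : WeakFormula D (fun x => F (x, s z, u x)) fun x =>
      (pullGrad (D ×ˢ I ×ˢ Ici (-H)) F s c u γ (x, z)).comp
        (ContinuousLinearMap.inl ℝ (Rn n) ℝ) := by
  have hF' := hF.mono (prod_mono (subset_closure (s := D)) (le_refl (I ×ˢ Ici (-H))))
  have hmap : MapsTo (fun q : Rn n × ℝ => (q.1, s z, q.2)) (D ×ˢ Ici (-H))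
      (D ×ˢ I ×ˢ Ici (-H)) := fun q hq => ⟨hq.1, hz, hq.2⟩
  have hsm : ContDiff ℝ 1 fun q : Rn n × ℝ => (q.1, s z, q.2) :=
    contDiff_fst.prodMk (contDiff_const.prodMk contDiff_snd)
  refine (WeakFormula.comp hu.isOpen hu.memH1 hu.contD hu.lower
    (F := fun q => F (q.1, s z, q.2)) (hF'.comp hsm.contDiffOn hmap)).congr (ae_eq_refl _) ?_
  refine (ae_restrict_iff' hu.isOpen.measurableSet).2 (Eventually.of_forall fun x hx => ?_)
  have hq : (x, u x) ∈ D ×ˢ Ici (-H) := ⟨hx, hu.lower x hx⟩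
  have h1 : HasFDerivWithinAt F (fderivWithin ℝ F (D ×ˢ I ×ˢ Ici (-H)) (x, s z, u x))
      (D ×ˢ I ×ˢ Ici (-H)) (x, s z, u x) :=
    (hF'.differentiableOn one_ne_zero _ (hmap hq)).hasFDerivWithinAt
  have h2 : HasFDerivWithinAt (fun q : Rn n × ℝ => (q.1, s z, q.2))
      ((ContinuousLinearMap.fst ℝ (Rn n) ℝ).prod ((0 : Rn n × ℝ →L[ℝ] ℝ).prod
        (ContinuousLinearMap.snd ℝ (Rn n) ℝ))) (D ×ˢ Ici (-H)) (x, u x) :=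
    (hasFDerivAt_fst.prodMk ((hasFDerivAt_const _ _).prodMk hasFDerivAt_snd)).hasFDerivWithinAt
  have h3 := (h1.comp (x, u x) h2 hmap).fderivWithin
    ((hu.isOpen.uniqueDiffOn.prod (uniqueDiffOn_Ici (-H))) _ hq)
  refine (congrArg (fun L => L.comp ((ContinuousLinearMap.id ℝ (Rn n)).prod (γ x))) h3).trans ?_
  ext v
  simp [pullGrad]

end Pull

end MEMS

namespace MEMS

/-! ### The boundary data on the device -/

section BoundaryData

variable {n : ℕ} {H M δ : ℝ} {D : Set (Rn n)} {u : Rn n → ℝ} {γ : Rn n → Rn n →L[ℝ] ℝ}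
  {hb h : Rn n × ℝ × ℝ → ℝ}

/-- The domain of the boundary data in the layer. -/
abbrev layerDom (H : ℝ) (D : Set (Rn n)) : Set (Rn n × ℝ × ℝ) :=
  D ×ˢ Icc (-H - 1) (-H) ×ˢ Ici (-H)

/-- The domain of the boundary data above the layer. -/
abbrev upperDom (H : ℝ) (D : Set (Rn n)) : Set (Rn n × ℝ × ℝ) :=
  D ×ˢ Ici (-H) ×ˢ Ici (-H)

/-- Boundary data of class `C¹` which match continuously at `z = -H`. -/
structure BoundaryPair (H : ℝ) (D : Set (Rn n)) (hb h : Rn n × ℝ × ℝ → ℝ) : Prop where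
  layer : ContDiffOn ℝ 1 hb (layerDom H (closure D))
  upper : ContDiffOn ℝ 1 h (upperDom H (closure D))
  eq : ∀ x ∈ D, ∀ w ∈ Ici (-H), hb (x, -H, w) = h (x, -H, w)

/-- The affine map of the layer `(-H-δ, -H)` onto `(-H-1, -H)`. -/
noncomputable def layerMap (H δ : ℝ) (z : ℝ) : ℝ := -H + (z + H) / δ

lemma layerMap_mem (hδ : 0 < δ) {z : ℝ} (h1 : -H - δ ≤ z) (h2 : z ≤ -H) :
    layerMap H δ z ∈ Icc (-H - 1) (-H) := by
  have h3 : -1 ≤ (z + H) / δ := by rw [le_div_iff₀ hδ]; linarith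
  have h4 : (z + H) / δ ≤ 0 := div_nonpos_of_nonpos_of_nonneg (by linarith) hδ.le
  exact ⟨by simp only [layerMap]; linarith, by simp only [layerMap]; linarith⟩

lemma continuous_layerMap : Continuous (layerMap H δ) := by
  unfold layerMap
  fun_prop

lemma hasDerivAt_layerMap (z : ℝ) : HasDerivAt (layerMap H δ) (1 / δ) z :=
  (((hasDerivAt_id z).add_const H).div_const δ).const_add (-H)

lemma layerMap_bottom : layerMap H δ (-H) = -H := by simp [layerMap]

/-- The weak derivative of `boundaryData`. -/
noncomputable def dataGrad (H δ : ℝ) (D : Set (Rn n)) (u : Rn n → ℝ)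
    (γ : Rn n → Rn n →L[ℝ] ℝ) (hb h : Rn n × ℝ × ℝ → ℝ) (p : Rn n × ℝ) : Rn n × ℝ →L[ℝ] ℝ :=
  if p.2 < -H then pullGrad (layerDom H D) hb (layerMap H δ) (1 / δ) u γ p
  else pullGrad (upperDom H D) h id 1 u γ p

lemma uniqueDiffOn_layer : UniqueDiffOn ℝ (Icc (-H - 1) (-H)) :=
  uniqueDiffOn_Icc (by linarith)

lemma continuousOn_boundaryData (hu : Deflection H M D u γ) (hd : BoundaryPair H D hb h)
    (hδ : 0 < δ) : ContinuousOn (boundaryData H δ u hb h) (D ×ˢ Ioi (-H - δ)) := by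
  -- The two branches are glued without a case distinction: the lower one at `min(z, -H)`, plus the
  -- upper one at `max(z, -H)`, minus their common value on the plate.
  have e : EqOn (boundaryData H δ u hb h)
      (fun p => hb (p.1, layerMap H δ (min p.2 (-H)), u p.1) + h (p.1, max p.2 (-H), u p.1)
        - h (p.1, -H, u p.1)) (D ×ˢ Ioi (-H - δ)) := by
    intro p hp
    have hm := hd.eq p.1 hp.1 (u p.1) (hu.lower _ hp.1)
    by_cases hz : p.2 < -H
    · simp only [boundaryData, if_pos hz, min_eq_left hz.le, max_eq_right hz.le, layerMap]
      ring
    · rw [not_lt] at hz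
      simp only [boundaryData, if_neg hz.not_gt, min_eq_right hz, max_eq_left hz,
        layerMap_bottom, hm]
      ring
  refine ContinuousOn.congr ?_ e
  have hb' := hd.layer.continuousOn.mono (prod_mono (subset_closure (s := D)) le_rfl)
  have h' := hd.upper.continuousOn.mono (prod_mono (subset_closure (s := D)) le_rfl)
  have c1 : Continuous fun z => layerMap H δ (min z (-H)) :=
    continuous_layerMap.comp (by fun_prop)
  have m1 : MapsTo (fun z => layerMap H δ (min z (-H))) (Ioi (-H - δ)) (Icc (-H - 1) (-H)) :=
    fun z hz => layerMap_mem hδ (le_min (le_of_lt hz) (by linarith)) (min_le_right _ _)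
  have c2 : Continuous fun z : ℝ => max z (-H) := by fun_prop
  exact ((hu.continuousOn_pull hb' c1 m1).add
    (hu.continuousOn_pull h' c2 (fun _ _ => mem_Ici.2 (le_max_right _ _)))).sub
    (hu.continuousOn_pull (s := fun _ => -H) h' continuous_const (fun _ _ => self_mem_Ici))

lemma exists_bound_boundaryData (hu : Deflection H M D u γ) (hd : BoundaryPair H D hb h)
    (hδ : 0 < δ) : ∃ B, ∀ p ∈ device H δ D u, |boundaryData H δ u hb h p| ≤ B := by
  obtain ⟨B₁, h₁⟩ := hu.exists_bound_pull hd.layer.continuousOn isCompact_Icc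
  obtain ⟨B₂, h₂⟩ := hu.exists_bound_pull (I := Icc (-H) M) (hd.upper.continuousOn.mono
    (prod_mono le_rfl (prod_mono Icc_subset_Ici_self le_rfl))) isCompact_Icc
  refine ⟨max B₁ B₂, fun p hp => ?_⟩
  by_cases hz : p.2 < -H
  · simp only [boundaryData, if_pos hz]
    exact (h₁ (p.1, layerMap H δ p.2) ⟨hp.1, layerMap_mem hδ hp.2.1.le hz.le⟩).trans
      (le_max_left _ _)
  · simp only [boundaryData, if_neg hz]
    exact (h₂ p ⟨hp.1, not_lt.1 hz, (hp.2.2.trans_le (hu.le_M hp.1)).le⟩).trans (le_max_right _ _)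

lemma exists_bound_dataGrad (hu : Deflection H M D u γ) (hd : BoundaryPair H D hb h) :
    ∃ B, 0 ≤ B ∧ (∀ x ∈ D, ∀ t ∈ Icc (-H - 1) (-H),
        ‖fderivWithin ℝ hb (layerDom H D) (x, t, u x)‖ ≤ B) ∧
      ∀ x ∈ D, ∀ t ∈ Icc (-H) M, ‖fderivWithin ℝ h (upperDom H D) (x, t, u x)‖ ≤ B := by
  obtain ⟨B₁, h0, h₁⟩ := hu.exists_bound_fderivWithin hd.layer uniqueDiffOn_layer isCompact_Icc
    le_rfl
  obtain ⟨B₂, -, h₂⟩ := hu.exists_bound_fderivWithin hd.upper (uniqueDiffOn_Ici _) isCompact_Icc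
    (I' := Icc (-H) M) Icc_subset_Ici_self
  exact ⟨max B₁ B₂, h0.trans (le_max_left _ _),
    fun x hx t ht => (h₁ x hx t ht).trans (le_max_left _ _),
    fun x hx t ht => (h₂ x hx t ht).trans (le_max_right _ _)⟩

lemma aestronglyMeasurable_dataGrad (hu : Deflection H M D u γ) (hd : BoundaryPair H D hb h)
    (hδ : 0 < δ) : AEStronglyMeasurable (dataGrad H δ D u γ hb h)
      (volume.restrict (device H δ D u)) := by
  have hs : MeasurableSet {p : Rn n × ℝ | p.2 < -H} :=
    measurableSet_lt measurable_snd measurable_const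
  have m1 := hu.aestronglyMeasurable_pullGrad (c := 1 / δ) hd.layer uniqueDiffOn_layer
    (continuous_layerMap (H := H) (δ := δ)) (J := Icc (-H - δ) (-H)) measurableSet_Icc
    (fun z hz => layerMap_mem hδ hz.1 hz.2)
  have m2 := hu.aestronglyMeasurable_pullGrad (c := 1) hd.upper (uniqueDiffOn_Ici _)
    continuous_id (J := Ici (-H)) measurableSet_Ici (fun z hz => hz)
  refine AEStronglyMeasurable.piecewise (s := {p : Rn n × ℝ | p.2 < -H}) hs ?_ ?_
  · rw [Measure.restrict_restrict hs]
    have hsub : {p : Rn n × ℝ | p.2 < -H} ∩ device H δ D u ⊆ D ×ˢ Icc (-H - δ) (-H) :=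
      fun p hp => ⟨hp.2.1, hp.2.2.1.le, le_of_lt hp.1⟩
    exact m1.mono_measure (Measure.restrict_mono hsub le_rfl)
  · rw [Measure.restrict_restrict hs.compl]
    have hsub : {p : Rn n × ℝ | p.2 < -H}ᶜ ∩ device H δ D u ⊆ D ×ˢ Ici (-H) :=
      fun p hp => ⟨hp.2.1, not_lt.1 (show ¬ p.2 < -H from hp.1)⟩
    exact m2.mono_measure (Measure.restrict_mono hsub le_rfl)

lemma memLp_of_norm_le {α E : Type*} [NormedAddCommGroup E] {m : MeasurableSpace α} {μ : Measure α}
    {f : α → E} {g : α → ℝ} (hf : AEStronglyMeasurable f μ) (hg : MemLp g 2 μ) {B : ℝ}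
    (h : ∀ᵐ x ∂μ, ‖f x‖ ≤ B * ‖g x‖) : MemLp f 2 μ :=
  hg.of_le_mul hf h

lemma norm_dataGrad_le (hu : Deflection H M D u γ) (hδ : 0 < δ) {B : ℝ} (hB0 : 0 ≤ B)
    (hB1 : ∀ x ∈ D, ∀ t ∈ Icc (-H - 1) (-H), ‖fderivWithin ℝ hb (layerDom H D) (x, t, u x)‖ ≤ B)
    (hB2 : ∀ x ∈ D, ∀ t ∈ Icc (-H) M, ‖fderivWithin ℝ h (upperDom H D) (x, t, u x)‖ ≤ B)
    {p : Rn n × ℝ} (hp : p ∈ device H δ D u) :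
    ‖dataGrad H δ D u γ hb h p‖ ≤ B * ‖(2 + 1 / δ) + ‖γ p.1‖‖ := by
  have hc : 0 < 1 / δ := one_div_pos.2 hδ
  have h0 : 0 ≤ (2 + 1 / δ) + ‖γ p.1‖ := by positivity
  rw [Real.norm_of_nonneg h0]
  by_cases hz : p.2 < -H
  · simp only [dataGrad, if_pos hz]
    refine (norm_pullGrad_le (F := hb) (s := layerMap H δ) (c := 1 / δ) (γ := γ) (p := p) hB0
      (hB1 p.1 hp.1 _ (layerMap_mem hδ hp.2.1.le hz.le))).trans ?_
    rw [abs_of_pos hc]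
    exact mul_le_mul_of_nonneg_left (by linarith) hB0
  · simp only [dataGrad, if_neg hz]
    refine (norm_pullGrad_le (F := h) (s := id) (c := 1) (γ := γ) (p := p) hB0 (hB2 p.1 hp.1 p.2
      ⟨not_lt.1 hz, (hp.2.2.trans_le (hu.le_M hp.1)).le⟩)).trans ?_
    rw [abs_one]
    exact mul_le_mul_of_nonneg_left (by linarith) hB0

lemma memLp_dataGrad (hu : Deflection H M D u γ) (hd : BoundaryPair H D hb h)
    (hδ : 0 < δ) (hδ1 : δ ≤ 1) : MemLp (dataGrad H δ D u γ hb h) 2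
      (volume.restrict (device H δ D u)) := by
  obtain ⟨B, hB0, hB1, hB2⟩ := exists_bound_dataGrad hu hd
  have : IsFiniteMeasure ((volume : Measure (Rn n × ℝ)).restrict (device H δ D u)) :=
    isFiniteMeasure_restrict_of_isBounded (hu.isBounded_container.subset (hu.device_subset hδ1))
  have hg : MemLp (fun p : Rn n × ℝ => (2 + 1 / δ) + ‖γ p.1‖) 2
      (volume.restrict (device H δ D u)) :=
    memLp_fun_add (memLp_const (2 + 1 / δ)) (hu.memLp_grad (hu.device_subset hδ1))
  exact memLp_of_norm_le (B := B) (aestronglyMeasurable_dataGrad hu hd hδ) hg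
    ((ae_restrict_iff' (hu.isOpen_device δ).measurableSet).2
      (Eventually.of_forall fun p hp => norm_dataGrad_le hu hδ hB0 hB1 hB2 hp))

lemma hasDerivAt_boundaryData (hu : Deflection H M D u γ) (hd : BoundaryPair H D hb h)
    (hδ : 0 < δ) {x : Rn n} (hx : x ∈ D) {z : ℝ} (hz1 : -H - δ < z) (hz2 : z ≠ -H) :
    HasDerivAt (fun t => boundaryData H δ u hb h (x, t))
      (dataGrad H δ D u γ hb h (x, z) (0, 1)) z := by
  rcases lt_or_gt_of_ne hz2 with hz | hz
  · simp only [dataGrad, if_pos hz]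
    have h1 := hu.hasDerivAt_pull hd.layer hx (hasDerivAt_layerMap (H := H) (δ := δ) z) (by
      filter_upwards [Ioo_mem_nhds hz1 hz] with t ht using layerMap_mem hδ ht.1.le ht.2.le)
    refine h1.congr_of_eventuallyEq ?_
    filter_upwards [Iio_mem_nhds hz] with t ht
    simp only [boundaryData, if_pos (show t < -H from ht), layerMap]
  · simp only [dataGrad, if_neg hz.not_gt]
    have h1 := hu.hasDerivAt_pull hd.upper hx (hasDerivAt_id z)
      (Filter.mem_of_superset (Ioi_mem_nhds hz) Ioi_subset_Ici_self)
    refine h1.congr_of_eventuallyEq ?_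
    filter_upwards [Ioi_mem_nhds hz] with t ht
    simp only [boundaryData, if_neg (show ¬ t < -H from (le_of_lt ht).not_gt), id]

/-- The data match continuously at the plate, so `weakFormula_of_slices` applies with `-H` as the
only exceptional height. The bounds depend on `δ`, which is harmless since only membership in `H¹`
is claimed. -/
lemma memH1With_boundaryData (hu : Deflection H M D u γ) (hd : BoundaryPair H D hb h)
    (hδ : 0 < δ) (hδ1 : δ ≤ 1) : MemH1With (device H δ D u) (boundaryData H δ u hb h)
      (dataGrad H δ D u γ hb h) := by
  have hW := hu.isOpen_device δ
  have : IsFiniteMeasure ((volume : Measure (Rn n × ℝ)).restrict (device H δ D u)) :=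
    isFiniteMeasure_restrict_of_isBounded (hu.isBounded_container.subset (hu.device_subset hδ1))
  have hc : ContinuousOn (boundaryData H δ u hb h) (device H δ D u) :=
    (continuousOn_boundaryData hu hd hδ).mono fun p hp => ⟨hp.1, hp.2.1⟩
  have hG := memLp_dataGrad hu hd hδ hδ1
  obtain ⟨B, hB⟩ := exists_bound_boundaryData hu hd hδ
  have hf : MemLp (boundaryData H δ u hb h) 2 (volume.restrict (device H δ D u)) :=
    MemLp.of_bound (hc.aestronglyMeasurable hW.measurableSet) B
      ((ae_restrict_iff' hW.measurableSet).2 (Eventually.of_forall hB))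
  refine MemH1With.of_weakFormula hf hG (weakFormula_of_slices hW hc
    (hG.integrable (by norm_num)) (countable_singleton (-H)) ?_ ?_)
  · exact fun p hp hps => hasDerivAt_boundaryData hu hd hδ hp.1 hp.2.1 hps
  · intro z hz
    by_cases hz1 : -H - δ < z
    · refine WeakFormula.mono (Ω := D) ?_ fun x hx => hx.1
      rcases lt_or_gt_of_ne (show z ≠ -H from hz) with hz2 | hz2
      · simp only [dataGrad, if_pos hz2, boundaryData]
        exact hu.weakFormula_pull hd.layer (s := layerMap H δ) (layerMap_mem hδ hz1.le hz2.le)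
      · simp only [dataGrad, if_neg hz2.not_gt, boundaryData]
        exact hu.weakFormula_pull hd.upper (s := id) (c := 1) (z := z) hz2.le
    · have : {x | (x, z) ∈ device H δ D u} = ∅ :=
        eq_empty_of_forall_notMem fun x hx => hz1 hx.2.1
      rw [this]
      intro φ _ v
      simp

lemma memH1With_upperData (hu : Deflection H M D u γ) (hd : BoundaryPair H D hb h) :
    MemH1With (freeSpace H D u) (fun p => h (p.1, p.2, u p.1))
      (pullGrad (upperDom H D) h id 1 u γ) := by
  -- The thickness `1` is arbitrary: in `Ω(u)` the data do not depend on it.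
  have h1 := (memH1With_boundaryData hu hd one_pos le_rfl).mono
    (freeSpace_subset_device zero_le_one)
  refine h1.congr ?_ ?_ <;>
  · refine (ae_restrict_iff' hu.isOpen_freeSpace.measurableSet).2 (Eventually.of_forall ?_)
    intro p hp
    simp only [boundaryData, dataGrad, if_neg (hp.2.1.le.not_gt)]

end BoundaryData

end MEMS

namespace MEMS

/-! ### Integrals over vertical slices -/

section Slices

variable {n : ℕ}

/-- Cauchy-Schwarz against the constant `1`. Measurability is not assumed because a non-integrable
function has integral zero by convention. On a slice of the layer the total mass is `δ`, the factor
carried by the permittivity. -/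
lemma enorm_integral_sq_le_measure_mul {α : Type*} [MeasurableSpace α] {ν : Measure α} (f : α → ℝ) :
    ‖∫ t, f t ∂ν‖ₑ ^ 2 ≤ ν univ * ∫⁻ t, ‖f t‖ₑ ^ 2 ∂ν := by
  by_cases hf : AEStronglyMeasurable f ν
  · have h1 := eLpNorm_le_eLpNorm_mul_rpow_measure_univ (p := 1) (q := 2) (by norm_num) hf
    have h2 : ‖∫ t, f t ∂ν‖ₑ ≤ eLpNorm f 2 ν * ν univ ^ (1 / 2 : ℝ) := by
      refine (enorm_integral_le_lintegral_enorm _).trans ?_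
      rw [← eLpNorm_one_eq_lintegral_enorm]
      refine h1.trans (le_of_eq ?_)
      norm_num
    calc ‖∫ t, f t ∂ν‖ₑ ^ 2 ≤ (eLpNorm f 2 ν * ν univ ^ (1 / 2 : ℝ)) ^ 2 := by gcongr
      _ = ν univ * ∫⁻ t, ‖f t‖ₑ ^ 2 ∂ν := by
        rw [mul_pow, eLpNorm_two_sq, mul_comm, ← ENNReal.rpow_natCast, ← ENNReal.rpow_mul]
        norm_num
  · rw [integral_undef fun h => hf h.1]
    simp

/-- The integral of `F` over the vertical slices of `W`. -/
noncomputable def sliceInt (W : Set (Rn n × ℝ)) (F : Rn n × ℝ → ℝ) (x : Rn n) : ℝ :=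
  ∫ z, W.indicator F (x, z)

variable {W : Set (Rn n × ℝ)} {F F' : Rn n × ℝ → ℝ}

lemma measurableSet_slice (hW : MeasurableSet W) (x : Rn n) : MeasurableSet {z | (x, z) ∈ W} :=
  hW.preimage measurable_prodMk_left

lemma sliceInt_eq_setIntegral (hW : MeasurableSet W) (x : Rn n) :
    sliceInt W F x = ∫ z in {z | (x, z) ∈ W}, F (x, z) := by
  rw [← integral_indicator (measurableSet_slice hW x)]
  rfl

lemma sliceInt_eq_zero {x : Rn n} (h : ∀ z, (x, z) ∉ W) : sliceInt W F x = 0 := by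
  simp [sliceInt, indicator_of_notMem (h _)]

lemma aestronglyMeasurable_sliceInt (hW : MeasurableSet W)
    (hF : AEStronglyMeasurable F (volume.restrict W)) :
    AEStronglyMeasurable (sliceInt W F) volume := by
  have h : AEStronglyMeasurable (W.indicator F) ((volume : Measure (Rn n)).prod volume) := by
    rw [← Measure.volume_eq_prod]
    exact (aestronglyMeasurable_indicator_iff hW).2 hF
  exact h.integral_prod_right'

lemma lintegral_eq_lintegral_slices (hW : MeasurableSet W) {w : Rn n × ℝ → ℝ≥0∞}
    (hw : AEMeasurable w (volume.restrict W)) :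
    ∫⁻ p in W, w p = ∫⁻ x, ∫⁻ z in {z | (x, z) ∈ W}, w (x, z) := by
  have h : AEMeasurable (W.indicator w) ((volume : Measure (Rn n)).prod volume) := by
    rw [← Measure.volume_eq_prod]
    exact (aemeasurable_indicator_iff hW).2 hw
  rw [← lintegral_indicator hW, Measure.volume_eq_prod, lintegral_prod _ h]
  refine lintegral_congr fun x => ?_
  rw [← lintegral_indicator (measurableSet_slice hW x)]
  rfl

lemma enorm_sliceInt_sq_le (hW : MeasurableSet W) (x : Rn n) :
    ‖sliceInt W F x‖ₑ ^ 2 ≤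
      volume {z | (x, z) ∈ W} * ∫⁻ z in {z | (x, z) ∈ W}, ‖F (x, z)‖ₑ ^ 2 := by
  rw [sliceInt_eq_setIntegral hW]
  refine (enorm_integral_sq_le_measure_mul _).trans (le_of_eq ?_)
  rw [Measure.restrict_apply_univ]

lemma lintegral_sliceInt_sq_le (hW : MeasurableSet W)
    (hF : AEStronglyMeasurable F (volume.restrict W)) {L : ℝ≥0∞}
    (hL : ∀ x, volume {z | (x, z) ∈ W} ≤ L) :
    ∫⁻ x, ‖sliceInt W F x‖ₑ ^ 2 ≤ L * ∫⁻ p in W, ‖F p‖ₑ ^ 2 := by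
  rw [lintegral_eq_lintegral_slices hW (hF.enorm.pow_const 2)]
  calc ∫⁻ x, ‖sliceInt W F x‖ₑ ^ 2
      ≤ ∫⁻ x, L * ∫⁻ z in {z | (x, z) ∈ W}, ‖F (x, z)‖ₑ ^ 2 := lintegral_mono fun x =>
        (enorm_sliceInt_sq_le hW x).trans (mul_le_mul_left (hL x) _)
    _ = _ := by
      refine lintegral_const_mul'' _ ?_
      have h : AEMeasurable (W.indicator fun p => ‖F p‖ₑ ^ 2)
          ((volume : Measure (Rn n)).prod volume) := by
        rw [← Measure.volume_eq_prod]
        exact (aemeasurable_indicator_iff hW).2 (hF.enorm.pow_const 2)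
      refine h.lintegral_prod_right'.congr (Eventually.of_forall fun x => ?_)
      simp only
      rw [← lintegral_indicator (measurableSet_slice hW x)]
      rfl

lemma eLpNorm_sliceInt_le (hW : MeasurableSet W)
    (hF : AEStronglyMeasurable F (volume.restrict W)) {L : ℝ≥0∞} (hL1 : 1 ≤ L)
    (hL : ∀ x, volume {z | (x, z) ∈ W} ≤ L) :
    eLpNorm (sliceInt W F) 2 volume ≤ L * eLpNorm F 2 (volume.restrict W) := by
  have h := lintegral_sliceInt_sq_le hW hF hL
  rw [← eLpNorm_two_sq, ← eLpNorm_two_sq] at h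
  have h2 : eLpNorm (sliceInt W F) 2 volume ^ 2 ≤
      (L * eLpNorm F 2 (volume.restrict W)) ^ 2 := by
    rw [mul_pow]
    -- The sharp constant would be the square root of `L`; since `1 ≤ L`, the factor `L` suffices
    -- and avoids roots.
    refine h.trans (mul_le_mul_left ?_ _)
    calc L = L * 1 := (mul_one L).symm
      _ ≤ L ^ 2 := by rw [sq]; gcongr
  exact (ENNReal.pow_le_pow_left_iff two_ne_zero).1 h2

lemma ae_integrable_slice (hW : MeasurableSet W) (hF : IntegrableOn F W) :
    ∀ᵐ x : Rn n, Integrable fun z : ℝ => W.indicator F (x, z) := by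
  have h : Integrable (W.indicator F) ((volume : Measure (Rn n)).prod volume) := by
    rw [← Measure.volume_eq_prod]
    exact (integrable_indicator_iff hW).2 hF
  exact h.prod_right_ae

lemma sliceInt_linearComb (hW : MeasurableSet W) (hF : IntegrableOn F W) (hF' : IntegrableOn F' W)
    (a b : ℝ) : sliceInt W (fun p => a * F p + b * F' p) =ᵐ[volume]
      fun x => a * sliceInt W F x + b * sliceInt W F' x := by
  filter_upwards [ae_integrable_slice hW hF, ae_integrable_slice hW hF'] with x h1 h2
  simp only [sliceInt]
  rw [← integral_const_mul, ← integral_const_mul, ← integral_add (h1.const_mul a) (h2.const_mul b)]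
  refine integral_congr_ae (Eventually.of_forall fun z => ?_)
  by_cases hm : (x, z) ∈ W <;> simp [hm]

lemma sliceInt_sub (hW : MeasurableSet W) (hF : IntegrableOn F W) (hF' : IntegrableOn F' W) :
    sliceInt W (fun p => F p - F' p) =ᵐ[volume]
      fun x => sliceInt W F x - sliceInt W F' x := by
  filter_upwards [sliceInt_linearComb hW hF hF' 1 (-1)] with x hx
  have e : (fun p => F p - F' p) = fun p => 1 * F p + -1 * F' p := by ext p; ring
  rw [e, hx]
  ring

/-- Continuity of `sliceInt` in `L²`. -/
lemma tendsto_eLpNorm_sliceInt {ι : Type*} {l : Filter ι} (hW : MeasurableSet W)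
    [IsFiniteMeasure ((volume : Measure (Rn n × ℝ)).restrict W)] {L : ℝ≥0∞} (hLt : L ≠ ⊤)
    (hL : ∀ x, volume {z | (x, z) ∈ W} ≤ L) {Fk : ι → Rn n × ℝ → ℝ}
    (hFk : ∀ k, MemLp (Fk k) 2 (volume.restrict W)) (hF : MemLp F 2 (volume.restrict W))
    (h : Tendsto (fun k => eLpNorm (fun p => Fk k p - F p) 2 (volume.restrict W)) l (𝓝 0)) :
    Tendsto (fun k => eLpNorm (fun x => sliceInt W (Fk k) x - sliceInt W F x) 2 volume) l
      (𝓝 0) := by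
  have h1 := ENNReal.Tendsto.const_mul (a := max 1 L) h (Or.inr (by simp [hLt]))
  rw [mul_zero] at h1
  refine tendsto_of_tendsto_of_tendsto_of_le_of_le tendsto_const_nhds h1 (fun _ => zero_le)
    fun k => ?_
  have e := sliceInt_sub hW ((hFk k).integrable (by norm_num)) (hF.integrable (by norm_num))
  rw [← eLpNorm_congr_ae e]
  exact eLpNorm_sliceInt_le hW ((hFk k).1.sub hF.1) (le_max_left _ _)
    fun x => (hL x).trans (le_max_right _ _)

end Slices

end MEMS

namespace MEMS

/-! ### Gradients as Euclidean vectors -/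

section Vec

variable {n : ℕ}

/-- The Euclidean space of gradients in `ℝⁿ⁺¹`. -/
abbrev GradVec (n : ℕ) : Type := EuclideanSpace ℝ (Option (Fin n))

/-- The standard basis of `ℝⁿ⁺¹`. -/
noncomputable def stdVec : Option (Fin n) → Rn n × ℝ
  | none => (0, 1)
  | some i => (EuclideanSpace.single i 1, 0)

/-- The coordinates on `ℝⁿ⁺¹`. -/
noncomputable def stdCoord : Option (Fin n) → Rn n × ℝ →L[ℝ] ℝ
  | none => ContinuousLinearMap.snd ℝ (Rn n) ℝ
  | some i => (EuclideanSpace.proj i).comp (ContinuousLinearMap.fst ℝ (Rn n) ℝ)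

/-- The gradient representing a linear form. -/
noncomputable def toVec : (Rn n × ℝ →L[ℝ] ℝ) →L[ℝ] GradVec n :=
  ((EuclideanSpace.equiv (Option (Fin n)) ℝ).symm : (Option (Fin n) → ℝ) →L[ℝ] GradVec n).comp
    (ContinuousLinearMap.pi fun i => ContinuousLinearMap.apply ℝ ℝ (stdVec i))

/-- The linear form represented by a gradient. -/
noncomputable def ofVec : GradVec n →L[ℝ] (Rn n × ℝ →L[ℝ] ℝ) :=
  ∑ i, (EuclideanSpace.proj i : GradVec n →L[ℝ] ℝ).smulRight (stdCoord i)

lemma toVec_apply (L : Rn n × ℝ →L[ℝ] ℝ) (i : Option (Fin n)) : toVec L i = L (stdVec i) := rfl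

lemma ofVec_apply (v : GradVec n) (p : Rn n × ℝ) : ofVec v p = ∑ i, v i * stdCoord i p := by
  simp [ofVec]

lemma stdCoord_stdVec (i j : Option (Fin n)) :
    stdCoord i (stdVec j) = if i = j then (1 : ℝ) else 0 := by
  cases i <;> cases j <;> simp [stdCoord, stdVec]

@[simp] lemma toVec_ofVec (v : GradVec n) : toVec (ofVec v) = v := by
  ext i
  rw [toVec_apply, ofVec_apply]
  simp [stdCoord_stdVec]

lemma sum_stdCoord_smul (p : Rn n × ℝ) : ∑ i, stdCoord i p • stdVec i = p := by
  rw [Fintype.sum_option]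
  have h := (EuclideanSpace.basisFun (Fin n) ℝ).sum_repr p.1
  refine Prod.ext ?_ ?_
  · simp only [stdCoord, stdVec, Prod.fst_add, Prod.fst_sum, Prod.smul_fst, smul_zero, zero_add]
    simpa using h
  · simp [stdCoord, stdVec, Prod.snd_sum]

@[simp] lemma ofVec_toVec (L : Rn n × ℝ →L[ℝ] ℝ) : ofVec (toVec L) = L := by
  refine ContinuousLinearMap.ext fun p => ?_
  rw [ofVec_apply]
  conv_rhs => rw [← sum_stdCoord_smul p, map_sum]
  refine Finset.sum_congr rfl fun i _ => ?_
  rw [toVec_apply, map_smul, smul_eq_mul, mul_comm]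

/-- The operator norm on linear forms belongs to the maximum norm of the product and is not
Hilbertian. The Euclidean representation turns the Dirichlet integral into a squared Hilbert norm.
-/
lemma gradSq_eq (L : Rn n × ℝ →L[ℝ] ℝ) : gradSq L = ‖toVec L‖ ^ 2 := by
  rw [EuclideanSpace.norm_sq_eq, Fintype.sum_option, gradSq, add_comm]
  simp [toVec_apply, stdVec]

lemma ofReal_gradSq (L : Rn n × ℝ →L[ℝ] ℝ) : ENNReal.ofReal (gradSq L) = ‖toVec L‖ₑ ^ 2 := by
  rw [gradSq_eq, ENNReal.ofReal_pow (norm_nonneg _), ofReal_norm]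

lemma sq_le_gradSq (L : Rn n × ℝ →L[ℝ] ℝ) : (L (0, 1)) ^ 2 ≤ gradSq L := by
  rw [gradSq]
  have : 0 ≤ ∑ i : Fin n, (L (EuclideanSpace.single i 1, 0)) ^ 2 :=
    Finset.sum_nonneg fun i _ => sq_nonneg _
  linarith

/-- `HasWeakDeriv.ae_eq` compares only the lengths of two gradients. Applied to `g₁ - g₂` and `0`,
both weak gradients of the zero function, it shows that the length of `g₁ - g₂` vanishes. -/
lemma MemH1With.ae_eq {Ω : Set (Rn n × ℝ)} (hΩ : IsOpen Ω) {f : Rn n × ℝ → ℝ}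
    {g₁ g₂ : Rn n × ℝ → Rn n × ℝ →L[ℝ] ℝ} (h₁ : MemH1With Ω f g₁) (h₂ : MemH1With Ω f g₂) :
    g₁ =ᵐ[volume.restrict Ω] g₂ := by
  have h := h₁.linearComb h₂ 1 (-1)
  have h0 := h₁.linearComb h₁ 0 0
  have h3 : MemH1With Ω (fun x => 0 * f x + 0 * f x) fun x => (1 : ℝ) • g₁ x + (-1 : ℝ) • g₂ x :=
    h.congr (Eventually.of_forall fun x => by simp) (ae_eq_refl _)
  filter_upwards [h3.2.1.ae_eq hΩ h0.2.1] with p hp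
  have e0 : gradSq ((0 : ℝ) • g₁ p + (0 : ℝ) • g₁ p) = 0 := by simp [gradSq_eq]
  rw [e0, gradSq_eq, sq_eq_zero_iff, norm_eq_zero] at hp
  have h4 := congrArg ofVec hp
  rw [ofVec_toVec, map_zero] at h4
  refine ContinuousLinearMap.ext fun v => ?_
  have h5 : 1 * g₁ p v + -1 * g₂ p v = 0 := congrArg (fun L : Rn n × ℝ →L[ℝ] ℝ => L v) h4
  linarith

end Vec

/-! ### The trace on the bottom plate -/

section Trace

variable {n : ℕ} {H M : ℝ} {D : Set (Rn n)} {u : Rn n → ℝ} {γ : Rn n → Rn n →L[ℝ] ℝ}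

lemma abs_apply_vert_le (L : Rn n × ℝ →L[ℝ] ℝ) : |L (0, 1)| ≤ ‖L‖ := by
  have := L.le_opNorm (0, 1)
  simpa using this

lemma memLp_apply {μ : Measure (Rn n × ℝ)}
    {g : Rn n × ℝ → Rn n × ℝ →L[ℝ] ℝ} (hg : MemLp g 2 μ) (v : Rn n × ℝ) :
    MemLp (fun p => g p v) 2 μ :=
  MemLp.clm_apply hg v

lemma tendsto_eLpNorm_vert {ι α : Type*} [MeasurableSpace α] {μ : Measure α} {l : Filter ι}
    {g : ι → α → Rn n × ℝ →L[ℝ] ℝ} {g₀ : α → Rn n × ℝ →L[ℝ] ℝ}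
    (h : Tendsto (fun k => eLpNorm (fun p => g k p - g₀ p) 2 μ) l (𝓝 0)) :
    Tendsto (fun k => eLpNorm (fun p => g k p (0, 1) - g₀ p (0, 1)) 2 μ) l (𝓝 0) :=
  tendsto_of_tendsto_of_tendsto_of_le_of_le tendsto_const_nhds h (fun _ => zero_le)
    fun k => eLpNorm_mono fun p => by
      rw [Real.norm_eq_abs, ← sub_apply]
      exact abs_apply_vert_le _

lemma IsC1Closure.memLp {Ω : Set (Rn n × ℝ)} (hΩ : IsOpen Ω) (hb : Bornology.IsBounded Ω)
    {φ : Rn n × ℝ → ℝ} (h : IsC1Closure Ω φ) :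
    MemLp φ 2 (volume.restrict Ω) ∧ MemLp (fderiv ℝ φ) 2 (volume.restrict Ω) := by
  have := isFiniteMeasure_restrict_of_isBounded hb
  obtain ⟨h1, h2, Φ, h3, h4⟩ := h
  have m := aestronglyMeasurable_of_contDiffOn hΩ h1
  obtain ⟨B, hB⟩ := hb.isCompact_closure.exists_bound_of_continuousOn h2
  obtain ⟨B', hB'⟩ := hb.isCompact_closure.exists_bound_of_continuousOn h3
  refine ⟨MemLp.of_bound m.1 B ?_, MemLp.of_bound m.2 B' ?_⟩
  · exact (ae_restrict_iff' hΩ.measurableSet).2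
      (Eventually.of_forall fun x hx => hB x (subset_closure hx))
  · refine (ae_restrict_iff' hΩ.measurableSet).2 (Eventually.of_forall fun x hx => ?_)
    rw [← h4 x hx]
    exact hB' x (subset_closure hx)

lemma freeSpace_slice {x : Rn n} (hx : x ∈ D) : {z | (x, z) ∈ freeSpace H D u} = Ioo (-H) (u x) := by
  ext z
  simp [freeSpace, hx]

lemma device_slice {δ : ℝ} {x : Rn n} (hx : x ∈ D) :
    {z | (x, z) ∈ device H δ D u} = Ioo (-H - δ) (u x) := by
  ext z
  simp [device, hx]

lemma Deflection.volume_slice_le (hu : Deflection H M D u γ) (x : Rn n) :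
    volume {z | (x, z) ∈ freeSpace H D u} ≤ ENNReal.ofReal (M + H) := by
  refine (measure_mono (fun z hz => ?_ : _ ⊆ Ioo (-H) M)).trans (le_of_eq ?_)
  · exact ⟨hz.2.1, hz.2.2.trans_le (hu.le_M hz.1)⟩
  · rw [Real.volume_Ioo, sub_neg_eq_add]

lemma Deflection.isFiniteMeasure (hu : Deflection H M D u γ) :
    IsFiniteMeasure ((volume : Measure (Rn n × ℝ)).restrict (freeSpace H D u)) :=
  isFiniteMeasure_restrict_of_isBounded (hu.isBounded_container.subset hu.freeSpace_subset)

/-- Integration by parts on the vertical slices of `Ω(u)`. -/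
lemma IsC1Closure.integral_slice {φ : Rn n × ℝ → ℝ} (h : IsC1Closure (freeSpace H D u) φ)
    (hΩ : IsOpen (freeSpace H D u)) {x : Rn n} (hx : x ∈ D) (hxu : -H < u x) (α β : ℝ) :
    sliceInt (freeSpace H D u) (fun p => β * φ p + (α + β * p.2) * fderiv ℝ φ p (0, 1)) x =
      (α + β * u x) * φ (x, u x) - (α - β * H) * φ (x, -H) := by
  obtain ⟨h1, h2, Φ, h3, h4⟩ := h
  have hc : Continuous fun z : ℝ => (x, z) := by fun_prop
  have hmem : MapsTo (fun z : ℝ => (x, z)) (Icc (-H) (u x)) (closure (freeSpace H D u)) := by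
    rw [← closure_Ioo hxu.ne]
    refine MapsTo.closure (fun z hz => ?_) hc
    exact ⟨hx, hz.1, hz.2⟩
  have c1 : ContinuousOn (fun z => φ (x, z)) (Icc (-H) (u x)) := h2.comp hc.continuousOn hmem
  have c2 : ContinuousOn (fun z => Φ (x, z) (0, 1)) (Icc (-H) (u x)) :=
    (h3.comp hc.continuousOn hmem).clm_apply continuousOn_const
  -- Two weights matter later: `α = 1, β = 0` gives the bottom value of a function that vanishes on
  -- the graph of `u`, while `α = u(x), β = -1` removes the upper boundary term for an arbitrary
  -- function.
  have hd : ∀ z ∈ Ioo (-H) (u x), HasDerivAt (fun z => (α + β * z) * φ (x, z))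
      (β * φ (x, z) + (α + β * z) * Φ (x, z) (0, 1)) z := by
    intro z hz
    have hm : (x, z) ∈ freeSpace H D u := ⟨hx, hz.1, hz.2⟩
    have e1 : HasFDerivAt φ (Φ (x, z)) (x, z) := by
      rw [h4 _ hm]
      exact ((h1.contDiffAt (hΩ.mem_nhds hm)).differentiableAt one_ne_zero).hasFDerivAt
    have e2 : HasDerivAt (fun z : ℝ => (x, z)) (0, 1) z :=
      (hasDerivAt_const z x).prodMk (hasDerivAt_id z)
    have e3 : HasDerivAt (fun z : ℝ => α + β * z) β z := by
      simpa using ((hasDerivAt_id z).const_mul β).const_add α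
    exact e3.mul (e1.comp_hasDerivAt z e2)
  have key := intervalIntegral.integral_eq_sub_of_hasDerivAt_of_le hxu.le
    (f := fun z => (α + β * z) * φ (x, z)) (by fun_prop) hd
    (ContinuousOn.intervalIntegrable_of_Icc hxu.le (by fun_prop))
  rw [sliceInt_eq_setIntegral hΩ.measurableSet, freeSpace_slice hx, ← integral_Ioc_eq_integral_Ioo,
    ← intervalIntegral.integral_of_le hxu.le]
  have e : ∫ z in (-H)..(u x), (β * φ (x, z) + (α + β * z) * fderiv ℝ φ (x, z) (0, 1)) =
      ∫ z in (-H)..(u x), (β * φ (x, z) + (α + β * z) * Φ (x, z) (0, 1)) := by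
    rw [intervalIntegral.integral_of_le hxu.le, intervalIntegral.integral_of_le hxu.le,
      integral_Ioc_eq_integral_Ioo, integral_Ioc_eq_integral_Ioo]
    refine setIntegral_congr_fun measurableSet_Ioo fun z hz => ?_
    simp only [h4 (x, z) ⟨hx, hz.1, hz.2⟩]
  refine e.trans (key.trans ?_)
  ring

/-- The trace on the bottom plate of a function in `H¹_B(Ω(u))`, computed from its gradient. -/
noncomputable def bottomTrace (H : ℝ) (D : Set (Rn n)) (u : Rn n → ℝ)
    (g : Rn n × ℝ → Rn n × ℝ →L[ℝ] ℝ) (x : Rn n) : ℝ :=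
  -sliceInt (freeSpace H D u) (fun p => g p (0, 1)) x

lemma bottomTrace_of_C1B {φ : Rn n × ℝ → ℝ} (h : φ ∈ C1B H D u) (hΩ : IsOpen (freeSpace H D u))
    {x : Rn n} (hx : x ∈ D) (hxu : -H < u x) : bottomTrace H D u (fderiv ℝ φ) x = φ (x, -H) := by
  have := h.1.integral_slice hΩ hx hxu 1 0
  simp only [zero_mul, zero_add, add_zero, one_mul, h.2.1 x hx, sub_zero, zero_sub] at this
  rw [bottomTrace, this, neg_neg]

lemma Deflection.lt_of_notMem (hu : Deflection H M D u γ) {x : Rn n}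
    (hx : x ∈ D \ coincidence H D u) : -H < u x :=
  lt_of_le_of_ne (hu.lower x hx.1) fun h => hx.2 ⟨hx.1, h.symm⟩

lemma Deflection.measurableSet_coincidence (hu : Deflection H M D u γ) :
    MeasurableSet (D \ coincidence H D u) := by
  have : D \ coincidence H D u = D ∩ u ⁻¹' {-H}ᶜ := by
    ext x
    simp only [coincidence, Set.mem_sdiff, mem_ofPred_eq, mem_inter_iff, mem_preimage,
      mem_compl_iff, mem_singleton_iff]
    tauto
  rw [this]
  exact (hu.contD.isOpen_inter_preimage hu.isOpen isOpen_compl_singleton).measurableSet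

/-- Integration over slices of length at most `M + H` is bounded on `L²`. For functions that vanish
on the graph of `u` this gives convergence of traces without the weight `H + u`, hence uniformly up
to the coincidence set. -/
lemma Deflection.tendsto_bottomTrace (hu : Deflection H M D u γ) {ι : Type*} {l : Filter ι}
    {g : ι → Rn n × ℝ → Rn n × ℝ →L[ℝ] ℝ} {g₀ : Rn n × ℝ → Rn n × ℝ →L[ℝ] ℝ}
    (hg : ∀ k, MemLp (g k) 2 (volume.restrict (freeSpace H D u)))
    (hg₀ : MemLp g₀ 2 (volume.restrict (freeSpace H D u)))
    (h : Tendsto (fun k => eLpNorm (fun p => g k p - g₀ p) 2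
      (volume.restrict (freeSpace H D u))) l (𝓝 0)) :
    Tendsto (fun k => eLpNorm (fun x => bottomTrace H D u (g k) x - bottomTrace H D u g₀ x) 2
      (volume.restrict D)) l (𝓝 0) := by
  have := hu.isFiniteMeasure
  have h1 := tendsto_eLpNorm_sliceInt hu.isOpen_freeSpace.measurableSet ENNReal.ofReal_ne_top
    hu.volume_slice_le (fun k => memLp_apply (hg k) (0, 1)) (memLp_apply hg₀ (0, 1))
    (tendsto_eLpNorm_vert h)
  refine tendsto_of_tendsto_of_tendsto_of_le_of_le tendsto_const_nhds h1 (fun _ => zero_le)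
    fun k => (eLpNorm_mono_measure _ Measure.restrict_le_self).trans (le_of_eq ?_)
  refine eLpNorm_congr_norm_ae (Eventually.of_forall fun x => ?_)
  simp only [bottomTrace, neg_sub_neg]
  exact norm_sub_rev _ _

lemma Deflection.memLp_bottomTrace (hu : Deflection H M D u γ)
    {g : Rn n × ℝ → Rn n × ℝ →L[ℝ] ℝ}
    (hg : MemLp g 2 (volume.restrict (freeSpace H D u))) :
    MemLp (bottomTrace H D u g) 2 (volume.restrict D) := by
  have hg' := memLp_apply hg (0, 1)
  have h : MemLp (sliceInt (freeSpace H D u) fun p => g p (0, 1)) 2 volume := by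
    refine ⟨aestronglyMeasurable_sliceInt hu.isOpen_freeSpace.measurableSet hg'.1, ?_⟩
    refine (eLpNorm_sliceInt_le hu.isOpen_freeSpace.measurableSet hg'.1 (le_max_left _ _)
      fun x => (hu.volume_slice_le x).trans (le_max_right _ _)).trans_lt
        (ENNReal.mul_lt_top ?_ hg'.2)
    simp
  exact h.neg.restrict D

lemma Deflection.bottomTrace_linearComb (hu : Deflection H M D u γ)
    {g g' : Rn n × ℝ → Rn n × ℝ →L[ℝ] ℝ}
    (hg : MemLp g 2 (volume.restrict (freeSpace H D u)))
    (hg' : MemLp g' 2 (volume.restrict (freeSpace H D u))) (a b : ℝ) :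
    bottomTrace H D u (fun p => a • g p + b • g' p) =ᵐ[volume]
      fun x => a * bottomTrace H D u g x + b * bottomTrace H D u g' x := by
  have := hu.isFiniteMeasure
  filter_upwards [sliceInt_linearComb hu.isOpen_freeSpace.measurableSet
    ((memLp_apply hg (0, 1)).integrable (by norm_num))
    ((memLp_apply hg' (0, 1)).integrable (by norm_num)) a b] with x hx
  simp only [bottomTrace]
  have e : (fun p => (a • g p + b • g' p) (0, 1)) =
      fun p => a * g p (0, 1) + b * g' p (0, 1) := by
    ext p; simp
  rw [e, hx]
  ring

end Trace

end MEMS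

/-! ### Uniqueness of the trace and the limit energy in terms of the gradient -/

namespace MEMS

section LimitEnergy

variable {n : ℕ} {H M : ℝ} {D : Set (Rn n)} {u : Rn n → ℝ} {γ : Rn n → Rn n →L[ℝ] ℝ}
  {σ : Rn n × ℝ → ℝ} {hb h : Rn n × ℝ × ℝ → ℝ}

lemma Deflection.isBounded_freeSpace (hu : Deflection H M D u γ) : Bornology.IsBounded (freeSpace H D u) :=
  hu.isBounded_container.subset hu.freeSpace_subset

lemma Deflection.add_nonneg_le (hu : Deflection H M D u γ) {x : Rn n} (hx : x ∈ D) :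
    0 ≤ H + u x ∧ H + u x ≤ M :=
  ⟨by linarith [hu.lower x hx], by linarith [hu.upper x hx, le_abs_self (u x)]⟩

/-- For approximants in `C¹_B` the slice integral is the bottom value, and the unweighted
convergence of the traces dominates the weighted one because `H + u ≤ M`. Over coincidence points
the slices are empty, which yields the conventional value zero. -/
lemma Deflection.isBottomTrace (hu : Deflection H M D u γ) {f : Rn n × ℝ → ℝ}
    {g : Rn n × ℝ → Rn n × ℝ →L[ℝ] ℝ} (h : H1ClosureWith (freeSpace H D u) (C1B H D u) f g) :
    IsBottomTrace H D u f (bottomTrace H D u g) := by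
  obtain ⟨hm, φ, hφ, ht⟩ := h
  refine ⟨(hu.memLp_bottomTrace hm.2.2).1, fun x hx => ?_, g, hm, φ, fun k => (hφ k).1, ht, ?_⟩
  · rw [bottomTrace, sliceInt_eq_zero, neg_zero]
    rintro z ⟨-, h1, h2⟩
    rw [hx.2] at h2
    exact lt_irrefl _ (h1.trans h2)
  · have t := hu.tendsto_bottomTrace
      (fun k => ((hφ k).1.memLp hu.isOpen_freeSpace hu.isBounded_freeSpace).2) hm.2.2 ht.2
    rw [tendsto_eLpNorm_two_iff] at t
    have t2 := ENNReal.Tendsto.const_mul (a := ENNReal.ofReal M) t (Or.inr ENNReal.ofReal_ne_top)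
    rw [mul_zero] at t2
    refine tendsto_of_tendsto_of_tendsto_of_le_of_le tendsto_const_nhds t2 (fun _ => zero_le)
      fun k => ?_
    simp only
    rw [← lintegral_const_mul' _ _ ENNReal.ofReal_ne_top]
    refine (setLIntegral_mono_ae' hu.measurableSet_coincidence
      (Eventually.of_forall fun x hx => ?_)).trans (lintegral_mono_set sdiff_subset)
    rw [bottomTrace_of_C1B (hφ k) hu.isOpen_freeSpace hx.1 (hu.lt_of_notMem hx),
      mul_comm, ENNReal.ofReal_mul (hu.add_nonneg_le hx.1).1, ← sq_abs,
      ENNReal.ofReal_pow (abs_nonneg _), ← Real.norm_eq_abs, ofReal_norm]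
    exact mul_le_mul_left (ENNReal.ofReal_le_ofReal (hu.add_nonneg_le hx.1).2) _

/-- The trace of a function in `H¹(Ω(u))` satisfies the trace identity obtained by integrating by
parts against `u(x) - z`. -/
lemma Deflection.trace_identity (hu : Deflection H M D u γ) {f : Rn n × ℝ → ℝ} {b : Rn n → ℝ}
    (hbt : IsBottomTrace H D u f b) {g : Rn n × ℝ → Rn n × ℝ →L[ℝ] ℝ}
    (hg : MemH1With (freeSpace H D u) f g) :
    (fun x => (H + u x) * b x) =ᵐ[volume.restrict (D \ coincidence H D u)]
      sliceInt (freeSpace H D u) (fun p => f p - (u p.1 - p.2) * g p (0, 1)) := by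
  have hΩ := hu.isOpen_freeSpace
  have hD' := hu.measurableSet_coincidence
  have := hu.isFiniteMeasure
  obtain ⟨hbm, -, g', hg', φ, hφ, ht, htr⟩ := hbt
  have hgg : g' =ᵐ[volume.restrict (freeSpace H D u)] g := hg'.ae_eq hΩ hg
  have ht := ht.congr (ae_eq_refl _) hgg
  set μ := (volume : Measure (Rn n × ℝ)).restrict (freeSpace H D u) with hμ
  -- the integrands
  have hw : ContinuousOn (fun p : Rn n × ℝ => u p.1 - p.2) (freeSpace H D u) :=
    (hu.contD.comp continuousOn_fst fun p hp => hp.1).sub continuousOn_snd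
  have hwb : ∀ᵐ p ∂μ, ‖u p.1 - p.2‖ ≤ M := by
    refine (ae_restrict_iff' hΩ.measurableSet).2 (Eventually.of_forall fun p hp => ?_)
    rw [Real.norm_eq_abs, abs_le]
    have := hu.add_nonneg_le hp.1
    exact ⟨by linarith [hp.2.1, hp.2.2], by linarith [hp.2.1, hp.2.2]⟩
  have hwm : AEStronglyMeasurable (fun p : Rn n × ℝ => u p.1 - p.2) μ :=
    hw.aestronglyMeasurable hΩ.measurableSet
  have hmul : ∀ F : Rn n × ℝ → ℝ, MemLp F 2 μ → MemLp (fun p => (u p.1 - p.2) * F p) 2 μ := by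
    intro F hF
    refine hF.of_le_mul (c := M) (hwm.mul hF.1) ?_
    filter_upwards [hwb] with p hp
    rw [norm_mul]
    exact mul_le_mul_of_nonneg_right hp (norm_nonneg _)
  have hφL := fun k => (hφ k).memLp hΩ hu.isBounded_freeSpace
  have m1 : ∀ k, MemLp (fun p => φ k p - (u p.1 - p.2) * fderiv ℝ (φ k) p (0, 1)) 2 μ :=
    fun k => (hφL k).1.sub (hmul _ (memLp_apply (hφL k).2 (0, 1)))
  have m2 : MemLp (fun p => f p - (u p.1 - p.2) * g p (0, 1)) 2 μ :=
    hg.1.sub (hmul _ (memLp_apply hg.2.2 (0, 1)))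
  have mz : ∀ k, MemLp (fun p => fderiv ℝ (φ k) p (0, 1) - g p (0, 1)) 2 μ := fun k =>
    (memLp_apply (hφL k).2 (0, 1)).sub (memLp_apply hg.2.2 (0, 1))
  have tz : Tendsto (fun k => eLpNorm (fun p =>
      (u p.1 - p.2) * (fderiv ℝ (φ k) p (0, 1) - g p (0, 1))) 2 μ) atTop (𝓝 0) := by
    have t := ENNReal.Tendsto.const_mul (a := ENNReal.ofReal M) (tendsto_eLpNorm_vert ht.2)
      (Or.inr ENNReal.ofReal_ne_top)
    rw [mul_zero] at t
    refine tendsto_of_tendsto_of_tendsto_of_le_of_le tendsto_const_nhds t (fun _ => zero_le)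
      fun k => eLpNorm_le_mul_eLpNorm_of_ae_le_mul ?_ 2
    filter_upwards [hwb] with p hp
    rw [norm_mul]
    exact mul_le_mul_of_nonneg_right hp (norm_nonneg _)
  have tF : Tendsto (fun k => eLpNorm (fun p =>
      (φ k p - (u p.1 - p.2) * fderiv ℝ (φ k) p (0, 1)) -
        (f p - (u p.1 - p.2) * g p (0, 1))) 2 μ) atTop (𝓝 0) := by
    refine tendsto_eLpNorm_linearComb 1 (-1) (fun k => ((hφL k).1.sub hg.1).1)
      (fun k => (hmul _ (mz k)).1) ht.1 tz fun k => Eventually.of_forall fun p => ?_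
    simp only [Pi.sub_apply, smul_eq_mul]
    ring
  have tS := tendsto_eLpNorm_sliceInt hΩ.measurableSet ENNReal.ofReal_ne_top
    hu.volume_slice_le m1 m2 tF
  -- the traces
  set ν := (volume : Measure (Rn n)).restrict (D \ coincidence H D u) with hν
  have tS' : Tendsto (fun k => eLpNorm (fun x => sliceInt (freeSpace H D u)
      (fun p => φ k p - (u p.1 - p.2) * fderiv ℝ (φ k) p (0, 1)) x -
      sliceInt (freeSpace H D u) (fun p => f p - (u p.1 - p.2) * g p (0, 1)) x) 2 ν)
      atTop (𝓝 0) :=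
    tendsto_of_tendsto_of_tendsto_of_le_of_le tendsto_const_nhds tS (fun _ => zero_le)
      fun k => eLpNorm_mono_measure _ Measure.restrict_le_self
  have hform : ∀ k, ∀ x ∈ D \ coincidence H D u, sliceInt (freeSpace H D u)
      (fun p => φ k p - (u p.1 - p.2) * fderiv ℝ (φ k) p (0, 1)) x =
        (H + u x) * φ k (x, -H) := by
    intro k x hx
    have key := (hφ k).integral_slice hΩ hx.1 (hu.lt_of_notMem hx) (u x) (-1)
    have e : sliceInt (freeSpace H D u)
        (fun p => φ k p - (u p.1 - p.2) * fderiv ℝ (φ k) p (0, 1)) x =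
        -sliceInt (freeSpace H D u)
          (fun p => -1 * φ k p + (u x + -1 * p.2) * fderiv ℝ (φ k) p (0, 1)) x := by
      simp only [sliceInt]
      rw [← integral_neg]
      refine integral_congr_ae (Eventually.of_forall fun z => ?_)
      by_cases hm : (x, z) ∈ freeSpace H D u
      · simp only [indicator_of_mem hm]; ring
      · simp only [indicator_of_notMem hm, neg_zero]
    rw [e, key]
    ring
  -- Since `(H + u)² ≤ M (H + u)`, the weighted convergence in the definition of the trace is `L²`
  -- convergence of the values multiplied by `H + u`.
  have tb : Tendsto (fun k => eLpNorm (fun x => (H + u x) * b x - sliceInt (freeSpace H D u)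
      (fun p => φ k p - (u p.1 - p.2) * fderiv ℝ (φ k) p (0, 1)) x) 2 ν) atTop (𝓝 0) := by
    rw [tendsto_eLpNorm_two_iff]
    have t := ENNReal.Tendsto.const_mul (a := ENNReal.ofReal M) htr (Or.inr ENNReal.ofReal_ne_top)
    rw [mul_zero] at t
    refine tendsto_of_tendsto_of_tendsto_of_le_of_le tendsto_const_nhds t (fun _ => zero_le)
      fun k => ?_
    simp only
    rw [← lintegral_const_mul' _ _ ENNReal.ofReal_ne_top]
    refine setLIntegral_mono_ae' hD' (Eventually.of_forall fun x hx => ?_)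
    have h0 := hu.add_nonneg_le hx.1
    rw [hform k x hx, ← ENNReal.ofReal_mul (h0.1.trans h0.2), ← ofReal_norm,
      ← ENNReal.ofReal_pow (norm_nonneg _), Real.norm_eq_abs, sq_abs]
    refine ENNReal.ofReal_le_ofReal ?_
    have : ((H + u x) * b x - (H + u x) * φ k (x, -H)) ^ 2 =
      (H + u x) * ((φ k (x, -H) - b x) ^ 2 * (H + u x)) := by ring
    rw [this]
    exact mul_le_mul_of_nonneg_right h0.2 (mul_nonneg (sq_nonneg _) h0.1)
  have hum : AEStronglyMeasurable (fun x => (H + u x) * b x) ν := by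
    have h1 : AEStronglyMeasurable u (volume.restrict D) :=
      hu.contD.aestronglyMeasurable hu.isOpen.measurableSet
    exact (((aestronglyMeasurable_const.add h1).mul hbm)).mono_measure
      (Measure.restrict_mono sdiff_subset le_rfl)
  have sm1 := fun k => (aestronglyMeasurable_sliceInt hΩ.measurableSet (m1 k).1).mono_measure
    (Measure.restrict_le_self (s := D \ coincidence H D u))
  have sm2 := (aestronglyMeasurable_sliceInt hΩ.measurableSet m2.1).mono_measure
    (Measure.restrict_le_self (s := D \ coincidence H D u))
  have hz : eLpNorm (fun x => (H + u x) * b x -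
      sliceInt (freeSpace H D u) (fun p => f p - (u p.1 - p.2) * g p (0, 1)) x) 2 ν = 0 := by
    have t := tb.add tS'
    rw [add_zero] at t
    refine le_antisymm (ge_of_tendsto' t fun k => ?_) zero_le
    exact eLpNorm_triangle_sub (hum.sub (sm1 k)) ((sm1 k).sub sm2)
  filter_upwards [(eLpNorm_eq_zero_iff (hum.sub sm2) two_ne_zero).1 hz] with x hx
  exact sub_eq_zero.1 hx

/-- The right-hand side of the trace identity involves only `f` and its gradient, so two traces
agree after multiplication by `H + u`. This factor is positive off the coincidence set, and on it
both traces are zero by convention. -/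
lemma Deflection.ae_eq_bottomTrace (hu : Deflection H M D u γ) {f : Rn n × ℝ → ℝ} {b : Rn n → ℝ}
    {g : Rn n × ℝ → Rn n × ℝ →L[ℝ] ℝ} (hbt : IsBottomTrace H D u f b)
    (h : H1ClosureWith (freeSpace H D u) (C1B H D u) f g) :
    b =ᵐ[volume.restrict D] bottomTrace H D u g := by
  have hT := hu.isBottomTrace h
  have e := (hu.trace_identity hbt h.1).trans (hu.trace_identity hT h.1).symm
  have e' := (ae_restrict_iff' hu.measurableSet_coincidence).1 e
  refine (ae_restrict_iff' hu.isOpen.measurableSet).2 ?_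
  filter_upwards [e'] with x hx hxD
  by_cases hc : x ∈ coincidence H D u
  · rw [hbt.2.1 x hc, hT.2.1 x hc]
  · have hx' : x ∈ D \ coincidence H D u := ⟨hxD, hc⟩
    have := hu.lt_of_notMem hx'
    exact mul_left_cancel₀ (by linarith : H + u x ≠ 0) (hx hx')

/-- The gradient of `h(x, z, u(x))` in `Ω(u)`. -/
noncomputable abbrev upperGrad (H : ℝ) (D : Set (Rn n)) (u : Rn n → ℝ)
    (γ : Rn n → Rn n →L[ℝ] ℝ) (h : Rn n × ℝ × ℝ → ℝ) : Rn n × ℝ → Rn n × ℝ →L[ℝ] ℝ :=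
  pullGrad (upperDom H D) h id 1 u γ

/-- The jump of the boundary data across the layer. -/
noncomputable def dataJump (H : ℝ) (u : Rn n → ℝ) (hb h : Rn n × ℝ × ℝ → ℝ) (x : Rn n) : ℝ :=
  h (x, -H, u x) - hb (x, -H - 1, u x)

/-- The limit energy in terms of the gradient. -/
noncomputable def gradEnergy (H : ℝ) (D : Set (Rn n)) (u : Rn n → ℝ)
    (γ : Rn n → Rn n →L[ℝ] ℝ) (σ : Rn n × ℝ → ℝ) (hb h : Rn n × ℝ × ℝ → ℝ)
    (g : Rn n × ℝ → Rn n × ℝ →L[ℝ] ℝ) : ℝ≥0∞ :=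
  1 / 2 * (∫⁻ p in freeSpace H D u, ENNReal.ofReal (gradSq (g p + upperGrad H D u γ h p))) +
    1 / 2 * ∫⁻ x in D, ENNReal.ofReal
      (σ (x, -H) * (bottomTrace H D u g x + dataJump H u hb h x) ^ 2)

lemma memLp_upperGrad (hu : Deflection H M D u γ) (hd : BoundaryPair H D hb h) :
    MemLp (upperGrad H D u γ h) 2 (volume.restrict (freeSpace H D u)) :=
  (memH1With_upperData hu hd).2.2

lemma MemH1With.add_upperData (hu : Deflection H M D u γ) (hd : BoundaryPair H D hb h)
    {f : Rn n × ℝ → ℝ} {g : Rn n × ℝ → Rn n × ℝ →L[ℝ] ℝ} (hf : MemH1With (freeSpace H D u) f g) :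
    MemH1With (freeSpace H D u) (fun p => f p + h (p.1, p.2, u p.1))
      fun p => g p + upperGrad H D u γ h p :=
  hf.add (memH1With_upperData hu hd)

/-- Weak gradients and traces are unique up to null sets, so each infimum in the definition runs
over a single value. -/
lemma energyLimit_eq (hu : Deflection H M D u γ) (hd : BoundaryPair H D hb h) {θ : L2M H M D}
    (h0 : ∀ᵐ p ∂(volume.restrict (container H M D \ freeSpace H D u)), θ p = 0)
    {g : Rn n × ℝ → Rn n × ℝ →L[ℝ] ℝ}
    (hg : H1ClosureWith (freeSpace H D u) (C1B H D u) θ g) :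
    energyLimit H M D u σ hb h θ = gradEnergy H D u γ σ hb h g := by
  have hin : InH1B H M D u θ := ⟨⟨g, hg⟩, h0⟩
  rw [energyLimit, if_pos hin, gradEnergy]
  congr 2
  · rw [dirichletIntegral_eq hu.isOpen_freeSpace (MemH1With.add_upperData hu hd hg.1).2.1]
    simp only [one_mul]
  · rw [robinIntegral]
    have key : ∀ b, IsBottomTrace H D u θ b → ∫⁻ x in D, ENNReal.ofReal
        (σ (x, -H) * (b x + h (x, -H, u x) - hb (x, -H - 1, u x)) ^ 2) =
        ∫⁻ x in D, ENNReal.ofReal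
          (σ (x, -H) * (bottomTrace H D u g x + dataJump H u hb h x) ^ 2) := by
      intro b hb'
      refine lintegral_congr_ae ?_
      filter_upwards [hu.ae_eq_bottomTrace hb' hg] with x hx
      rw [hx, dataJump, add_sub_assoc]
    refine le_antisymm ?_ (le_iInf₂ fun b hb' => (key b hb').ge)
    exact (iInf₂_le _ (hu.isBottomTrace hg)).trans (key _ (hu.isBottomTrace hg)).le

end LimitEnergy

end MEMS

namespace MEMS

/-! ### Weak compactness -/

/-- A closed convex set in a product with a Hilbert space contains limits in the first component,
as long as the second component stays bounded. -/
lemma exists_mem_of_convex_isClosed {Y 𝓗 : Type*} [NormedAddCommGroup Y] [NormedSpace ℝ Y]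
    [NormedAddCommGroup 𝓗] [InnerProductSpace ℝ 𝓗] [CompleteSpace 𝓗] {A : Set (Y × 𝓗)}
    (hc : Convex ℝ A) (hcl : IsClosed A) {R : ℝ} {θ : Y}
    (h : ∀ r > 0, ∃ p ∈ A, dist p.1 θ ≤ r ∧ ‖p.2‖ ≤ R) : ∃ y, (θ, y) ∈ A ∧ ‖y‖ ≤ R := by
  set r : ℕ → ℝ := fun k => 1 / ((k : ℝ) + 1) with hr
  have r0 : ∀ k, 0 < r k := fun k => by positivity
  have rmono : ∀ k l, k ≤ l → r l ≤ r k := fun k l hkl =>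
    one_div_le_one_div_of_le (by positivity) (by have : (k : ℝ) ≤ l := mod_cast hkl
                                                 linarith)
  have rlim : Tendsto r atTop (𝓝 0) := tendsto_one_div_add_atTop_nhds_zero_nat
  -- These sets are convex and decrease with `k`. Their distances `d k` from the origin therefore
  -- increase, bounded by `R`, and elements of nearly minimal norm form a Cauchy sequence; this
  -- replaces weak compactness and Mazur's lemma.
  set K : ℕ → Set 𝓗 := fun k => {g | ∃ θ', dist θ' θ ≤ r k ∧ (θ', g) ∈ A} with hK
  set d : ℕ → ℝ := fun k => sInf (norm '' K k) with hd
  have Kmono : ∀ k l, k ≤ l → K l ⊆ K k := fun k l hkl g hg => by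
    obtain ⟨θ', h1, h2⟩ := hg
    exact ⟨θ', h1.trans (rmono k l hkl), h2⟩
  have bdd : ∀ k, BddBelow (norm '' K k) := fun k => ⟨0, by rintro _ ⟨g, -, rfl⟩; positivity⟩
  have ne : ∀ k, (norm '' K k).Nonempty := fun k => by
    obtain ⟨p, hp, h1, -⟩ := h (r k) (r0 k)
    exact ⟨_, p.2, ⟨p.1, h1, hp⟩, rfl⟩
  have dle : ∀ k, ∀ g ∈ K k, d k ≤ ‖g‖ := fun k g hg => csInf_le (bdd k) ⟨g, hg, rfl⟩
  have dR : ∀ k, d k ≤ R := fun k => by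
    obtain ⟨p, hp, h1, h2⟩ := h (r k) (r0 k)
    exact (dle k p.2 ⟨p.1, h1, hp⟩).trans h2
  have d0 : ∀ k, 0 ≤ d k := fun k => Real.sInf_nonneg (by rintro _ ⟨g, -, rfl⟩; positivity)
  have dmono : Monotone d := fun k l hkl =>
    csInf_le_csInf (bdd k) (ne l) (image_mono (Kmono k l hkl))
  have hdb : BddAbove (range d) := ⟨R, by rintro _ ⟨k, rfl⟩; exact dR k⟩
  have dlim := tendsto_atTop_ciSup dmono hdb
  set s := ⨆ k, d k with hs
  have ds : ∀ k, d k ≤ s := fun k => le_ciSup hdb k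
  have hex : ∀ k, ∃ p ∈ A, dist p.1 θ ≤ r k ∧ ‖p.2‖ < d k + r k := fun k => by
    obtain ⟨_, ⟨g, ⟨θ', h1, h2⟩, rfl⟩, h3⟩ :=
      exists_lt_of_csInf_lt (ne k) (lt_add_of_pos_right (d k) (r0 k))
    exact ⟨(θ', g), h2, h1, h3⟩
  choose p hpA hpθ hpn using hex
  -- The radicand comes from the parallelogram law: `‖a - b‖² = 2‖a‖² + 2‖b‖² - ‖a + b‖²`, where
  -- both norms are at most `s + r k` and the midpoint lies in `K k`, hence has norm at least `d k`.
  have blim : Tendsto (fun k => Real.sqrt (4 * (s + r k) ^ 2 - 4 * d k ^ 2)) atTop (𝓝 0) := by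
    have : Tendsto (fun k => 4 * (s + r k) ^ 2 - 4 * d k ^ 2) atTop
        (𝓝 (4 * (s + 0) ^ 2 - 4 * s ^ 2)) :=
      (((tendsto_const_nhds.add rlim).pow 2).const_mul 4).sub ((dlim.pow 2).const_mul 4)
    simpa using this.sqrt
  have hcauchy : CauchySeq fun k => (p k).2 := by
    refine cauchySeq_of_le_tendsto_0' _ (fun k l hkl => ?_) blim
    have hmid : (1 / 2 : ℝ) • (p k).2 + (1 / 2 : ℝ) • (p l).2 ∈ K k := by
      refine ⟨(1 / 2 : ℝ) • (p k).1 + (1 / 2 : ℝ) • (p l).1, ?_,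
        hc (hpA k) (hpA l) (by norm_num) (by norm_num) (by norm_num)⟩
      have hb := (convex_closedBall θ (r k)) (mem_closedBall_iff_norm.2
        (by simpa [dist_eq_norm] using hpθ k)) (mem_closedBall_iff_norm.2
        (by simpa [dist_eq_norm] using (hpθ l).trans (rmono k l hkl)))
        (a := 1 / 2) (b := 1 / 2) (by norm_num) (by norm_num) (by norm_num)
      exact hb
    have h1 := dle k _ hmid
    rw [← smul_add, norm_smul, Real.norm_of_nonneg (by norm_num : (0 : ℝ) ≤ 1 / 2)] at h1
    have hpar := parallelogram_law_with_norm ℝ (p k).2 (p l).2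
    have hk : ‖(p k).2‖ ≤ s + r k := (hpn k).le.trans (by linarith [ds k])
    have hl : ‖(p l).2‖ ≤ s + r k := (hpn l).le.trans (by linarith [ds l, rmono k l hkl])
    rw [dist_eq_norm]
    refine Real.le_sqrt_of_sq_le ?_
    nlinarith [norm_nonneg (p k).2, norm_nonneg (p l).2, d0 k, norm_nonneg ((p k).2 + (p l).2)]
  obtain ⟨y, hy⟩ := cauchySeq_tendsto_of_complete hcauchy
  have hθ : Tendsto (fun k => (p k).1) atTop (𝓝 θ) :=
    tendsto_iff_dist_tendsto_zero.2 (squeeze_zero (fun _ => dist_nonneg) hpθ rlim)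
  refine ⟨y, hcl.mem_of_tendsto (hθ.prodMk_nhds hy) (Eventually.of_forall hpA), ?_⟩
  have : Tendsto (fun k => R + r k) atTop (𝓝 (R + 0)) := tendsto_const_nhds.add rlim
  rw [add_zero] at this
  exact le_of_tendsto_of_tendsto' hy.norm this fun k => (hpn k).le.trans (by linarith [dR k])

/-! ### Lower semicontinuity of the limit energy -/

section Lsc

variable {n : ℕ} {H M : ℝ} {D : Set (Rn n)} {u : Rn n → ℝ} {γ : Rn n → Rn n →L[ℝ] ℝ}
  {σ : Rn n × ℝ → ℝ} {hb h : Rn n × ℝ × ℝ → ℝ}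

/-- The assumptions on the permittivity of the layer. -/
structure LayerPermittivity (H : ℝ) (D : Set (Rn n)) (σ : Rn n × ℝ → ℝ) : Prop where
  cont : ContinuousOn σ (closure D ×ˢ Icc (-H - 1) (-H))
  pos : ∀ p ∈ closure D ×ˢ Icc (-H - 1) (-H), 0 < σ p

lemma IsC1Closure.linearComb {Ω : Set (Rn n × ℝ)} (hΩ : IsOpen Ω) {φ ψ : Rn n × ℝ → ℝ}
    (h₁ : IsC1Closure Ω φ) (h₂ : IsC1Closure Ω ψ) (a b : ℝ) :
    IsC1Closure Ω fun x => a * φ x + b * ψ x := by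
  obtain ⟨d₁, c₁, Φ, k₁, e₁⟩ := h₁
  obtain ⟨d₂, c₂, Ψ, k₂, e₂⟩ := h₂
  refine ⟨(contDiffOn_const.mul d₁).add (contDiffOn_const.mul d₂),
    (continuousOn_const.mul c₁).add (continuousOn_const.mul c₂),
    fun x => a • Φ x + b • Ψ x, (k₁.const_smul a).add (k₂.const_smul b), fun x hx => ?_⟩
  have f₁ := ((d₁.contDiffAt (hΩ.mem_nhds hx)).differentiableAt one_ne_zero).hasFDerivAt
  have f₂ := ((d₂.contDiffAt (hΩ.mem_nhds hx)).differentiableAt one_ne_zero).hasFDerivAt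
  refine Eq.trans ?_ ((f₁.const_mul a).add (f₂.const_mul b)).fderiv.symm
  simp only [e₁ x hx, e₂ x hx]

lemma C1B.linearComb (hΩ : IsOpen (freeSpace H D u)) {φ ψ : Rn n × ℝ → ℝ} (h₁ : φ ∈ C1B H D u)
    (h₂ : ψ ∈ C1B H D u) (a b : ℝ) : (fun x => a * φ x + b * ψ x) ∈ C1B H D u := by
  refine ⟨h₁.1.linearComb hΩ h₂.1 a b, fun x hx => ?_, fun x hx z hz => ?_⟩
  · simp [h₁.2.1 x hx, h₂.2.1 x hx]
  · simp [h₁.2.2 x hx z hz, h₂.2.2 x hx z hz]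

/-- The weight of the trace in the limit energy. -/
noncomputable def traceWeight (H : ℝ) (σ : Rn n × ℝ → ℝ) (x : Rn n) : ℝ := Real.sqrt (σ (x, -H))

lemma LayerPermittivity.continuousOn_weight (hσ : LayerPermittivity H D σ) :
    ContinuousOn (traceWeight H σ) (closure D) := by
  refine (hσ.cont.comp (f := fun x : Rn n => (x, -H)) (by fun_prop) fun x hx => ?_).sqrt
  exact ⟨hx, by constructor <;> linarith⟩

lemma LayerPermittivity.weight_sq (hσ : LayerPermittivity H D σ) {x : Rn n} (hx : x ∈ D) :
    traceWeight H σ x ^ 2 = σ (x, -H) :=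
  Real.sq_sqrt (hσ.pos (x, -H) ⟨subset_closure hx, by constructor <;> linarith⟩).le

lemma exists_bound_dataJump (hu : Deflection H M D u γ) (hd : BoundaryPair H D hb h) :
    ∃ B, ∀ x ∈ D, |dataJump H u hb h x| ≤ B := by
  obtain ⟨B₁, h₁⟩ := hu.exists_bound_pull hd.layer.continuousOn isCompact_Icc
  refine ⟨B₁ + B₁, fun x hx => ?_⟩
  have e := hd.eq x hx (u x) (hu.lower x hx)
  rw [dataJump, ← e]
  refine (abs_sub _ _).trans (add_le_add (h₁ (x, -H) ⟨hx, ?_⟩) (h₁ (x, -H - 1) ⟨hx, ?_⟩)) <;>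
  constructor <;> simp

lemma continuousOn_dataJump (hu : Deflection H M D u γ) (hd : BoundaryPair H D hb h) :
    ContinuousOn (dataJump H u hb h) D := by
  have g : ∀ c : ℝ, ContinuousOn (fun x : Rn n => (x, c, u x)) D := fun c =>
    continuousOn_id.prodMk (continuousOn_const.prodMk hu.contD)
  refine ContinuousOn.sub (hd.upper.continuousOn.comp (g (-H)) fun x hx => ?_)
    (hd.layer.continuousOn.comp (g (-H - 1)) fun x hx => ?_)
  · exact ⟨subset_closure hx, self_mem_Ici, hu.lower x hx⟩
  · exact ⟨subset_closure hx, by constructor <;> linarith, hu.lower x hx⟩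

lemma memLp_dataJump (hu : Deflection H M D u γ) (hd : BoundaryPair H D hb h) :
    MemLp (dataJump H u hb h) 2 (volume.restrict D) := by
  have := isFiniteMeasure_restrict_of_isBounded hu.isBounded
  obtain ⟨B, hB⟩ := exists_bound_dataJump hu hd
  exact MemLp.of_bound ((continuousOn_dataJump hu hd).aestronglyMeasurable
    hu.isOpen.measurableSet) B
    ((ae_restrict_iff' hu.isOpen.measurableSet).2 (Eventually.of_forall hB))

lemma weight_bound (hu : Deflection H M D u γ) (hσ : LayerPermittivity H D σ) :
    ∃ B, ∀ᵐ x ∂(volume.restrict D), ‖traceWeight H σ x‖ ≤ B := by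
  obtain ⟨B, hB⟩ := hu.isBounded.isCompact_closure.exists_bound_of_continuousOn
    hσ.continuousOn_weight
  exact ⟨B, (ae_restrict_iff' hu.isOpen.measurableSet).2
    (Eventually.of_forall fun x hx => hB x (subset_closure hx))⟩

/-- The weighted jump across the layer. -/
noncomputable def robinTerm (H : ℝ) (D : Set (Rn n)) (u : Rn n → ℝ) (σ : Rn n × ℝ → ℝ)
    (hb h : Rn n × ℝ × ℝ → ℝ) (g : Rn n × ℝ → Rn n × ℝ →L[ℝ] ℝ) (x : Rn n) : ℝ :=
  traceWeight H σ x * (bottomTrace H D u g x + dataJump H u hb h x)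

lemma memLp_weight_mul (hu : Deflection H M D u γ) (hσ : LayerPermittivity H D σ) {f : Rn n → ℝ}
    (hf : MemLp f 2 (volume.restrict D)) :
    MemLp (fun x => traceWeight H σ x * f x) 2 (volume.restrict D) := by
  obtain ⟨B, hB⟩ := weight_bound hu hσ
  refine hf.of_le_mul (c := B) (((hσ.continuousOn_weight.mono
    subset_closure).aestronglyMeasurable hu.isOpen.measurableSet).mul hf.1) ?_
  filter_upwards [hB] with x hx
  rw [norm_mul]
  exact mul_le_mul_of_nonneg_right hx (norm_nonneg _)

lemma memLp_robinTerm (hu : Deflection H M D u γ) (hd : BoundaryPair H D hb h)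
    (hσ : LayerPermittivity H D σ) {g : Rn n × ℝ → Rn n × ℝ →L[ℝ] ℝ}
    (hg : MemLp g 2 (volume.restrict (freeSpace H D u))) :
    MemLp (robinTerm H D u σ hb h g) 2 (volume.restrict D) :=
  memLp_weight_mul hu hσ (memLp_fun_add (hu.memLp_bottomTrace hg) (memLp_dataJump hu hd))

lemma gradEnergy_eq (hu : Deflection H M D u γ) (hσ : LayerPermittivity H D σ)
    (g : Rn n × ℝ → Rn n × ℝ →L[ℝ] ℝ) : gradEnergy H D u γ σ hb h g =
      1 / 2 * (eLpNorm (fun p => toVec (g p + upperGrad H D u γ h p)) 2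
        (volume.restrict (freeSpace H D u)) ^ 2 +
        eLpNorm (robinTerm H D u σ hb h g) 2 (volume.restrict D) ^ 2) := by
  rw [gradEnergy, ← mul_add, eLpNorm_two_sq, eLpNorm_two_sq]
  simp_rw [ofReal_gradSq]
  congr 2
  refine setLIntegral_congr_fun hu.isOpen.measurableSet fun x hx => ?_
  rw [← hσ.weight_sq hx, ← mul_pow, ← sq_abs, ENNReal.ofReal_pow (abs_nonneg _),
    ← Real.norm_eq_abs, ofReal_norm]
  rfl

/-- The Hilbert space of gradients in `Ω(u)` and traces on `D`. -/
abbrev PairSpace (H : ℝ) (D : Set (Rn n)) (u : Rn n → ℝ) : Type :=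
  WithLp 2 (Lp (GradVec n) 2 ((volume : Measure (Rn n × ℝ)).restrict (freeSpace H D u)) ×
    Lp ℝ 2 ((volume : Measure (Rn n)).restrict D))

/-- The functions in `H¹_B(Ω(u))` with the two terms that make up their energy. -/
def energyGraph (H M : ℝ) (D : Set (Rn n)) (u : Rn n → ℝ) (γ : Rn n → Rn n →L[ℝ] ℝ)
    (σ : Rn n × ℝ → ℝ) (hb h : Rn n × ℝ × ℝ → ℝ) : Set (L2M H M D × PairSpace H D u) :=
  {q | (∀ᵐ p ∂(volume.restrict (container H M D \ freeSpace H D u)), q.1 p = 0) ∧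
    ∃ g, H1ClosureWith (freeSpace H D u) (C1B H D u) q.1 g ∧
      q.2.fst =ᵐ[volume.restrict (freeSpace H D u)]
        (fun p => toVec (g p + upperGrad H D u γ h p)) ∧
      q.2.snd =ᵐ[volume.restrict D] robinTerm H D u σ hb h g}

lemma enorm_sq_pair (y : PairSpace H D u) : ‖y‖ₑ ^ 2 = ‖y.fst‖ₑ ^ 2 + ‖y.snd‖ₑ ^ 2 := by
  rw [← ofReal_norm, ← ofReal_norm, ← ofReal_norm, ← ENNReal.ofReal_pow (norm_nonneg _),
    ← ENNReal.ofReal_pow (norm_nonneg _), ← ENNReal.ofReal_pow (norm_nonneg _),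
    ← ENNReal.ofReal_add (by positivity) (by positivity), WithLp.prod_norm_sq_eq_of_L2]

lemma energyLimit_of_mem_energyGraph (hu : Deflection H M D u γ) (hd : BoundaryPair H D hb h)
    (hσ : LayerPermittivity H D σ) {θ : L2M H M D} {y : PairSpace H D u}
    (hq : (θ, y) ∈ energyGraph H M D u γ σ hb h) :
    energyLimit H M D u σ hb h θ = 1 / 2 * ‖y‖ₑ ^ 2 := by
  obtain ⟨h0, g, hg, e1, e2⟩ := hq
  rw [energyLimit_eq hu hd h0 hg, gradEnergy_eq hu hσ, enorm_sq_pair, Lp.enorm_def, Lp.enorm_def,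
    eLpNorm_congr_ae e1, eLpNorm_congr_ae e2]

lemma exists_mem_energyGraph (hu : Deflection H M D u γ) (hd : BoundaryPair H D hb h)
    (hσ : LayerPermittivity H D σ) {θ : L2M H M D}
    (h0 : ∀ᵐ p ∂(volume.restrict (container H M D \ freeSpace H D u)), θ p = 0)
    {g : Rn n × ℝ → Rn n × ℝ →L[ℝ] ℝ}
    (hg : H1ClosureWith (freeSpace H D u) (C1B H D u) θ g) :
    ∃ y, (θ, y) ∈ energyGraph H M D u γ σ hb h := by
  have hgV : MemLp (fun p => g p + upperGrad H D u γ h p) 2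
      (volume.restrict (freeSpace H D u)) := memLp_fun_add hg.1.2.2 (memLp_upperGrad hu hd)
  have m1 : MemLp (fun p => toVec (g p + upperGrad H D u γ h p)) 2
      (volume.restrict (freeSpace H D u)) := toVec.comp_memLp' hgV
  have m2 := memLp_robinTerm hu hd hσ hg.1.2.2
  exact ⟨WithLp.toLp 2 (m1.toLp _, m2.toLp _), h0, g, hg, m1.coeFn_toLp, m2.coeFn_toLp⟩

lemma InH1B.exists_mem_energyGraph (hu : Deflection H M D u γ) (hd : BoundaryPair H D hb h)
    (hσ : LayerPermittivity H D σ) {θ : L2M H M D} (hθ : InH1B H M D u θ) :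
    ∃ y, (θ, y) ∈ energyGraph H M D u γ σ hb h := by
  obtain ⟨⟨g, hg⟩, h0⟩ := hθ
  exact MEMS.exists_mem_energyGraph hu hd hσ h0 hg

/-- On `H¹_B` the energy is half a squared norm: the gradient term is in `L²`, and the trace lies in
`L²(D)` without weight, so the Robin term is finite even when `u` touches the plate. -/
lemma energyLimit_lt_top_iff (hu : Deflection H M D u γ) (hd : BoundaryPair H D hb h)
    (hσ : LayerPermittivity H D σ) (θ : L2M H M D) :
    energyLimit H M D u σ hb h θ < ⊤ ↔ InH1B H M D u θ := by
  constructor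
  · intro hlt
    by_contra hn
    rw [energyLimit, if_neg hn] at hlt
    exact lt_irrefl _ hlt
  · intro hθ
    obtain ⟨y, hy⟩ := hθ.exists_mem_energyGraph hu hd hσ
    rw [energyLimit_of_mem_energyGraph hu hd hσ hy]
    exact ENNReal.mul_lt_top (by simp) (by simp)

/-- Both energy components are affine in the gradient, with inhomogeneities from the data that are
preserved by convex combinations. -/
lemma convex_energyGraph (hu : Deflection H M D u γ) :
    Convex ℝ (energyGraph H M D u γ σ hb h) := by
  rintro ⟨θ₁, y₁⟩ ⟨z₁, g₁, hg₁, e₁, f₁⟩ ⟨θ₂, y₂⟩ ⟨z₂, g₂, hg₂, e₂, f₂⟩ a b ha hb' hab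
  have hsub : (volume : Measure (Rn n × ℝ)).restrict (container H M D \ freeSpace H D u) ≤
      volume.restrict (container H M D) := Measure.restrict_mono sdiff_subset le_rfl
  have hsub' : (volume : Measure (Rn n × ℝ)).restrict (freeSpace H D u) ≤
      volume.restrict (container H M D) := Measure.restrict_mono hu.freeSpace_subset le_rfl
  have eθ : (a • θ₁ + b • θ₂ : L2M H M D) =ᵐ[volume.restrict (container H M D)]
      fun p => a * θ₁ p + b * θ₂ p := by
    filter_upwards [Lp.coeFn_add (a • θ₁) (b • θ₂), Lp.coeFn_smul a θ₁, Lp.coeFn_smul b θ₂]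
      with p h1 h2 h3
    rw [h1, Pi.add_apply, h2, h3]
    rfl
  refine ⟨?_, fun p => a • g₁ p + b • g₂ p, ?_, ?_, ?_⟩
  · filter_upwards [ae_mono hsub eθ, z₁, z₂] with p h1 h2 h3
    have h2' : θ₁ p = 0 := h2
    have h3' : θ₂ p = 0 := h3
    refine h1.trans ?_
    rw [h2', h3', mul_zero, mul_zero, add_zero]
  · refine (hg₁.linearComb hu.isOpen_freeSpace (fun φ hφ => hφ.1.1)
      (fun φ hφ ψ hψ => C1B.linearComb hu.isOpen_freeSpace hφ hψ a b) hg₂).congr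
      (EventuallyEq.symm (ae_mono hsub' eθ)) (ae_eq_refl _)
  · have e : (a • y₁ + b • y₂ : PairSpace H D u).fst = a • y₁.fst + b • y₂.fst := rfl
    simp only at e₁ e₂
    rw [Prod.snd_add, Prod.smul_snd, Prod.smul_snd]
    simp only
    rw [e]
    filter_upwards [Lp.coeFn_add (a • y₁.fst) (b • y₂.fst), Lp.coeFn_smul a y₁.fst,
      Lp.coeFn_smul b y₂.fst, e₁, e₂] with p h1 h2 h3 h4 h5
    rw [h1, Pi.add_apply, h2, h3, Pi.smul_apply, Pi.smul_apply, h4, h5, ← map_smul, ← map_smul,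
      ← map_add]
    congr 1
    have : b = 1 - a := by linarith
    rw [this]
    module
  · have e : (a • y₁ + b • y₂ : PairSpace H D u).snd = a • y₁.snd + b • y₂.snd := rfl
    simp only at f₁ f₂
    rw [Prod.snd_add, Prod.smul_snd, Prod.smul_snd]
    simp only
    rw [e]
    filter_upwards [Lp.coeFn_add (a • y₁.snd) (b • y₂.snd), Lp.coeFn_smul a y₁.snd,
      Lp.coeFn_smul b y₂.snd, f₁, f₂,
      ae_restrict_of_ae (hu.bottomTrace_linearComb hg₁.1.2.2 hg₂.1.2.2 a b)] with x h1 h2 h3 h4 h5 h6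
    rw [h1, Pi.add_apply, h2, h3, Pi.smul_apply, Pi.smul_apply, h4, h5, robinTerm, robinTerm,
      robinTerm, h6]
    have : b = 1 - a := by linarith
    rw [this, smul_eq_mul, smul_eq_mul]
    ring

lemma eLpNorm_ae_eq_of_tendsto {α : Type*} [MeasurableSpace α] {μ : Measure α} {f : ℕ → α → ℝ}
    {f₁ f₂ : α → ℝ} (h : ∀ k, AEStronglyMeasurable (f k) μ) (h₁ : AEStronglyMeasurable f₁ μ)
    (h₂ : AEStronglyMeasurable f₂ μ)
    (t₁ : Tendsto (fun k => eLpNorm (fun x => f k x - f₁ x) 2 μ) atTop (𝓝 0))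
    (t₂ : Tendsto (fun k => eLpNorm (fun x => f k x - f₂ x) 2 μ) atTop (𝓝 0)) : f₁ =ᵐ[μ] f₂ := by
  have hz : eLpNorm (fun x => f₁ x - f₂ x) 2 μ = 0 := by
    have t := t₁.add t₂
    rw [add_zero] at t
    refine le_antisymm (ge_of_tendsto' t fun k => ?_) zero_le
    have e : eLpNorm (fun x => f k x - f₁ x) 2 μ = eLpNorm (fun x => f₁ x - f k x) 2 μ :=
      eLpNorm_congr_norm_ae (Eventually.of_forall fun x => norm_sub_rev _ _)
    rw [e]
    exact eLpNorm_triangle_sub (h₁.sub (h k)) ((h k).sub h₂)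
  filter_upwards [(eLpNorm_eq_zero_iff (h₁.sub h₂) two_ne_zero).1 hz] with x hx
  exact sub_eq_zero.1 hx

lemma tendsto_robinTerm (hu : Deflection H M D u γ) (hσ : LayerPermittivity H D σ)
    {g : ℕ → Rn n × ℝ → Rn n × ℝ →L[ℝ] ℝ} {g₀ : Rn n × ℝ → Rn n × ℝ →L[ℝ] ℝ}
    (hg : ∀ k, MemLp (g k) 2 (volume.restrict (freeSpace H D u)))
    (hg₀ : MemLp g₀ 2 (volume.restrict (freeSpace H D u)))
    (t : Tendsto (fun k => eLpNorm (fun p => g k p - g₀ p) 2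
      (volume.restrict (freeSpace H D u))) atTop (𝓝 0)) :
    Tendsto (fun k => eLpNorm (fun x => robinTerm H D u σ hb h (g k) x -
      robinTerm H D u σ hb h g₀ x) 2 (volume.restrict D)) atTop (𝓝 0) := by
  obtain ⟨B, hB⟩ := weight_bound hu hσ
  have t1 := ENNReal.Tendsto.const_mul (a := ENNReal.ofReal B) (hu.tendsto_bottomTrace hg hg₀ t)
    (Or.inr ENNReal.ofReal_ne_top)
  rw [mul_zero] at t1
  refine tendsto_of_tendsto_of_tendsto_of_le_of_le tendsto_const_nhds t1 (fun _ => zero_le)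
    fun k => eLpNorm_le_mul_eLpNorm_of_ae_le_mul ?_ 2
  filter_upwards [hB] with x hx
  rw [robinTerm, robinTerm, ← mul_sub, add_sub_add_right_eq_sub, norm_mul]
  exact mul_le_mul_of_nonneg_right hx (norm_nonneg _)

lemma tendsto_eLpNorm_of_tendsto_Lp {α E : Type*} [MeasurableSpace α] {μ : Measure α}
    [NormedAddCommGroup E] {f : ℕ → Lp E 2 μ} {f₀ : Lp E 2 μ} (h : Tendsto f atTop (𝓝 f₀)) :
    Tendsto (fun k => eLpNorm (fun x => f k x - f₀ x) 2 μ) atTop (𝓝 0) :=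
  (Lp.tendsto_Lp_iff_tendsto_eLpNorm' f f₀).1 h

lemma tendsto_eLpNorm_clm {α E F : Type*} [MeasurableSpace α] {μ : Measure α}
    [NormedAddCommGroup E] [NormedSpace ℝ E] [NormedAddCommGroup F] [NormedSpace ℝ F]
    (L : E →L[ℝ] F) {f : ℕ → α → E} {f₀ : α → E}
    (h : Tendsto (fun k => eLpNorm (fun x => f k x - f₀ x) 2 μ) atTop (𝓝 0)) :
    Tendsto (fun k => eLpNorm (fun x => L (f k x) - L (f₀ x)) 2 μ) atTop (𝓝 0) := by
  have t := ENNReal.Tendsto.const_mul (a := ENNReal.ofReal ‖L‖) h (Or.inr ENNReal.ofReal_ne_top)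
  rw [mul_zero] at t
  refine tendsto_of_tendsto_of_tendsto_of_le_of_le tendsto_const_nhds t (fun _ => zero_le)
    fun k => eLpNorm_le_mul_eLpNorm_of_ae_le_mul (Eventually.of_forall fun x => ?_) 2
  rw [← map_sub]
  exact L.le_opNorm _

lemma memLp_fun_sub {α E : Type*} [MeasurableSpace α] {μ : Measure α} [NormedAddCommGroup E]
    {f g : α → E} (hf : MemLp f 2 μ) (hg : MemLp g 2 μ) : MemLp (fun x => f x - g x) 2 μ :=
  hf.sub hg

/-- The first Hilbert component determines the gradient after subtraction of that of the data, so
gradients converge in `L²`. Membership in `H¹_B` and the trace then pass to the limit. -/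
lemma isClosed_energyGraph (hu : Deflection H M D u γ) (hd : BoundaryPair H D hb h)
    (hσ : LayerPermittivity H D σ) : IsClosed (energyGraph H M D u γ σ hb h) := by
  refine IsSeqClosed.isClosed fun q q₀ hq hlim => ?_
  set V := upperGrad H D u γ h with hV
  have mV : MemLp V 2 (volume.restrict (freeSpace H D u)) := memLp_upperGrad hu hd
  have hΩ := hu.isOpen_freeSpace
  have tθ := tendsto_eLpNorm_of_tendsto_Lp ((continuous_fst.tendsto q₀).comp hlim)
  have ty : Tendsto (fun k => (q k).2) atTop (𝓝 q₀.2) := (continuous_snd.tendsto q₀).comp hlim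
  have ty1 := tendsto_eLpNorm_of_tendsto_Lp (((WithLp.fstL 2 ℝ _ _).continuous.tendsto _).comp ty)
  have ty2 := tendsto_eLpNorm_of_tendsto_Lp (((WithLp.sndL 2 ℝ _ _).continuous.tendsto _).comp ty)
  have mono : ∀ {s : Set (Rn n × ℝ)}, s ⊆ container H M D → Tendsto (fun k =>
      eLpNorm (fun p => (q k).1 p - q₀.1 p) 2 (volume.restrict s)) atTop (𝓝 0) := fun hs =>
    tendsto_of_tendsto_of_tendsto_of_le_of_le tendsto_const_nhds tθ (fun _ => zero_le)
      fun k => eLpNorm_mono_measure _ (Measure.restrict_mono hs le_rfl)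
  have mθ : ∀ θ : L2M H M D, ∀ {s : Set (Rn n × ℝ)}, s ⊆ container H M D →
      MemLp θ 2 (volume.restrict s) := fun θ s hs =>
    (Lp.memLp θ).mono_measure (Measure.restrict_mono hs le_rfl)
  choose h0 g hg e1 e2 using hq
  set g₀ : Rn n × ℝ → Rn n × ℝ →L[ℝ] ℝ := fun p => ofVec (q₀.2.fst p) - V p with hg₀
  have m1 : MemLp (fun p => ofVec (q₀.2.fst p)) 2 (volume.restrict (freeSpace H D u)) :=
    ofVec.comp_memLp' (Lp.memLp q₀.2.fst)
  have mg₀ : MemLp g₀ 2 (volume.restrict (freeSpace H D u)) := memLp_fun_sub m1 mV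
  have tg : Tendsto (fun k => eLpNorm (fun p => g k p - g₀ p) 2
      (volume.restrict (freeSpace H D u))) atTop (𝓝 0) := by
    refine (tendsto_eLpNorm_clm ofVec ty1).congr fun k => eLpNorm_congr_ae ?_
    filter_upwards [e1 k] with p hp
    have hp' : ofVec ((q k).2.fst p) = g k p + V p := by rw [hp, ofVec_toVec]
    simp only [hg₀]
    refine (congrArg (fun L => L - ofVec (q₀.2.fst p)) hp').trans ?_
    abel
  refine ⟨?_, g₀, ?_, ?_, ?_⟩
  · refine eLpNorm_ae_eq_of_tendsto (f := fun k => (q k).1) (f₂ := fun _ => 0)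
      (fun k => (mθ _ sdiff_subset).1) (mθ _ sdiff_subset).1 aestronglyMeasurable_const
      (mono sdiff_subset) (tendsto_const_nhds.congr fun k => Eq.symm ?_)
    refine (eLpNorm_congr_ae (g := fun _ => (0 : ℝ)) ?_).trans (by simp)
    filter_upwards [h0 k] with p hp
    rw [hp, sub_zero]
  · exact H1ClosureWith.of_tendsto hΩ (fun φ hφ => hφ.1.1) hg (mθ _ hu.freeSpace_subset) mg₀
      (mono hu.freeSpace_subset) tg
  · refine Eventually.of_forall fun p => ?_
    simp only [hg₀, hV]
    rw [sub_add_cancel, toVec_ofVec]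
  · have mg := fun k => (hg k).1.2.2
    refine eLpNorm_ae_eq_of_tendsto (f := fun k => (q k).2.snd)
      (fun k => (Lp.memLp _).1) (Lp.memLp _).1 (memLp_robinTerm hu hd hσ mg₀).1
      ty2 ((tendsto_robinTerm (hb := hb) (h := h) hu hσ mg mg₀ tg).congr fun k => eLpNorm_congr_ae ?_)
    filter_upwards [e2 k] with x hx
    rw [hx]

/-- Lower semicontinuity of the limit energy. -/
lemma energyLimit_le_of_approx (hu : Deflection H M D u γ) (hd : BoundaryPair H D hb h)
    (hσ : LayerPermittivity H D σ) {θ : L2M H M D} {c : ℝ≥0∞} (hc : c ≠ ⊤)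
    (H0 : ∀ r > 0, ∃ θ' : L2M H M D, dist θ' θ ≤ r ∧ energyLimit H M D u σ hb h θ' ≤ c) :
    energyLimit H M D u σ hb h θ ≤ c := by
  have hy : ∀ y : PairSpace H D u, 1 / 2 * ‖y‖ₑ ^ 2 ≤ c ↔ ‖y‖ ≤ Real.sqrt (2 * c.toReal) := by
    intro y
    rw [Real.le_sqrt (norm_nonneg _), ← ofReal_norm, ← ENNReal.ofReal_pow (norm_nonneg _)]
    have e : (1 / 2 : ℝ≥0∞) = ENNReal.ofReal (1 / 2) := by
      rw [ENNReal.ofReal_div_of_pos two_pos]; simp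
    rw [e, ← ENNReal.ofReal_mul (by norm_num), ENNReal.ofReal_le_iff_le_toReal hc]
    · constructor <;> intro h <;> linarith
    · positivity
  obtain ⟨y, hyA, hyn⟩ := exists_mem_of_convex_isClosed
    (convex_energyGraph (σ := σ) (hb := hb) (h := h) hu)
    (isClosed_energyGraph hu hd hσ) (R := Real.sqrt (2 * c.toReal)) (θ := θ) fun r hr => by
      obtain ⟨θ', h1, h2⟩ := H0 r hr
      have hin := (energyLimit_lt_top_iff hu hd hσ θ').1 (h2.trans_lt hc.lt_top)
      obtain ⟨y, hyA⟩ := hin.exists_mem_energyGraph hu hd hσ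
      rw [energyLimit_of_mem_energyGraph hu hd hσ hyA] at h2
      exact ⟨(θ', y), hyA, h1, (hy y).1 h2⟩
  rw [energyLimit_of_mem_energyGraph hu hd hσ hyA]
  exact (hy y).2 hyn

end Lsc

end MEMS

namespace MEMS

/-! ### Comparison of the energies -/

section Comparison

variable {n : ℕ} {H M δ : ℝ} {D : Set (Rn n)} {u : Rn n → ℝ} {γ : Rn n → Rn n →L[ℝ] ℝ}
  {σ : Rn n × ℝ → ℝ} {hb h : Rn n × ℝ × ℝ → ℝ}

/-- The layer `R_δ`. -/
def layer (H δ : ℝ) (D : Set (Rn n)) : Set (Rn n × ℝ) := D ×ˢ Ioo (-H - δ) (-H)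

lemma layer_slice {x : Rn n} (hx : x ∈ D) : {z | (x, z) ∈ layer H δ D} = Ioo (-H - δ) (-H) := by
  ext z
  simp [layer, hx]

lemma Deflection.measurableSet_layer (hu : Deflection H M D u γ) :
    MeasurableSet (layer H δ D) := hu.isOpen.measurableSet.prod measurableSet_Ioo

lemma Deflection.layer_subset (hu : Deflection H M D u γ) : layer H δ D ⊆ device H δ D u :=
  fun _ hp => ⟨hp.1, hp.2.1, hp.2.2.trans_le (hu.lower _ hp.1)⟩

lemma Deflection.volume_device_slice_le (hu : Deflection H M D u γ) (hδ1 : δ ≤ 1) (x : Rn n) :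
    volume {z | (x, z) ∈ device H δ D u} ≤ ENNReal.ofReal (M + H + 1) := by
  refine (measure_mono (fun z hz => ?_ : _ ⊆ Ioo (-H - 1) M)).trans (le_of_eq ?_)
  · exact ⟨by linarith [hz.2.1], hz.2.2.trans_le (hu.le_M hz.1)⟩
  · rw [Real.volume_Ioo]
    congr 1
    ring

lemma Deflection.isFiniteMeasure_device (hu : Deflection H M D u γ) (hδ1 : δ ≤ 1) :
    IsFiniteMeasure ((volume : Measure (Rn n × ℝ)).restrict (device H δ D u)) :=
  isFiniteMeasure_restrict_of_isBounded (hu.isBounded_container.subset (hu.device_subset hδ1))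

/-- Vanishing on the graph of `u` and on the lateral boundary is inherited from the device; at the
plate, which is interior to the device, `C¹_B` imposes nothing except where the graph or the lateral
boundary reaches it. -/
lemma IsTestFunction.mem_C1B (hu : Deflection H M D u γ) {φ : Rn n × ℝ → ℝ}
    (hφ : IsTestFunction (device H δ D u) φ) : φ ∈ C1B H D u := by
  have h1 : ContDiff ℝ 1 φ := hφ.1.of_le (by norm_cast)
  refine ⟨⟨h1.contDiffOn, h1.continuous.continuousOn, fderiv ℝ φ,
    (h1.continuous_fderiv one_ne_zero).continuousOn, fun _ _ => rfl⟩, fun x hx => ?_,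
    fun x hx z hz => ?_⟩
  · exact hφ.eq_zero fun hm => lt_irrefl _ hm.2.2
  · refine hφ.eq_zero fun hm => ?_
    rw [hu.isOpen.frontier_eq] at hx
    exact hx.2 hm.1

lemma IsTestFunction.sliceInt_eq_zero (hu : Deflection H M D u γ) (hδ : 0 < δ)
    {φ : Rn n × ℝ → ℝ} (hφ : IsTestFunction (device H δ D u) φ) (x : Rn n) :
    sliceInt (device H δ D u) (fun p => fderiv ℝ φ p (0, 1)) x = 0 := by
  by_cases hx : x ∈ D
  · have hle : -H - δ ≤ u x := by linarith [hu.lower x hx]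
    have h1 : ContDiff ℝ 1 φ := hφ.1.of_le (by norm_cast)
    have hd : ∀ z ∈ uIcc (-H - δ) (u x), HasDerivAt (fun z => φ (x, z))
        (fderiv ℝ φ (x, z) (0, 1)) z := fun z _ =>
      ((h1.differentiable one_ne_zero) (x, z)).hasFDerivAt.comp_hasDerivAt z
        ((hasDerivAt_const z x).prodMk (hasDerivAt_id z))
    have hc : Continuous fun z : ℝ => fderiv ℝ φ (x, z) (0, 1) :=
      ((h1.continuous_fderiv one_ne_zero).comp (by fun_prop)).clm_apply continuous_const
    rw [sliceInt_eq_setIntegral (hu.isOpen_device δ).measurableSet, device_slice hx,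
      ← integral_Ioc_eq_integral_Ioo, ← intervalIntegral.integral_of_le hle,
      intervalIntegral.integral_eq_sub_of_hasDerivAt hd (hc.intervalIntegrable _ _)]
    rw [hφ.eq_zero fun hm => lt_irrefl _ hm.2.2, hφ.eq_zero fun hm => lt_irrefl _ hm.2.1, sub_zero]
  · exact MEMS.sliceInt_eq_zero fun z hz => hx hz.1

/-- For test functions this is the fundamental theorem of calculus with zero values at both ends of
the slice; slice integrals are continuous in `L²`. It encodes the boundary conditions at the top and
at the bottom of the device. -/
lemma sliceInt_device_eq_zero (hu : Deflection H M D u γ) (hδ : 0 < δ) (hδ1 : δ ≤ 1)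
    {f : Rn n × ℝ → ℝ} {g : Rn n × ℝ → Rn n × ℝ →L[ℝ] ℝ}
    (hf : H1ClosureWith (device H δ D u) {φ | IsTestFunction (device H δ D u) φ} f g) :
    sliceInt (device H δ D u) (fun p => g p (0, 1)) =ᵐ[volume] fun _ => 0 := by
  obtain ⟨hm, φ, hφ, ht⟩ := hf
  have := hu.isFiniteMeasure_device hδ1
  have hW := (hu.isOpen_device δ).measurableSet
  have t := tendsto_eLpNorm_sliceInt hW ENNReal.ofReal_ne_top
    (hu.volume_device_slice_le hδ1) (fun k => memLp_apply ((hφ k).memLp_fderiv) (0, 1))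
    (memLp_apply hm.2.2 (0, 1)) (tendsto_eLpNorm_vert ht.2)
  simp_rw [fun k x => (hφ k).sliceInt_eq_zero hu hδ x] at t
  exact eLpNorm_ae_eq_of_tendsto (f := fun _ _ => 0) (fun _ => aestronglyMeasurable_const)
    (aestronglyMeasurable_sliceInt hW (memLp_apply hm.2.2 (0, 1)).1) aestronglyMeasurable_const t
    (by simp)

lemma sliceInt_device (hu : Deflection H M D u γ) (hδ : 0 < δ) (hδ1 : δ ≤ 1)
    {F : Rn n × ℝ → ℝ} (hF : MemLp F 2 (volume.restrict (device H δ D u))) :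
    ∀ᵐ x, x ∈ D → sliceInt (device H δ D u) F x =
      sliceInt (layer H δ D) F x + sliceInt (freeSpace H D u) F x := by
  have := hu.isFiniteMeasure_device hδ1
  have hW := (hu.isOpen_device δ).measurableSet
  filter_upwards [ae_integrable_slice hW (hF.integrable (by norm_num))] with x hx hxD
  have h1 : (fun z => (device H δ D u).indicator F (x, z)) =
      (Ioo (-H - δ) (u x)).indicator fun z => F (x, z) := by
    rw [← device_slice hxD]; rfl
  rw [h1, integrable_indicator_iff measurableSet_Ioo] at hx
  have hl := hu.lower x hxD
  have hi : IntervalIntegrable (fun z => F (x, z)) volume (-H - δ) (u x) := by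
    rw [intervalIntegrable_iff_integrableOn_Ioo_of_le (by linarith)]
    exact hx
  rw [sliceInt_eq_setIntegral hW, sliceInt_eq_setIntegral hu.measurableSet_layer,
    sliceInt_eq_setIntegral hu.isOpen_freeSpace.measurableSet, device_slice hxD,
    layer_slice hxD, freeSpace_slice hxD, ← integral_Ioc_eq_integral_Ioo,
    ← integral_Ioc_eq_integral_Ioo, ← integral_Ioc_eq_integral_Ioo,
    ← intervalIntegral.integral_of_le (by linarith), ← intervalIntegral.integral_of_le
    (by linarith), ← intervalIntegral.integral_of_le hl]
  refine (intervalIntegral.integral_add_adjacent_intervals ?_ ?_).symm <;>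
  refine hi.mono_set ?_
  · rw [uIcc_of_le (by linarith), uIcc_of_le (by linarith)]
    exact Icc_subset_Icc_right hl
  · rw [uIcc_of_le hl, uIcc_of_le (by linarith)]
    exact Icc_subset_Icc_left (by linarith)

/-- The layer is mapped affinely onto `(-H-1, -H)`, so the increment of the data does not depend on
`δ`. Its upper value is expressed by `h` through the matching condition. -/
lemma sliceInt_dataGrad (hu : Deflection H M D u γ) (hd : BoundaryPair H D hb h) (hδ : 0 < δ)
    {x : Rn n} (hx : x ∈ D) :
    sliceInt (layer H δ D) (fun p => dataGrad H δ D u γ hb h p (0, 1)) x =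
      dataJump H u hb h x := by
  have hle : -H - δ ≤ -H := by linarith
  have hF' := hd.layer.mono (prod_mono (subset_closure (s := D)) le_rfl)
  have hmem : ∀ z ∈ Icc (-H - δ) (-H),
      ((x, layerMap H δ z, u x) : Rn n × ℝ × ℝ) ∈ layerDom H D :=
    fun z hz => ⟨hx, layerMap_mem hδ hz.1 hz.2, hu.lower x hx⟩
  have hc : Continuous fun z : ℝ => ((x, layerMap H δ z, u x) : Rn n × ℝ × ℝ) := by
    have := continuous_layerMap (H := H) (δ := δ)
    fun_prop
  have c1 : ContinuousOn (fun z => hb (x, layerMap H δ z, u x)) (Icc (-H - δ) (-H)) :=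
    hF'.continuousOn.comp hc.continuousOn hmem
  have c2 : ContinuousOn (fun z => pullGrad (layerDom H D) hb (layerMap H δ) (1 / δ) u γ (x, z)
      (0, 1)) (Icc (-H - δ) (-H)) := by
    have := (hF'.continuousOn_fderivWithin (hu.uniqueDiffOn uniqueDiffOn_layer) le_rfl).comp
      hc.continuousOn hmem
    refine (this.clm_apply (continuousOn_const (c := (0, 1 / δ, 0)))).congr fun z _ => ?_
    simp [pullGrad]
  have hder : ∀ z ∈ Ioo (-H - δ) (-H), HasDerivAt (fun z => hb (x, layerMap H δ z, u x))
      (pullGrad (layerDom H D) hb (layerMap H δ) (1 / δ) u γ (x, z) (0, 1)) z := fun z hz =>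
    hu.hasDerivAt_pull hd.layer hx (hasDerivAt_layerMap z) (by
      filter_upwards [Ioo_mem_nhds hz.1 hz.2] with t ht using layerMap_mem hδ ht.1.le ht.2.le)
  have key := intervalIntegral.integral_eq_sub_of_hasDerivAt_of_le hle c1 hder
    (c2.intervalIntegrable_of_Icc hle)
  rw [sliceInt_eq_setIntegral hu.measurableSet_layer, layer_slice hx]
  have e : ∫ z in Ioo (-H - δ) (-H), dataGrad H δ D u γ hb h (x, z) (0, 1) =
      ∫ z in Ioo (-H - δ) (-H),
        pullGrad (layerDom H D) hb (layerMap H δ) (1 / δ) u γ (x, z) (0, 1) := by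
    refine setIntegral_congr_fun measurableSet_Ioo fun z hz => ?_
    simp only [dataGrad, if_pos (show z < -H from hz.2)]
  rw [e, ← integral_Ioc_eq_integral_Ioo, ← intervalIntegral.integral_of_le hle, key,
    layerMap_bottom, hd.eq x hx (u x) (hu.lower x hx), dataJump]
  have : layerMap H δ (-H - δ) = -H - 1 := by
    rw [layerMap]
    field_simp
    ring
  rw [this]

end Comparison

end MEMS

/-! ### Restriction to `Ω(u)` and the lower bound for the energy -/

namespace MEMS

section LowerBound

variable {n : ℕ} {H M δ : ℝ} {D : Set (Rn n)} {u : Rn n → ℝ} {γ : Rn n → Rn n →L[ℝ] ℝ}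
  {σ : Rn n × ℝ → ℝ} {hb h : Rn n × ℝ × ℝ → ℝ}

/-- Restriction to `Ω(u)`, followed by extension by zero. -/
noncomputable def cut (hu : Deflection H M D u γ) (θ : L2M H M D) : L2M H M D :=
  ((Lp.memLp θ).indicator hu.isOpen_freeSpace.measurableSet).toLp

lemma cut_ae (hu : Deflection H M D u γ) (θ : L2M H M D) :
    cut hu θ =ᵐ[volume.restrict (container H M D)] (freeSpace H D u).indicator θ :=
  MemLp.coeFn_toLp _

lemma cut_ae_freeSpace (hu : Deflection H M D u γ) (θ : L2M H M D) :
    cut hu θ =ᵐ[volume.restrict (freeSpace H D u)] θ := by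
  filter_upwards [ae_mono (Measure.restrict_mono hu.freeSpace_subset le_rfl) (cut_ae hu θ),
    ae_restrict_mem hu.isOpen_freeSpace.measurableSet] with p h1 h2
  rw [h1, indicator_of_mem h2]

lemma cut_ae_off (hu : Deflection H M D u γ) (θ : L2M H M D) :
    ∀ᵐ p ∂(volume.restrict (container H M D \ freeSpace H D u)), cut hu θ p = 0 := by
  have hm : MeasurableSet (container H M D \ freeSpace H D u) :=
    (hu.isOpen.measurableSet.prod measurableSet_Ioo).diff hu.isOpen_freeSpace.measurableSet
  filter_upwards [ae_mono (Measure.restrict_mono sdiff_subset le_rfl) (cut_ae hu θ),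
    ae_restrict_mem hm] with p h1 h2
  rw [h1, indicator_of_notMem h2.2]

lemma dist_cut_le (hu : Deflection H M D u γ) (θ₁ θ₂ : L2M H M D) :
    dist (cut hu θ₁) (cut hu θ₂) ≤ dist θ₁ θ₂ := by
  rw [Lp.dist_def, Lp.dist_def]
  refine ENNReal.toReal_mono ?_ (eLpNorm_mono_ae ?_)
  · exact ((Lp.memLp θ₁).sub (Lp.memLp θ₂)).2.ne
  · filter_upwards [cut_ae hu θ₁, cut_ae hu θ₂] with p h1 h2
    rw [Pi.sub_apply, Pi.sub_apply, h1, h2]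
    by_cases hp : p ∈ freeSpace H D u
    · rw [indicator_of_mem hp, indicator_of_mem hp]
    · rw [indicator_of_notMem hp, indicator_of_notMem hp, sub_zero, norm_zero]
      exact norm_nonneg _

/-- One gradient serves both domains, because test functions of the device restrict to elements of
`C¹_B`. This links the trace in `Ω(u)` with the increment across the layer. -/
lemma InH10.exists_grad (hu : Deflection H M D u γ) (hδ : 0 ≤ δ) {θ : L2M H M D}
    (hθ : InH10 H M δ D u θ) : ∃ g,
      H1ClosureWith (device H δ D u) {φ | IsTestFunction (device H δ D u) φ} θ g ∧
      H1ClosureWith (freeSpace H D u) (C1B H D u) (cut hu θ) g := by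
  obtain ⟨⟨g, hm, φ, hφ, ht⟩, -⟩ := hθ
  refine ⟨g, ⟨hm, φ, hφ, ht⟩, H1ClosureWith.congr (f := θ) (g := g)
    ⟨hm.mono (freeSpace_subset_device hδ), φ, fun k => IsTestFunction.mem_C1B hu (hφ k),
      ht.mono (freeSpace_subset_device hδ)⟩ (cut_ae_freeSpace hu θ).symm (ae_eq_refl _)⟩

lemma InH10.energyDelta_eq (hu : Deflection H M D u γ) (hd : BoundaryPair H D hb h)
    (hδ : 0 < δ) (hδ1 : δ ≤ 1) {θ : L2M H M D} (hθ : InH10 H M δ D u θ)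
    {g : Rn n × ℝ → Rn n × ℝ →L[ℝ] ℝ} (hg : MemH1With (device H δ D u) θ g) :
    energyDelta H M δ D u σ hb h θ = 1 / 2 * ∫⁻ p in device H δ D u,
      ENNReal.ofReal (permittivity H δ σ p * gradSq (g p + dataGrad H δ D u γ hb h p)) := by
  rw [energyDelta, if_pos hθ]
  congr 1
  exact dirichletIntegral_eq (hu.isOpen_device δ)
    (hg.add (memH1With_boundaryData hu hd hδ hδ1)).2.1

/-- The integral of the vertical derivative across the layer. -/
lemma sliceInt_layer (hu : Deflection H M D u γ) (hd : BoundaryPair H D hb h)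
    (hδ : 0 < δ) (hδ1 : δ ≤ 1) {f : Rn n × ℝ → ℝ} {g : Rn n × ℝ → Rn n × ℝ →L[ℝ] ℝ}
    (hf : H1ClosureWith (device H δ D u) {φ | IsTestFunction (device H δ D u) φ} f g) :
    ∀ᵐ x, x ∈ D → sliceInt (layer H δ D)
      (fun p => g p (0, 1) + dataGrad H δ D u γ hb h p (0, 1)) x =
        bottomTrace H D u g x + dataJump H u hb h x := by
  have hfin := hu.isFiniteMeasure_device hδ1
  have hsub : (volume : Measure (Rn n × ℝ)).restrict (layer H δ D) ≤
    volume.restrict (device H δ D u) := Measure.restrict_mono hu.layer_subset le_rfl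
  have i1 := (memLp_apply hf.1.2.2 (0, 1)).integrable (by norm_num)
  have i2 := (memLp_apply (memLp_dataGrad hu hd hδ hδ1) (0, 1)).integrable (by norm_num)
  filter_upwards [sliceInt_device_eq_zero hu hδ hδ1 hf,
    sliceInt_device hu hδ hδ1 (memLp_apply hf.1.2.2 (0, 1)),
    sliceInt_linearComb hu.measurableSet_layer (i1.mono_measure hsub) (i2.mono_measure hsub) 1 1]
    with x h1 h2 h3 hx
  simp only [one_mul] at h3
  rw [h3, sliceInt_dataGrad hu hd hδ hx, bottomTrace]
  have := h2 hx
  rw [h1] at this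
  linarith

/-- Cauchy-Schwarz on each slice of length `δ`; the weight depends on `x` alone and may be placed
under the integral. With `w = σ(x,-H)` the right-hand side carries the product `δσ` of the layer's
permittivity. -/
lemma lintegral_layer_le (hu : Deflection H M D u γ)
    {F : Rn n × ℝ → ℝ} (hF : AEStronglyMeasurable F (volume.restrict (layer H δ D)))
    {w : Rn n → ℝ≥0∞} (hw : AEMeasurable w volume) :
    ∫⁻ x in D, w x * ‖sliceInt (layer H δ D) F x‖ₑ ^ 2 ≤
      ∫⁻ p in layer H δ D, w p.1 * (ENNReal.ofReal δ * ‖F p‖ₑ ^ 2) := by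
  have hm : AEMeasurable (fun p : Rn n × ℝ => w p.1) (volume.restrict (layer H δ D)) := by
    have : AEMeasurable (fun p : Rn n × ℝ => w p.1) volume := by
      rw [Measure.volume_eq_prod]
      exact hw.comp_quasiMeasurePreserving Measure.quasiMeasurePreserving_fst
    exact this.restrict
  rw [lintegral_eq_lintegral_slices
    (w := fun p => w p.1 * (ENNReal.ofReal δ * ‖F p‖ₑ ^ 2)) hu.measurableSet_layer
    (hm.mul ((hF.enorm.pow_const 2).const_mul _)), ← lintegral_indicator hu.isOpen.measurableSet]
  refine lintegral_mono fun x => ?_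
  by_cases hx : x ∈ D
  · rw [indicator_of_mem hx]
    have key := enorm_sliceInt_sq_le (F := F) (hu.measurableSet_layer (δ := δ)) x
    rw [layer_slice hx, Real.volume_Ioo] at key
    rw [layer_slice hx]
    calc w x * ‖sliceInt (layer H δ D) F x‖ₑ ^ 2
        ≤ w x * (ENNReal.ofReal δ * ∫⁻ z in Ioo (-H - δ) (-H), ‖F (x, z)‖ₑ ^ 2) := by
          refine mul_le_mul_right (key.trans (le_of_eq ?_)) _
          congr 2
          ring
      _ = w x * ∫⁻ z in Ioo (-H - δ) (-H), ENNReal.ofReal δ * ‖F (x, z)‖ₑ ^ 2 := by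
          rw [lintegral_const_mul' _ _ ENNReal.ofReal_ne_top]
      _ ≤ _ := lintegral_const_mul_le _ _
  · rw [indicator_of_notMem hx]
    exact zero_le

/-- The energy of the restriction to `Ω(u)` is controlled by the energy on `Ω_δ(u)`. -/
lemma energyLimit_cut_le (hu : Deflection H M D u γ) (hd : BoundaryPair H D hb h)
    (hσ : LayerPermittivity H D σ) (hδ : 0 < δ) (hδ1 : δ ≤ 1) {r : ℝ} (hr : 1 ≤ r)
    (hrσ : ∀ x ∈ D, ∀ z ∈ Ioo (-H - δ) (-H), σ (x, -H) ≤ r * σ (x, z)) (θ : L2M H M D) :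
    energyLimit H M D u σ hb h (cut hu θ) ≤
      ENNReal.ofReal r * energyDelta H M δ D u σ hb h θ := by
  by_cases hθ : InH10 H M δ D u θ
  swap
  · rw [energyDelta, if_neg hθ, ENNReal.mul_top (by simp; linarith)]
    exact le_top
  have hr0 : 0 ≤ r := zero_le_one.trans hr
  obtain ⟨g, hg, hgc⟩ := hθ.exists_grad hu hδ.le
  rw [energyLimit_eq hu hd (cut_ae_off hu θ) hgc, hθ.energyDelta_eq hu hd hδ hδ1 hg.1, gradEnergy,
    ← mul_add, mul_left_comm]
  refine mul_le_mul_right ?_ _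
  set E : Rn n × ℝ → ℝ≥0∞ := fun p => ENNReal.ofReal
    (permittivity H δ σ p * gradSq (g p + dataGrad H δ D u γ hb h p)) with hE
  have hdisj : Disjoint (freeSpace H D u) (layer H δ D) := by
    rw [disjoint_left]
    intro p hp hp'
    exact lt_irrefl _ (hp.2.1.trans hp'.2.2)
  have hsplit : (∫⁻ p in freeSpace H D u, E p) + ∫⁻ p in layer H δ D, E p ≤
      ∫⁻ p in device H δ D u, E p := by
    rw [← lintegral_union hu.measurableSet_layer hdisj]
    exact lintegral_mono_set (union_subset (freeSpace_subset_device hδ.le) hu.layer_subset)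
  refine le_trans ?_ (mul_le_mul_right hsplit _)
  rw [mul_add]
  refine add_le_add ?_ ?_
  · have e : ∫⁻ p in freeSpace H D u, ENNReal.ofReal (gradSq (g p + upperGrad H D u γ h p)) =
        ∫⁻ p in freeSpace H D u, E p := by
      refine setLIntegral_congr_fun hu.isOpen_freeSpace.measurableSet fun p hp => ?_
      simp only [hE, permittivity, dataGrad, if_neg hp.2.1.le.not_gt, one_mul]
    rw [e]
    refine le_mul_of_one_le_left zero_le ?_
    simpa using ENNReal.ofReal_le_ofReal hr
  · set F : Rn n × ℝ → ℝ := fun p => g p (0, 1) + dataGrad H δ D u γ hb h p (0, 1) with hF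
    have hFm : AEStronglyMeasurable F (volume.restrict (layer H δ D)) :=
      ((memLp_apply hg.1.2.2 (0, 1)).1.add
        (memLp_apply (memLp_dataGrad hu hd hδ hδ1) (0, 1)).1).mono_measure
        (Measure.restrict_mono hu.layer_subset le_rfl)
    set w : Rn n → ℝ≥0∞ := D.indicator fun x => ENNReal.ofReal (traceWeight H σ x ^ 2) with hw
    have hwm : AEMeasurable w volume := by
      refine (aemeasurable_indicator_iff hu.isOpen.measurableSet).2 ?_
      exact (((hσ.continuousOn_weight.mono subset_closure).aemeasurable
        hu.isOpen.measurableSet).pow_const 2).ennreal_ofReal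
    have e : ∫⁻ x in D, ENNReal.ofReal
        (σ (x, -H) * (bottomTrace H D u g x + dataJump H u hb h x) ^ 2) =
        ∫⁻ x in D, w x * ‖sliceInt (layer H δ D) F x‖ₑ ^ 2 := by
      refine lintegral_congr_ae ((ae_restrict_iff' hu.isOpen.measurableSet).2 ?_)
      filter_upwards [sliceInt_layer hu hd hδ hδ1 hg] with x hx hxD
      simp only [hw, hF]
      rw [indicator_of_mem hxD, hx hxD, hσ.weight_sq hxD, ← ofReal_norm,
        ← ENNReal.ofReal_pow (norm_nonneg _), Real.norm_eq_abs, sq_abs,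
        ← ENNReal.ofReal_mul (by rw [← hσ.weight_sq hxD]; positivity)]
    rw [e, ← lintegral_const_mul' _ _ ENNReal.ofReal_ne_top]
    refine (lintegral_layer_le hu hFm hwm).trans ?_
    refine setLIntegral_mono_ae' hu.measurableSet_layer (Eventually.of_forall fun p hp => ?_)
    have hs := hrσ p.1 hp.1 p.2 hp.2
    have hσ0 : 0 ≤ σ (p.1, -H) := by rw [← hσ.weight_sq hp.1]; positivity
    simp only [hw, hE, permittivity]
    rw [indicator_of_mem hp.1, if_pos hp.2.2, hσ.weight_sq hp.1, ← ofReal_norm,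
      ← ENNReal.ofReal_pow (norm_nonneg _), Real.norm_eq_abs, sq_abs,
      ← ENNReal.ofReal_mul hδ.le, ← ENNReal.ofReal_mul hσ0, ← ENNReal.ofReal_mul hr0]
    refine ENNReal.ofReal_le_ofReal ?_
    -- Horizontal derivatives in the layer are discarded; only the vertical one contributes to the
    -- limit.
    have h1 : F p ^ 2 ≤ gradSq (g p + dataGrad H δ D u γ hb h p) :=
      sq_le_gradSq (g p + dataGrad H δ D u γ hb h p)
    calc σ (p.1, -H) * (δ * F p ^ 2) ≤ (r * σ p) * (δ * F p ^ 2) :=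
          mul_le_mul_of_nonneg_right hs (by positivity)
      _ ≤ (r * σ p) * (δ * gradSq (g p + dataGrad H δ D u γ hb h p)) :=
          mul_le_mul_of_nonneg_left (mul_le_mul_of_nonneg_left h1 hδ.le) (hσ0.trans hs)
      _ = _ := by ring

end LowerBound

end MEMS

namespace MEMS

/-! ### The liminf inequality -/

section Liminf

variable {n : ℕ} {H M δ : ℝ} {D : Set (Rn n)} {u : Rn n → ℝ} {γ : Rn n → Rn n →L[ℝ] ℝ}
  {σ : Rn n × ℝ → ℝ} {hb h : Rn n × ℝ × ℝ → ℝ}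

/-- A positive continuous function on a compact set is uniformly continuous and bounded away from
zero, so its oscillation on short vertical segments is small relative to its size. One inequality
serves the liminf, the other the recovery family. -/
lemma LayerPermittivity.exists_ratio (hσ : LayerPermittivity H D σ) (hD : Bornology.IsBounded D)
    {r : ℝ} (hr : 1 < r) : ∃ δ₀ > 0, δ₀ ≤ 1 ∧ ∀ δ, δ ≤ δ₀ → ∀ x ∈ D, ∀ z ∈ Ioo (-H - δ) (-H),
      σ (x, -H) ≤ r * σ (x, z) ∧ σ (x, z) ≤ r * σ (x, -H) := by
  have hK : IsCompact (closure D ×ˢ Icc (-H - 1) (-H)) :=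
    hD.isCompact_closure.prod isCompact_Icc
  obtain ⟨B, hB⟩ := hK.exists_bound_of_continuousOn
    (hσ.cont.inv₀ fun p hp => (hσ.pos p hp).ne')
  have hB1 : 0 < max B 1 := lt_max_of_lt_right one_pos
  -- As `B` bounds `σ⁻¹`, this tolerance is at most `(r - 1)σ` at every point. The maximum with `1`
  -- guards against a nonpositive `B`.
  have hε : 0 < (r - 1) / max B 1 := div_pos (by linarith) hB1
  obtain ⟨d, hd, huc⟩ := Metric.uniformContinuousOn_iff.1
    (hK.uniformContinuousOn_of_continuous hσ.cont) _ hε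
  refine ⟨min d 1, lt_min hd one_pos, min_le_right _ _, fun δ hδ x hx z hz => ?_⟩
  have hx' := subset_closure hx
  have hzm : (x, z) ∈ closure D ×ˢ Icc (-H - 1) (-H) :=
    ⟨hx', by linarith [hz.1, hδ.trans (min_le_right _ _)], hz.2.le⟩
  have h1 := huc (x, -H) ⟨hx', by constructor <;> linarith⟩ (x, z) hzm (by
    rw [dist_prod_same_left, Real.dist_eq, abs_of_pos (by linarith [hz.2])]
    linarith [hz.1, hδ.trans (min_le_left _ _)])
  rw [Real.dist_eq] at h1
  have key : ∀ p ∈ closure D ×ˢ Icc (-H - 1) (-H), (r - 1) / max B 1 ≤ (r - 1) * σ p := by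
    intro p hpm
    have hp := hσ.pos _ hpm
    have h2 := hB _ hpm
    rw [Pi.inv_apply, norm_inv, Real.norm_of_nonneg hp.le] at h2
    rw [div_eq_mul_inv]
    exact mul_le_mul_of_nonneg_left (inv_le_of_inv_le₀ hp (h2.trans (le_max_left _ _)))
      (by linarith)
  have h2 := key _ hzm
  have h3 := key (x, -H) ⟨hx', by constructor <;> linarith⟩
  rw [abs_lt] at h1
  constructor <;> linarith

lemma volume_snd_eq (c : ℝ) : volume {p : Rn n × ℝ | p.2 = c} = 0 := by
  have : {p : Rn n × ℝ | p.2 = c} = univ ×ˢ {c} := by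
    ext p
    simp
  rw [this, Measure.volume_eq_prod, Measure.prod_prod, Real.volume_singleton, mul_zero]

/-- Limits of functions supported in shrinking layers above the plate live in `Ω(u)`. -/
lemma cut_eq_self (hu : Deflection H M D u γ) {y : ℝ → L2M H M D} {θ : L2M H M D}
    (hy : Tendsto y (𝓝[>] 0) (𝓝 θ)) (hf : ∃ᶠ δ in 𝓝[>] 0, InH10 H M δ D u (y δ)) :
    cut hu θ = θ := by
  have hm : ∀ δ, MeasurableSet (container H M D \ device H δ D u) := fun δ =>
    (hu.isOpen.measurableSet.prod measurableSet_Ioo).diff (hu.isOpen_device δ).measurableSet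
  -- For fixed `d`, the elements with `δ < d` vanish off the device of thickness `d`, and so does
  -- their `L²` limit; it suffices that such `δ` occur arbitrarily close to zero.
  have key : ∀ d > 0, ∀ᵐ p ∂(volume.restrict (container H M D)), p ∉ device H d D u → θ p = 0 := by
    intro d hd
    have hz : eLpNorm θ 2 (volume.restrict (container H M D \ device H d D u)) = 0 := by
      refine le_antisymm (le_of_forall_pos_le_add fun ε hε => ?_) zero_le
      rw [zero_add]
      have h1 : ∀ᶠ δ in 𝓝[>] 0, edist (y δ) θ < ε := hy (Metric.eball_mem_nhds θ hε)
      have h2 : ∀ᶠ δ in 𝓝[>] (0 : ℝ), δ < d := nhdsWithin_le_nhds (Iio_mem_nhds hd)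
      obtain ⟨δ, hδ, h1, h2⟩ := (hf.and_eventually (h1.and h2)).exists
      have hs : container H M D \ device H d D u ⊆ container H M D \ device H δ D u :=
        fun p hp => ⟨hp.1, fun hpd => hp.2 ⟨hpd.1, by linarith [hpd.2.1], hpd.2.2⟩⟩
      have e : eLpNorm θ 2 (volume.restrict (container H M D \ device H d D u)) =
          eLpNorm (y δ - θ : Rn n × ℝ → ℝ) 2
            (volume.restrict (container H M D \ device H d D u)) := by
        refine eLpNorm_congr_norm_ae ?_
        filter_upwards [ae_mono (Measure.restrict_mono hs le_rfl) hδ.2] with p hp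
        rw [Pi.sub_apply, hp, zero_sub, norm_neg]
      rw [e]
      refine (eLpNorm_mono_measure _ (Measure.restrict_mono sdiff_subset le_rfl)).trans ?_
      rw [← Lp.edist_def]
      exact h1.le
    have hae := (eLpNorm_eq_zero_iff ((Lp.memLp θ).1.mono_measure
      (Measure.restrict_mono sdiff_subset le_rfl)) two_ne_zero).1 hz
    have hC : MeasurableSet (container H M D) := hu.isOpen.measurableSet.prod measurableSet_Ioo
    rw [ae_restrict_iff' hC]
    filter_upwards [(ae_restrict_iff' (hm d)).1 hae] with p hp hpc hpd using hp ⟨hpc, hpd⟩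
  refine Lp.ext ((cut_ae hu θ).trans ?_)
  -- Countably many thicknesses exhaust the points below the plate, and the plate itself is a null
  -- set.
  have hall : ∀ᵐ p ∂(volume.restrict (container H M D)),
      ∀ k : ℕ, p ∉ device H (1 / ((k : ℝ) + 1)) D u → θ p = 0 :=
    ae_all_iff.2 fun k => key _ (by positivity)
  have hne : ∀ᵐ p ∂(volume.restrict (container H M D)), p.2 ≠ -H :=
    ae_restrict_of_ae (ae_iff.2 (by simpa using volume_snd_eq (n := n) (-H)))
  have hC : MeasurableSet (container H M D) := hu.isOpen.measurableSet.prod measurableSet_Ioo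
  filter_upwards [hall, hne, ae_restrict_mem hC] with p h1 h2 h3
  by_cases hp : p ∈ freeSpace H D u
  · rw [indicator_of_mem hp]
  · rw [indicator_of_notMem hp]
    rcases lt_or_gt_of_ne h2 with hz | hz
    · obtain ⟨k, hk⟩ := exists_nat_one_div_lt (show 0 < -H - p.2 by linarith)
      exact (h1 k fun hpd => by linarith [hpd.2.1]).symm
    · exact (h1 0 fun hpd => hp ⟨hpd.1, hz, hpd.2.2⟩).symm

/-- If the liminf is below `c`, energies below `c` occur for arbitrarily small `δ`. The
corresponding restrictions to `Ω(u)` approximate `θ`, because `cut` is a contraction that fixes `θ`,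
and their limit energies are at most `r c`. Lower semicontinuity and `r → 1` conclude. -/
lemma energyLimit_le_liminf (hu : Deflection H M D u γ) (hd : BoundaryPair H D hb h)
    (hσ : LayerPermittivity H D σ) {y : ℝ → L2M H M D} {θ : L2M H M D}
    (hy : Tendsto y (𝓝[>] 0) (𝓝 θ)) :
    energyLimit H M D u σ hb h θ ≤
      liminf (fun δ => energyDelta H M δ D u σ hb h (y δ)) (𝓝[>] 0) := by
  refine le_of_forall_gt_imp_ge_of_dense fun c hc => ?_
  rcases eq_or_ne c ⊤ with rfl | hct
  · exact le_top
  have hf : ∃ᶠ δ in 𝓝[>] (0 : ℝ), energyDelta H M δ D u σ hb h (y δ) < c :=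
    frequently_lt_of_liminf_lt (by isBoundedDefault) hc
  have hcut : cut hu θ = θ := cut_eq_self hu hy <| hf.mono fun δ hδ => by
    by_contra hn
    rw [energyDelta, if_neg hn] at hδ
    exact not_top_lt hδ
  have key : ∀ r : ℝ, 1 < r → energyLimit H M D u σ hb h θ ≤ ENNReal.ofReal r * c := by
    intro r hr
    refine energyLimit_le_of_approx hu hd hσ (ENNReal.mul_ne_top ENNReal.ofReal_ne_top hct)
      fun ρ hρ => ?_
    obtain ⟨δ₀, h0, h1, hrat⟩ := hσ.exists_ratio hu.isBounded hr
    have e1 : ∀ᶠ δ in 𝓝[>] (0 : ℝ), dist (y δ) θ < ρ := hy (Metric.ball_mem_nhds θ hρ)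
    have e2 : ∀ᶠ δ in 𝓝[>] (0 : ℝ), δ < δ₀ := nhdsWithin_le_nhds (Iio_mem_nhds h0)
    have e3 : ∀ᶠ δ in 𝓝[>] (0 : ℝ), 0 < δ := self_mem_nhdsWithin
    obtain ⟨δ, hδ, f1, f2, f3⟩ := (hf.and_eventually (e1.and (e2.and e3))).exists
    refine ⟨cut hu (y δ), ?_, ?_⟩
    · have := dist_cut_le hu (y δ) θ
      rw [hcut] at this
      exact this.trans f1.le
    · exact (energyLimit_cut_le hu hd hσ f3 (f2.le.trans h1) hr.le
        (fun x hx z hz => (hrat δ f2.le x hx z hz).1) (y δ)).trans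
        (mul_le_mul_right hδ.le _)
  have ht : Tendsto (fun r : ℝ => ENNReal.ofReal r * c) (𝓝[>] 1) (𝓝 (ENNReal.ofReal 1 * c)) :=
    ENNReal.Tendsto.mul_const
      ((ENNReal.continuous_ofReal.tendsto 1).mono_left nhdsWithin_le_nhds) (Or.inr hct)
  rw [ENNReal.ofReal_one, one_mul] at ht
  exact ge_of_tendsto ht (by filter_upwards [self_mem_nhdsWithin] with r hr using key r hr)

end Liminf

end MEMS

namespace MEMS

/-! ### Density of functions with compact support below the graph -/

section Density

variable {n : ℕ} {H M : ℝ} {D : Set (Rn n)} {u : Rn n → ℝ} {γ : Rn n → Rn n →L[ℝ] ℝ}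

lemma memLp_const_zero {α E : Type*} [MeasurableSpace α] [NormedAddCommGroup E] (μ : Measure α) :
    MemLp (fun _ : α => (0 : E)) 2 μ := MemLp.zero'

/-- The chain rule `WeakFormula.comp` applied to the zero function and `F(x, w) = φ(x)`. -/
lemma weakFormula_of_contDiffOn {X : Type*} [NormedAddCommGroup X] [NormedSpace ℝ X]
    [MeasureSpace X] [BorelSpace X] [FiniteDimensional ℝ X] [(volume : Measure X).IsAddHaarMeasure]
    {Ω : Set X} (hΩ : IsOpen Ω) {φ : X → ℝ} (hφ : ContDiffOn ℝ 1 φ Ω) :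
    WeakFormula Ω φ (fderiv ℝ φ) := by
  have h0 : MemH1With Ω (fun _ => (0 : ℝ)) fun _ => (0 : X →L[ℝ] ℝ) :=
    MemH1With.of_weakFormula (memLp_const_zero _) (memLp_const_zero _) fun ψ _ v => by simp
  have hF : ContDiffOn ℝ 1 (fun q : X × ℝ => φ q.1) (Ω ×ˢ Ici 0) :=
    hφ.comp contDiffOn_fst fun q hq => hq.1
  refine (WeakFormula.comp hΩ h0 continuousOn_const (fun _ _ => le_rfl) hF).congr
    (ae_eq_refl _) ?_
  refine (ae_restrict_iff' hΩ.measurableSet).2 (Eventually.of_forall fun x hx => ?_)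
  have h1 : HasFDerivAt (fun q : X × ℝ => φ q.1)
      ((fderiv ℝ φ x).comp (ContinuousLinearMap.fst ℝ X ℝ)) (x, 0) :=
    (((hφ.contDiffAt (hΩ.mem_nhds hx)).differentiableAt one_ne_zero).hasFDerivAt).comp (x, (0 : ℝ))
      hasFDerivAt_fst
  have e := h1.hasFDerivWithinAt.fderivWithin
    ((hΩ.uniqueDiffOn.prod (uniqueDiffOn_Ici 0)) (x, 0) ⟨hx, self_mem_Ici⟩)
  refine (congrArg (fun L => L.comp ((ContinuousLinearMap.id ℝ X).prod 0)) e).trans ?_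
  ext v
  simp

/-- The region below the graph of `u`. -/
def subgraph (D : Set (Rn n)) (u : Rn n → ℝ) : Set (Rn n × ℝ) := {p | p.1 ∈ D ∧ p.2 < u p.1}

lemma Deflection.isOpen_subgraph (hu : Deflection H M D u γ) : IsOpen (subgraph D u) := by
  have h2 : ContinuousOn (fun p : Rn n × ℝ => u p.1 - p.2) (D ×ˢ univ) :=
    (hu.contD.comp continuousOn_fst fun p hp => hp.1).sub continuousOn_snd
  convert h2.isOpen_inter_preimage (hu.isOpen.prod isOpen_univ) isOpen_Ioi (t := Ioi 0) using 1
  ext p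
  simp [subgraph]

/-- Reflection of the lower half-space at the bottom plate. -/
def fold (H : ℝ) (p : Rn n × ℝ) : Rn n × ℝ := (p.1, -H + |p.2 + H|)

lemma continuous_fold : Continuous (fold (n := n) H) := by
  unfold fold
  fun_prop

/-- The union of `Ω(u)`, its reflection at the bottom plate, and the part of the plate between
them. -/
def double (H : ℝ) (D : Set (Rn n)) (u : Rn n → ℝ) : Set (Rn n × ℝ) :=
  fold H ⁻¹' subgraph D u

lemma Deflection.isOpen_double (hu : Deflection H M D u γ) : IsOpen (double H D u) :=
  hu.isOpen_subgraph.preimage continuous_fold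

lemma fold_mem_freeSpace {p : Rn n × ℝ} (hp : p ∈ double H D u) (hz : p.2 ≠ -H) :
    fold H p ∈ freeSpace H D u := by
  refine ⟨hp.1, ?_, hp.2⟩
  have : 0 < |p.2 + H| := abs_pos.2 fun h => hz (by linarith)
  simp only [fold]
  linarith

lemma freeSpace_subset_double : freeSpace H D u ⊆ double H D u := by
  intro p hp
  refine ⟨hp.1, ?_⟩
  have h1 := hp.2.1
  simp only [fold]
  rw [abs_of_pos (by linarith)]
  linarith [hp.2.2]

lemma double_subset_subgraph : double H D u ⊆ subgraph D u := by
  intro p hp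
  refine ⟨hp.1, ?_⟩
  have h1 := hp.2
  simp only [fold] at h1
  linarith [le_abs_self (p.2 + H)]

lemma Deflection.isBounded_double (hu : Deflection H M D u γ) :
    Bornology.IsBounded (double H D u) := by
  refine (hu.isBounded.prod (Metric.isBounded_Icc (-H - (M + H)) (-H + (M + H)))).subset ?_
  intro p hp
  have h1 := hp.2
  have h2 := hu.le_M hp.1
  simp only [fold] at h1 h2
  refine ⟨hp.1, ?_⟩
  have h3 : |p.2 + H| ≤ M + H := by linarith
  rw [abs_le] at h3
  exact ⟨by linarith, by linarith⟩

lemma Deflection.mem_closure_of_mem_closure (hu : Deflection H M D u γ) {x : Rn n}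
    (hx : x ∈ closure D) {t : ℝ} (ht : t ∈ Ioo (-H) (u x)) :
    (x, t) ∈ closure (freeSpace H D u) := by
  have : (𝓝[D] x).NeBot := mem_closure_iff_nhdsWithin_neBot.1 hx
  have h1 : Tendsto (fun y : Rn n => (y, t)) (𝓝[D] x) (𝓝 (x, t)) :=
    (Continuous.tendsto (by fun_prop) x).mono_left nhdsWithin_le_nhds
  refine mem_closure_of_tendsto h1 ?_
  have h2 : ∀ᶠ y in 𝓝[D] x, t < u y :=
    ((hu.cont x hx).mono subset_closure).tendsto.eventually (lt_mem_nhds ht.2)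
  filter_upwards [h2, self_mem_nhdsWithin] with y hy hyD using ⟨hyD, ht.1, hy⟩

lemma Deflection.mem_closure_of_Icc (hu : Deflection H M D u γ) {x : Rn n}
    (hx : x ∈ closure D) (hxu : -H < u x) {t : ℝ} (ht : t ∈ Icc (-H) (u x)) :
    (x, t) ∈ closure (freeSpace H D u) := by
  rw [← closure_Ioo hxu.ne] at ht
  have hc : Continuous fun z : ℝ => (x, z) := by fun_prop
  have hm : MapsTo (fun z : ℝ => (x, z)) (Ioo (-H) (u x)) (closure (freeSpace H D u)) :=
    fun t ht => hu.mem_closure_of_mem_closure hx ht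
  simpa using hm.closure hc ht

/-- Continuity adds the edge `z = -H` to the lateral condition. Since `u = 0 > -H` on `∂D`, the
whole segment lies in the closure of `Ω(u)`, where `φ` is continuous. -/
lemma C1B.eq_zero_frontier (hu : Deflection H M D u γ) {φ : Rn n × ℝ → ℝ} (hφ : φ ∈ C1B H D u)
    {x : Rn n} (hx : x ∈ frontier D) {t : ℝ} (ht : t ∈ Icc (-H) 0) : φ (x, t) = 0 := by
  have hx0 := hu.bdry x hx
  have hxc := frontier_subset_closure hx
  have hH := hu.pos
  have hc : ContinuousOn (fun t : ℝ => φ (x, t)) (Icc (-H) 0) :=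
    hφ.1.2.1.comp (by fun_prop) fun t ht =>
      hu.mem_closure_of_Icc hxc (by rw [hx0]; linarith) (by rwa [hx0])
  have h0 : EqOn (fun t : ℝ => φ (x, t)) (fun _ => 0) (Ioo (-H) 0) :=
    fun t ht => hφ.2.2 x hx t ⟨ht.1, ht.2.le⟩
  exact h0.of_subset_closure hc continuousOn_const Ioo_subset_Icc_self
    (by rw [closure_Ioo (by linarith)]) ht

lemma Deflection.closure_double (hu : Deflection H M D u γ) {p : Rn n × ℝ}
    (hp : p ∈ closure (double H D u)) : p.1 ∈ closure D ∧ -H + |p.2 + H| ≤ u p.1 := by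
  have hc : IsClosed {p : Rn n × ℝ | p.1 ∈ closure D ∧ -H + |p.2 + H| ≤ u p.1} := by
    have h1 : ContinuousOn (fun p : Rn n × ℝ => u p.1 - (-H + |p.2 + H|)) (closure D ×ˢ univ) :=
      (hu.cont.comp continuousOn_fst fun p hp => hp.1).sub (by fun_prop)
    convert h1.preimage_isClosed_of_isClosed (isClosed_closure.prod isClosed_univ)
      (isClosed_Ici (a := (0 : ℝ))) using 1
    ext p
    simp
  have hsub : double H D u ⊆ {p : Rn n × ℝ | p.1 ∈ closure D ∧ -H + |p.2 + H| ≤ u p.1} :=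
    fun q hq => ⟨subset_closure hq.1, le_of_lt hq.2⟩
  exact closure_minimal hsub hc hp

/-- A boundary point of the doubled domain folds to the graph of `u` or to the lateral boundary,
where `φ` vanishes; coincidence points belong to the graph. Extension by zero is therefore
continuous. -/
lemma C1B.continuous_double (hu : Deflection H M D u γ) {φ : Rn n × ℝ → ℝ} (hφ : φ ∈ C1B H D u) :
    Continuous ((double H D u).indicator (φ ∘ fold H)) := by
  have hH := hu.pos
  have hz : ∀ p ∈ closure (double H D u), p ∉ double H D u → φ (fold H p) = 0 := by
    intro p hp hp'
    obtain ⟨h1, h2⟩ := hu.closure_double hp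
    by_cases hx : p.1 ∈ D
    · have : -H + |p.2 + H| = u p.1 := le_antisymm h2 (not_lt.1 fun h => hp' ⟨hx, h⟩)
      simp only [fold]
      rw [this]
      exact hφ.2.1 _ hx
    · have hf : p.1 ∈ frontier D := ⟨h1, fun h => hx (interior_subset h)⟩
      rw [hu.bdry _ hf] at h2
      exact C1B.eq_zero_frontier hu hφ hf ⟨by linarith [abs_nonneg (p.2 + H)], h2⟩
  have hmaps : MapsTo (fold H) (double H D u) (closure (freeSpace H D u)) := by
    intro p hp
    have h1 := hp.2
    simp only [fold] at h1
    exact hu.mem_closure_of_Icc (subset_closure hp.1)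
      (show -H < u p.1 by linarith [abs_nonneg (p.2 + H)]) ⟨by linarith [abs_nonneg (p.2 + H)], h1.le⟩
  have hc : ContinuousOn (φ ∘ fold H) (closure (double H D u)) := by
    have := (hmaps.closure continuous_fold)
    rw [closure_closure] at this
    exact hφ.1.2.1.comp continuous_fold.continuousOn this
  have h1 : ContinuousOn ((double H D u).indicator (φ ∘ fold H)) (closure (double H D u)) := by
    refine hc.congr fun p hp => ?_
    by_cases hm : p ∈ double H D u
    · rw [indicator_of_mem hm]
    · rw [indicator_of_notMem hm, Function.comp_apply, hz p hp hm]
  have h2 : ContinuousOn ((double H D u).indicator (φ ∘ fold H)) (double H D u)ᶜ :=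
    (continuousOn_const (c := (0 : ℝ))).congr fun p hp => indicator_of_notMem hp _
  have := h1.union_of_isClosed h2 isClosed_closure hu.isOpen_double.isClosed_compl
  rw [← continuousOn_univ]
  refine this.mono fun p _ => ?_
  by_cases hp : p ∈ double H D u
  · exact Or.inl (subset_closure hp)
  · exact Or.inr hp

/-- The derivative of the reflection of `φ`. -/
noncomputable def foldGrad (H : ℝ) (φ : Rn n × ℝ → ℝ) (p : Rn n × ℝ) : Rn n × ℝ →L[ℝ] ℝ :=
  if p.2 < -H then (fderiv ℝ φ (fold H p)).comp
    ((ContinuousLinearMap.fst ℝ (Rn n) ℝ).prod (-ContinuousLinearMap.snd ℝ (Rn n) ℝ))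
  else fderiv ℝ φ p

lemma fold_of_lt {p : Rn n × ℝ} (h : p.2 < -H) : fold H p = (p.1, -2 * H - p.2) := by
  rw [fold, abs_of_neg (by linarith)]
  congr 1
  ring

lemma fold_of_le {p : Rn n × ℝ} (h : -H ≤ p.2) : fold H p = p := by
  rw [fold, abs_of_nonneg (by linarith)]
  ext <;> simp

lemma norm_foldMap_le : ‖(ContinuousLinearMap.fst ℝ (Rn n) ℝ).prod
    (-ContinuousLinearMap.snd ℝ (Rn n) ℝ)‖ ≤ 1 := by
  refine ContinuousLinearMap.opNorm_le_bound _ zero_le_one fun v => ?_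
  rw [one_mul]
  refine norm_prod_le_iff.2 ⟨norm_fst_le v, ?_⟩
  simpa using norm_snd_le v

lemma C1B.memLp_foldGrad (hu : Deflection H M D u γ) {φ : Rn n × ℝ → ℝ} (hφ : φ ∈ C1B H D u) :
    MemLp (foldGrad H φ) 2 (volume.restrict (double H D u)) := by
  have hfin : IsFiniteMeasure ((volume : Measure (Rn n × ℝ)).restrict (double H D u)) :=
    isFiniteMeasure_restrict_of_isBounded hu.isBounded_double
  obtain ⟨h1, h2, Φ, h3, h4⟩ := hφ.1
  obtain ⟨B, hB⟩ := hu.isBounded_freeSpace.isCompact_closure.exists_bound_of_continuousOn h3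
  have hΩ := hu.isOpen_freeSpace
  have hcf : ContinuousOn (fderiv ℝ φ) (freeSpace H D u) :=
    h1.continuousOn_fderiv_of_isOpen hΩ le_rfl
  have hne : ∀ᵐ p ∂(volume.restrict (double H D u)), p.2 ≠ -H :=
    ae_restrict_of_ae (ae_iff.2 (by simpa using volume_snd_eq (n := n) (-H)))
  have hs : MeasurableSet {p : Rn n × ℝ | p.2 < -H} :=
    measurableSet_lt measurable_snd measurable_const
  have hm : AEStronglyMeasurable (foldGrad H φ) (volume.restrict (double H D u)) := by
    refine AEStronglyMeasurable.piecewise (s := {p : Rn n × ℝ | p.2 < -H}) hs ?_ ?_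
    · rw [Measure.restrict_restrict hs]
      have c : ContinuousOn (fun p => (fderiv ℝ φ (fold H p)).comp
          ((ContinuousLinearMap.fst ℝ (Rn n) ℝ).prod (-ContinuousLinearMap.snd ℝ (Rn n) ℝ)))
          ({p : Rn n × ℝ | p.2 < -H} ∩ double H D u) :=
        (hcf.comp continuous_fold.continuousOn fun p hp =>
          fold_mem_freeSpace hp.2 (ne_of_lt hp.1)).clm_comp continuousOn_const
      exact c.aestronglyMeasurable (hs.inter hu.isOpen_double.measurableSet)
    · rw [Measure.restrict_restrict hs.compl]
      have m1 := hcf.aestronglyMeasurable (μ := volume) hΩ.measurableSet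
      refine m1.mono_ac ?_
      have hsub : ({p : Rn n × ℝ | p.2 < -H}ᶜ ∩ double H D u : Set (Rn n × ℝ)) ≤ᵐ[volume]
          freeSpace H D u := by
        have hne' : ∀ᵐ p : Rn n × ℝ, p.2 ≠ -H :=
          ae_iff.2 (by simpa using volume_snd_eq (n := n) (-H))
        filter_upwards [hne'] with p hp hpm
        have := fold_mem_freeSpace hpm.2 hp
        rwa [fold_of_le (not_lt.1 hpm.1)] at this
      exact (Measure.restrict_mono_ae hsub).absolutelyContinuous
  refine MemLp.of_bound hm B ?_
  filter_upwards [hne, ae_restrict_mem hu.isOpen_double.measurableSet] with p hp hpm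
  have hf := fold_mem_freeSpace hpm hp
  have hb := hB _ (subset_closure hf)
  rw [h4 _ hf] at hb
  by_cases hz : p.2 < -H
  · simp only [foldGrad, if_pos hz]
    refine (ContinuousLinearMap.opNorm_comp_le _ _).trans ?_
    exact (mul_le_of_le_one_right (norm_nonneg _) norm_foldMap_le).trans hb
  · simp only [foldGrad, if_neg hz]
    rwa [fold_of_le (not_lt.1 hz)] at hb

/-- Reflection keeps continuity and creates a kink only at `z = -H`, the exceptional height in
`weakFormula_of_slices`. Every other horizontal slice is a slice of `Ω(u)` at the folded height,
where `φ` is `C¹`. -/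
lemma C1B.memH1With_double (hu : Deflection H M D u γ) {φ : Rn n × ℝ → ℝ} (hφ : φ ∈ C1B H D u) :
    MemH1With (double H D u) ((double H D u).indicator (φ ∘ fold H)) (foldGrad H φ) := by
  have hfin : IsFiniteMeasure ((volume : Measure (Rn n × ℝ)).restrict (double H D u)) :=
    isFiniteMeasure_restrict_of_isBounded hu.isBounded_double
  have hc := C1B.continuous_double hu hφ
  have hW := hu.isOpen_double
  have hΩ := hu.isOpen_freeSpace
  have hG := C1B.memLp_foldGrad hu hφ
  obtain ⟨B, hB⟩ := hu.isBounded_double.isCompact_closure.exists_bound_of_continuousOn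
    hc.continuousOn
  have hf : MemLp ((double H D u).indicator (φ ∘ fold H)) 2 (volume.restrict (double H D u)) :=
    MemLp.of_bound hc.aestronglyMeasurable B ((ae_restrict_iff' hW.measurableSet).2
      (Eventually.of_forall fun p hp => hB p (subset_closure hp)))
  have hd : ∀ p ∈ freeSpace H D u, HasFDerivAt φ (fderiv ℝ φ p) p := fun p hp =>
    ((hφ.1.1.contDiffAt (hΩ.mem_nhds hp)).differentiableAt one_ne_zero).hasFDerivAt
  refine MemH1With.of_weakFormula hf hG (weakFormula_of_slices hW hc.continuousOn
    (hG.integrable (by norm_num)) (countable_singleton (-H)) ?_ ?_)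
  · intro p hp hpz
    have hfp := fold_mem_freeSpace hp hpz
    have hev : ∀ᶠ t in 𝓝 p.2, (p.1, t) ∈ double H D u :=
      (Continuous.tendsto (by fun_prop : Continuous fun t : ℝ => (p.1, t)) p.2).eventually
        (hW.mem_nhds hp)
    rcases lt_or_gt_of_ne (show p.2 ≠ -H from hpz) with hz | hz
    · have e1 : HasDerivAt (fun t : ℝ => (p.1, -2 * H - t)) (0, -1) p.2 :=
        (hasDerivAt_const p.2 p.1).prodMk ((hasDerivAt_id p.2).const_sub (-2 * H))
      have e2 := hd _ hfp
      rw [fold_of_lt hz] at e2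
      have e3 := e2.comp_hasDerivAt p.2 e1
      simp only [foldGrad, if_pos hz, fold_of_lt hz]
      have e4 : ((fderiv ℝ φ (p.1, -2 * H - p.2)).comp ((ContinuousLinearMap.fst ℝ (Rn n) ℝ).prod
          (-ContinuousLinearMap.snd ℝ (Rn n) ℝ))) (0, 1) =
          fderiv ℝ φ (p.1, -2 * H - p.2) (0, -1) := by simp
      rw [e4]
      refine e3.congr_of_eventuallyEq ?_
      filter_upwards [hev, Iio_mem_nhds hz] with t ht htz
      rw [indicator_of_mem ht, Function.comp_apply, Function.comp_apply,
        fold_of_lt (show (p.1, t).2 < -H from htz)]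
    · have e1 : HasDerivAt (fun t : ℝ => (p.1, t)) (0, 1) p.2 :=
        (hasDerivAt_const p.2 p.1).prodMk (hasDerivAt_id p.2)
      have e2 := hd _ hfp
      rw [fold_of_le hz.le] at e2
      have e3 := e2.comp_hasDerivAt p.2 e1
      simp only [foldGrad, if_neg hz.not_gt]
      refine e3.congr_of_eventuallyEq ?_
      filter_upwards [hev, Ioi_mem_nhds hz] with t ht htz
      rw [indicator_of_mem ht, Function.comp_apply, Function.comp_apply,
        fold_of_le (show -H ≤ (p.1, t).2 from le_of_lt htz)]
  · intro z hz
    have hz' : z ≠ -H := hz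
    set ζ := -H + |z + H| with hζ
    have hsl : {x | (x, z) ∈ double H D u} = {x | (x, ζ) ∈ freeSpace H D u} := by
      have : 0 < |z + H| := abs_pos.2 fun h => hz' (by linarith)
      ext x
      constructor
      · exact fun hx => fold_mem_freeSpace hx hz'
      · exact fun hx => ⟨hx.1, hx.2.2⟩
    have hci : Continuous fun x : Rn n => (x, ζ) := by fun_prop
    have hop : IsOpen {x | (x, ζ) ∈ freeSpace H D u} := hΩ.preimage hci
    have hsm : ContDiffOn ℝ 1 (fun x => φ (x, ζ)) {x | (x, ζ) ∈ freeSpace H D u} :=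
      hφ.1.1.comp (contDiff_id.prodMk contDiff_const).contDiffOn fun x hx => hx
    rw [hsl]
    refine (weakFormula_of_contDiffOn hop hsm).congr ?_ ?_ <;>
    refine (ae_restrict_iff' hop.measurableSet).2 (Eventually.of_forall fun x hx => ?_)
    · have : (x, z) ∈ double H D u := by
        have hx' : x ∈ {x | (x, z) ∈ double H D u} := by rw [hsl]; exact hx
        exact hx'
      exact (indicator_of_mem this (φ ∘ fold H)).symm
    · have e1 : HasFDerivAt (fun x : Rn n => (x, ζ)) (ContinuousLinearMap.inl ℝ (Rn n) ℝ) x :=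
        (hasFDerivAt_id x).prodMk (hasFDerivAt_const ζ x)
      have e2 := ((hd _ hx).comp x e1).fderiv
      refine e2.trans ?_
      by_cases hzl : z < -H
      · simp only [foldGrad, if_pos hzl]
        ext v
        simp [fold, hζ]
      · simp only [foldGrad, if_neg hzl]
        have : ζ = z := by rw [hζ, abs_of_nonneg (by linarith [not_lt.1 hzl])]; ring
        rw [this]

/-- Functions in `C¹_B` are limits of smooth functions with compact support below the graph. -/
lemma C1B.h1ClosureWith_subgraph (hu : Deflection H M D u γ) {φ : Rn n × ℝ → ℝ}
    (hφ : φ ∈ C1B H D u) : H1ClosureWith (freeSpace H D u)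
      {ψ | IsTestFunction (subgraph D u) ψ} φ (fderiv ℝ φ) := by
  have hm := C1B.memH1With_double hu hφ
  obtain ⟨g, hg, ψ, hψ, ht⟩ := hm.memH10_of_continuous hu.isOpen_double hu.isBounded_double
    (C1B.continuous_double hu hφ) fun p hp => indicator_of_notMem hp _
  have hgg := hg.ae_eq hu.isOpen_double hm
  have hΩ := hu.isOpen_freeSpace
  refine H1ClosureWith.congr (f := (double H D u).indicator (φ ∘ fold H)) (g := foldGrad H φ)
    ⟨hm.mono freeSpace_subset_double, ψ, fun k => (hψ k).mono double_subset_subgraph,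
    (ht.congr (ae_eq_refl _) hgg).mono freeSpace_subset_double⟩ ?_ ?_ <;>
  refine (ae_restrict_iff' hΩ.measurableSet).2 (Eventually.of_forall fun p hp => ?_)
  · rw [indicator_of_mem (freeSpace_subset_double hp), Function.comp_apply,
      fold_of_le hp.2.1.le]
  · simp only [foldGrad, if_neg hp.2.1.le.not_gt]

/-- It suffices to recover smooth functions which vanish near the graph of `u` and near the lateral
boundary but are free at the plate. -/
lemma H1ClosureWith.subgraph (hu : Deflection H M D u γ) {f : Rn n × ℝ → ℝ}
    {g : Rn n × ℝ → Rn n × ℝ →L[ℝ] ℝ} (h : H1ClosureWith (freeSpace H D u) (C1B H D u) f g) :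
    H1ClosureWith (freeSpace H D u) {ψ | IsTestFunction (subgraph D u) ψ} f g := by
  obtain ⟨hm, φ, hφ, ht⟩ := h
  exact H1ClosureWith.of_tendsto hu.isOpen_freeSpace
    (fun ψ hψ => (hψ.1.of_le (by simp)).contDiffOn)
    (fun k => C1B.h1ClosureWith_subgraph hu (hφ k)) hm.1 hm.2.2 ht.1 ht.2

end Density

end MEMS

namespace MEMS

/-! ### Recovery families -/

section Recovery

variable {n : ℕ} {H M δ : ℝ} {D : Set (Rn n)} {u : Rn n → ℝ} {γ : Rn n → Rn n →L[ℝ] ℝ}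
  {σ : Rn n × ℝ → ℝ} {hb h : Rn n × ℝ × ℝ → ℝ} {χ : Rn n → ℝ} {ψ : Rn n × ℝ → ℝ}

/-- The profile of the recovery family in the layer: where `χ = 1`, it is affine in the vertical
variable. -/
def recLayer (H : ℝ) (hb h : Rn n × ℝ × ℝ → ℝ) (χ : Rn n → ℝ) (ψ : Rn n × ℝ → ℝ)
    (q : Rn n × ℝ × ℝ) : ℝ :=
  χ q.1 * ((-H - q.2.1) * hb (q.1, -H - 1, q.2.2) + (q.2.1 + H + 1) * h (q.1, -H, q.2.2)) +
    (1 - χ q.1) * hb q + (q.2.1 + H + 1) * ψ (q.1, -H)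

/-- The profile of the recovery family above the layer. -/
def recUpper (h : Rn n × ℝ × ℝ → ℝ) (ψ : Rn n × ℝ → ℝ) (q : Rn n × ℝ × ℝ) : ℝ :=
  h q + ψ (q.1, q.2.1)

/-- The total potential of the recovery family has the same structure as the boundary data, so weak
differentiability and the derivative bounds need no new proof. The recovery family is a difference
of two such data. -/
lemma boundaryPair_rec (hd : BoundaryPair H D hb h) (hχ : ContDiff ℝ 1 χ) (hψ : ContDiff ℝ 1 ψ) :
    BoundaryPair H D (recLayer H hb h χ ψ) (recUpper h ψ) := by
  have c1 : ContDiff ℝ 1 fun q : Rn n × ℝ × ℝ => χ q.1 := hχ.comp contDiff_fst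
  have c2 : ContDiff ℝ 1 fun q : Rn n × ℝ × ℝ => q.2.1 := contDiff_fst.comp contDiff_snd
  have c3 : ContDiff ℝ 1 fun q : Rn n × ℝ × ℝ => q.2.2 := contDiff_snd.comp contDiff_snd
  have c4 : ∀ c : ℝ, ContDiff ℝ 1 fun q : Rn n × ℝ × ℝ => (q.1, c, q.2.2) := fun c =>
    contDiff_fst.prodMk (contDiff_const.prodMk c3)
  have c5 : ContDiff ℝ 1 fun q : Rn n × ℝ × ℝ => ψ (q.1, -H) :=
    hψ.comp (contDiff_fst.prodMk contDiff_const)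
  have c6 : ContDiff ℝ 1 fun q : Rn n × ℝ × ℝ => ψ (q.1, q.2.1) :=
    hψ.comp (contDiff_fst.prodMk c2)
  have d1 : ContDiffOn ℝ 1 (fun q : Rn n × ℝ × ℝ => hb (q.1, -H - 1, q.2.2))
      (layerDom H (closure D)) :=
    hd.layer.comp (c4 (-H - 1)).contDiffOn fun q hq =>
      ⟨hq.1, ⟨le_rfl, by linarith⟩, hq.2.2⟩
  have d2 : ContDiffOn ℝ 1 (fun q : Rn n × ℝ × ℝ => h (q.1, -H, q.2.2))
      (layerDom H (closure D)) :=
    hd.upper.comp (c4 (-H)).contDiffOn fun q hq => ⟨hq.1, self_mem_Ici, hq.2.2⟩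
  have e1 : ContDiff ℝ 1 fun q : Rn n × ℝ × ℝ => -H - q.2.1 := contDiff_const.sub c2
  have e2 : ContDiff ℝ 1 fun q : Rn n × ℝ × ℝ => q.2.1 + H + 1 :=
    (c2.add contDiff_const).add contDiff_const
  have e3 : ContDiff ℝ 1 fun q : Rn n × ℝ × ℝ => 1 - χ q.1 := contDiff_const.sub c1
  refine ⟨?_, hd.upper.add c6.contDiffOn, fun x hx w hw => ?_⟩
  · exact ((c1.contDiffOn.mul ((e1.contDiffOn.mul d1).add (e2.contDiffOn.mul d2))).add
      (e3.contDiffOn.mul hd.layer)).add (e2.mul c5).contDiffOn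
  · simp only [recLayer, recUpper, hd.eq x hx w hw]
    ring

/-- The recovery family. -/
noncomputable def recFun (H δ : ℝ) (D : Set (Rn n)) (u : Rn n → ℝ) (hb h : Rn n × ℝ × ℝ → ℝ)
    (χ : Rn n → ℝ) (ψ : Rn n × ℝ → ℝ) : Rn n × ℝ → ℝ :=
  (device H δ D u).indicator fun p =>
    boundaryData H δ u (recLayer H hb h χ ψ) (recUpper h ψ) p - boundaryData H δ u hb h p

lemma continuous_cutoff_mul (hD : IsOpen D) (hχ : IsTestFunction D χ) {b : Rn n × ℝ → ℝ}
    (hb : ContinuousOn b (D ×ˢ univ)) : Continuous fun p : Rn n × ℝ => χ p.1 * b p := by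
  rw [continuous_iff_continuousAt]
  intro p
  by_cases hp : p.1 ∈ D
  · exact (hχ.1.continuous.comp continuous_fst).continuousAt.mul
      (hb.continuousAt ((hD.prod isOpen_univ).mem_nhds ⟨hp, mem_univ _⟩))
  · have h1 : ∀ᶠ q : Rn n × ℝ in 𝓝 p, q.1 ∉ tsupport χ :=
      continuous_fst.continuousAt.eventually
        ((isClosed_tsupport χ).isOpen_compl.mem_nhds fun h => hp (hχ.2.2 h))
    refine (continuousAt_const (y := (0 : ℝ))).congr ?_
    filter_upwards [h1] with q hq
    rw [image_eq_zero_of_notMem_tsupport hq, zero_mul]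

/-- The layer variable, extended constantly. -/
noncomputable def clampMap (H δ : ℝ) (z : ℝ) : ℝ := max (-H - 1) (min (layerMap H δ z) (-H))

lemma continuous_clampMap : Continuous (clampMap H δ) :=
  continuous_const.max (continuous_layerMap.min continuous_const)

lemma clampMap_mem (z : ℝ) : clampMap H δ z ∈ Icc (-H - 1) (-H) :=
  ⟨le_max_left _ _, max_le (by linarith) (min_le_right _ _)⟩

lemma clampMap_of_mem (hδ : 0 < δ) {z : ℝ} (h1 : -H - δ ≤ z) (h2 : z ≤ -H) :
    clampMap H δ z = layerMap H δ z := by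
  have := layerMap_mem hδ h1 h2
  rw [clampMap, min_eq_left this.2, max_eq_right this.1]

lemma clampMap_of_ge (hδ : 0 < δ) {z : ℝ} (hz : -H ≤ z) : clampMap H δ z = -H := by
  have : 0 ≤ (z + H) / δ := div_nonneg (by linarith) hδ.le
  rw [clampMap, layerMap, min_eq_right (by linarith), max_eq_right (by linarith)]

lemma clampMap_of_le (hδ : 0 < δ) {z : ℝ} (hz : z ≤ -H - δ) : clampMap H δ z = -H - 1 := by
  have : (z + H) / δ ≤ -1 := by
    rw [div_le_iff₀ hδ]
    linarith
  rw [clampMap, layerMap, min_eq_left (by linarith), max_eq_left (by linarith)]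

/-- The deviation of `h_b` from the affine interpolation across the layer. -/
def layerDefect (H : ℝ) (hb h : Rn n × ℝ × ℝ → ℝ) (q : Rn n × ℝ × ℝ) : ℝ :=
  (-H - q.2.1) * hb (q.1, -H - 1, q.2.2) + (q.2.1 + H + 1) * h (q.1, -H, q.2.2) - hb q

/-- The defect `layerDefect` vanishes at both ends of the layer, and the factor of `ψ` runs from `0`
at the bottom to `1` at the plate. With the clamped variable one formula holds on the whole space;
it shows continuity and a bound that does not depend on `δ`. -/
lemma recFun_eq (hu : Deflection H M D u γ) (hd : BoundaryPair H D hb h) (hδ : 0 < δ)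
    (hχ : IsTestFunction D χ) (hψ : IsTestFunction (subgraph D u) ψ) :
    recFun H δ D u hb h χ ψ = fun p => χ p.1 * layerDefect H hb h (p.1, clampMap H δ p.2, u p.1) +
      (clampMap H δ p.2 + H + 1) * ψ (p.1, max p.2 (-H)) := by
  ext p
  by_cases hx : p.1 ∈ D
  swap
  · have e1 : ψ (p.1, max p.2 (-H)) = 0 := hψ.eq_zero fun h => hx h.1
    rw [recFun, indicator_of_notMem fun h => hx h.1, hχ.eq_zero hx, e1]
    ring
  have hm := hd.eq p.1 hx (u p.1) (hu.lower _ hx)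
  rcases le_or_gt (-H) p.2 with hz | hz
  · rw [clampMap_of_ge hδ hz, max_eq_left hz]
    by_cases hpu : p.2 < u p.1
    · have : p ∈ device H δ D u := ⟨hx, by linarith, hpu⟩
      rw [recFun, indicator_of_mem this]
      simp only [boundaryData, if_neg hz.not_gt, recUpper, layerDefect, hm]
      ring
    · have e1 : ψ (p.1, p.2) = 0 := hψ.eq_zero fun h => hpu h.2
      rw [recFun, indicator_of_notMem fun h => hpu h.2.2, e1]
      simp only [layerDefect, hm]
      ring
  · rw [max_eq_right hz.le]
    rcases le_or_gt p.2 (-H - δ) with hz2 | hz2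
    · rw [clampMap_of_le hδ hz2, recFun, indicator_of_notMem fun h => absurd h.2.1 hz2.not_gt]
      simp only [layerDefect]
      ring
    · have : p ∈ device H δ D u := ⟨hx, hz2, hz.trans_le (hu.lower _ hx)⟩
      rw [clampMap_of_mem hδ hz2.le hz.le, recFun, indicator_of_mem this]
      simp only [boundaryData, if_pos hz, recLayer, layerDefect, layerMap]
      ring

lemma continuousOn_layerDefect (hd : BoundaryPair H D hb h) :
    ContinuousOn (layerDefect H hb h) (layerDom H (closure D)) := by
  have c4 : ∀ c : ℝ, Continuous fun q : Rn n × ℝ × ℝ => (q.1, c, q.2.2) := fun c => by fun_prop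
  have d1 : ContinuousOn (fun q : Rn n × ℝ × ℝ => hb (q.1, -H - 1, q.2.2))
      (layerDom H (closure D)) :=
    hd.layer.continuousOn.comp (c4 (-H - 1)).continuousOn fun q hq =>
      ⟨hq.1, ⟨le_rfl, by linarith⟩, hq.2.2⟩
  have d2 : ContinuousOn (fun q : Rn n × ℝ × ℝ => h (q.1, -H, q.2.2))
      (layerDom H (closure D)) :=
    hd.upper.continuousOn.comp (c4 (-H)).continuousOn fun q hq => ⟨hq.1, self_mem_Ici, hq.2.2⟩
  exact (((by fun_prop : Continuous fun q : Rn n × ℝ × ℝ => -H - q.2.1).continuousOn.mul d1).add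
    ((by fun_prop : Continuous fun q : Rn n × ℝ × ℝ => q.2.1 + H + 1).continuousOn.mul d2)).sub
    hd.layer.continuousOn

lemma continuous_recFun (hu : Deflection H M D u γ) (hd : BoundaryPair H D hb h) (hδ : 0 < δ)
    (hχ : IsTestFunction D χ) (hψ : IsTestFunction (subgraph D u) ψ) :
    Continuous (recFun H δ D u hb h χ ψ) := by
  rw [recFun_eq hu hd hδ hχ hψ]
  have hcl := continuous_clampMap (H := H) (δ := δ)
  have hψc := hψ.1.continuous
  refine (continuous_cutoff_mul hu.isOpen hχ ?_).add (by fun_prop)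
  exact hu.continuousOn_pull (J := univ)
    ((continuousOn_layerDefect hd).mono (prod_mono subset_closure le_rfl)) hcl
    fun z _ => clampMap_mem z

lemma exists_bound_recFun (hu : Deflection H M D u γ) (hd : BoundaryPair H D hb h)
    (hχ : IsTestFunction D χ) (hψ : IsTestFunction (subgraph D u) ψ) :
    ∃ B, ∀ δ > 0, ∀ p, |recFun H δ D u hb h χ ψ p| ≤ B := by
  obtain ⟨B₁, h₁⟩ := hχ.2.1.exists_bound_of_continuous hχ.1.continuous
  obtain ⟨B₂, h₂⟩ := hψ.2.1.exists_bound_of_continuous hψ.1.continuous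
  obtain ⟨B₃, h₃⟩ := hu.exists_bound_pull (continuousOn_layerDefect hd) isCompact_Icc
  have hB₁ : 0 ≤ B₁ := (norm_nonneg _).trans (h₁ 0)
  have hB₂ : 0 ≤ B₂ := (norm_nonneg _).trans (h₂ 0)
  refine ⟨B₁ * |B₃| + B₂, fun δ hδ p => ?_⟩
  rw [recFun_eq hu hd hδ hχ hψ]
  refine (abs_add_le _ _).trans (add_le_add ?_ ?_)
  · rw [abs_mul]
    by_cases hx : p.1 ∈ D
    · exact mul_le_mul (h₁ _) ((h₃ (p.1, clampMap H δ p.2) ⟨hx, clampMap_mem _⟩).trans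
        (le_abs_self _)) (abs_nonneg _) hB₁
    · rw [hχ.eq_zero hx, abs_zero, zero_mul]
      positivity
  · rw [abs_mul]
    have hm := clampMap_mem (H := H) (δ := δ) p.2
    have : |clampMap H δ p.2 + H + 1| ≤ 1 := by
      rw [abs_le]
      constructor <;> linarith [hm.1, hm.2]
    calc _ ≤ 1 * B₂ := mul_le_mul this (h₂ _) (abs_nonneg _) zero_le_one
      _ = B₂ := one_mul _

lemma memLp_recFun (hu : Deflection H M D u γ) (hd : BoundaryPair H D hb h) (hδ : 0 < δ)
    (hχ : IsTestFunction D χ) (hψ : IsTestFunction (subgraph D u) ψ) :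
    MemLp (recFun H δ D u hb h χ ψ) 2 (volume.restrict (container H M D)) := by
  have := isFiniteMeasure_restrict_of_isBounded hu.isBounded_container
  obtain ⟨B, hB⟩ := exists_bound_recFun hu hd hχ hψ
  exact MemLp.of_bound (continuous_recFun hu hd hδ hχ hψ).aestronglyMeasurable B
    (Eventually.of_forall (hB δ hδ))

/-- Continuity on the whole space together with vanishing off the device replaces a discussion of
boundary traces. Near the lateral boundary this rests on the compact supports of `χ` and `ψ`. -/
lemma memH10_recFun (hu : Deflection H M D u γ) (hd : BoundaryPair H D hb h) (hδ : 0 < δ)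
    (hδ1 : δ ≤ 1) (hχ : IsTestFunction D χ) (hψ : IsTestFunction (subgraph D u) ψ) :
    MemH10 (device H δ D u) (recFun H δ D u hb h χ ψ) := by
  have hd' := boundaryPair_rec hd (hχ.1.of_le (by simp)) (hψ.1.of_le (by simp))
  have h1 := (memH1With_boundaryData hu hd' hδ hδ1).sub (memH1With_boundaryData hu hd hδ hδ1)
  refine (h1.congr (f' := recFun H δ D u hb h χ ψ) ?_ (ae_eq_refl _)).memH10_of_continuous
    (hu.isOpen_device δ) (hu.isBounded_container.subset (hu.device_subset hδ1))
    (continuous_recFun hu hd hδ hχ hψ) fun p hp => indicator_of_notMem hp _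
  refine (ae_restrict_iff' (hu.isOpen_device δ).measurableSet).2 (Eventually.of_forall ?_)
  intro p hp
  simp only [recFun]
  rw [indicator_of_mem hp]

/-- The recovery family as elements of `L₂(Ω_M)`. -/
noncomputable def recL2 (hu : Deflection H M D u γ) (hd : BoundaryPair H D hb h) (hδ : 0 < δ)
    (hχ : IsTestFunction D χ) (hψ : IsTestFunction (subgraph D u) ψ) : L2M H M D :=
  (memLp_recFun hu hd hδ hχ hψ).toLp

lemma recL2_ae (hu : Deflection H M D u γ) (hd : BoundaryPair H D hb h) (hδ : 0 < δ)
    (hχ : IsTestFunction D χ) (hψ : IsTestFunction (subgraph D u) ψ) :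
    recL2 hu hd hδ hχ hψ =ᵐ[volume.restrict (container H M D)] recFun H δ D u hb h χ ψ :=
  MemLp.coeFn_toLp _

lemma inH10_recL2 (hu : Deflection H M D u γ) (hd : BoundaryPair H D hb h) (hδ : 0 < δ)
    (hδ1 : δ ≤ 1) (hχ : IsTestFunction D χ) (hψ : IsTestFunction (subgraph D u) ψ) :
    InH10 H M δ D u (recL2 hu hd hδ hχ hψ) := by
  have e := recL2_ae hu hd hδ hχ hψ
  obtain ⟨g, hg⟩ := memH1Closure_iff.1 (memH10_recFun hu hd hδ hδ1 hχ hψ)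
  refine ⟨⟨g, H1ClosureWith.congr hg
    (EventuallyEq.symm (ae_mono (Measure.restrict_mono (hu.device_subset hδ1) le_rfl) e))
    (ae_eq_refl _)⟩, ?_⟩
  have hm : MeasurableSet (container H M D \ device H δ D u) :=
    (hu.isOpen.measurableSet.prod measurableSet_Ioo).diff (hu.isOpen_device δ).measurableSet
  filter_upwards [ae_mono (Measure.restrict_mono sdiff_subset le_rfl) e, ae_restrict_mem hm]
    with p h1 h2
  rw [h1, recFun, indicator_of_notMem h2.2]

lemma energyDelta_recL2 (hu : Deflection H M D u γ) (hd : BoundaryPair H D hb h) (hδ : 0 < δ)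
    (hδ1 : δ ≤ 1) (hχ : IsTestFunction D χ) (hψ : IsTestFunction (subgraph D u) ψ) :
    energyDelta H M δ D u σ hb h (recL2 hu hd hδ hχ hψ) = 1 / 2 * ∫⁻ p in device H δ D u,
      ENNReal.ofReal (permittivity H δ σ p *
        gradSq (dataGrad H δ D u γ (recLayer H hb h χ ψ) (recUpper h ψ) p)) := by
  have hd' := boundaryPair_rec hd (hχ.1.of_le (by simp)) (hψ.1.of_le (by simp))
  rw [energyDelta, if_pos (inH10_recL2 hu hd hδ hδ1 hχ hψ)]
  congr 1
  refine dirichletIntegral_eq (hu.isOpen_device δ)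
    ((memH1With_boundaryData hu hd' hδ hδ1).congr ?_ (ae_eq_refl _)).2.1
  filter_upwards [ae_mono (Measure.restrict_mono (hu.device_subset hδ1) le_rfl)
    (recL2_ae hu hd hδ hχ hψ), ae_restrict_mem (hu.isOpen_device δ).measurableSet] with p h1 h2
  rw [h1, recFun, indicator_of_mem h2, sub_add_cancel]

end Recovery

end MEMS

namespace MEMS

/-! ### The energy of the recovery family -/

section RecoveryEnergy

variable {n : ℕ} {H M δ : ℝ} {D : Set (Rn n)} {u : Rn n → ℝ} {γ : Rn n → Rn n →L[ℝ] ℝ}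
  {σ : Rn n × ℝ → ℝ} {hb h : Rn n × ℝ × ℝ → ℝ} {χ : Rn n → ℝ} {ψ : Rn n × ℝ → ℝ}

/-- Both sides are the vertical derivative of the same profile, and derivatives in one variable are
unique. -/
lemma dataGrad_vert_rec (hu : Deflection H M D u γ) (hd : BoundaryPair H D hb h) (hδ : 0 < δ)
    (hχ : IsTestFunction D χ) (hψ : IsTestFunction (subgraph D u) ψ) {p : Rn n × ℝ}
    (hp : p ∈ layer H δ D) :
    dataGrad H δ D u γ (recLayer H hb h χ ψ) (recUpper h ψ) p (0, 1) =
      1 / δ * (χ p.1 * dataJump H u hb h p.1 + ψ (p.1, -H)) +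
        (1 - χ p.1) * dataGrad H δ D u γ hb h p (0, 1) := by
  have hd' := boundaryPair_rec hd (hχ.1.of_le (by simp)) (hψ.1.of_le (by simp))
  have h1 := hasDerivAt_boundaryData hu hd' hδ hp.1 hp.2.1 hp.2.2.ne
  have h2 := hasDerivAt_boundaryData hu hd hδ hp.1 hp.2.1 hp.2.2.ne
  have hL := hasDerivAt_layerMap (H := H) (δ := δ) p.2
  refine h1.unique ?_
  have h3 := ((((hL.const_sub (-H)).mul_const (hb (p.1, -H - 1, u p.1))).add
    (((hL.add_const H).add_const 1).mul_const (h (p.1, -H, u p.1)))).const_mul (χ p.1)).add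
    (h2.const_mul (1 - χ p.1)) |>.add (((hL.add_const H).add_const 1).mul_const (ψ (p.1, -H)))
  have h4 := h3.congr_of_eventuallyEq (f₁ := fun t =>
    boundaryData H δ u (recLayer H hb h χ ψ) (recUpper h ψ) (p.1, t)) (by
      filter_upwards [Iio_mem_nhds hp.2.2] with t ht
      have ht' : t < -H := ht
      simp only [boundaryData, if_pos ht', recLayer, layerMap, Pi.add_apply])
  convert h4 using 1
  rw [dataJump]
  ring

lemma abs_dataGrad_vert_le (hδ : 0 < δ) {B : ℝ}
    (hB : ∀ x ∈ D, ∀ t ∈ Icc (-H - 1) (-H), ‖fderivWithin ℝ hb (layerDom H D) (x, t, u x)‖ ≤ B)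
    {p : Rn n × ℝ} (hp : p ∈ layer H δ D) :
    |dataGrad H δ D u γ hb h p (0, 1)| ≤ 1 / δ * B := by
  simp only [dataGrad, if_pos hp.2.2, pullGrad, ContinuousLinearMap.comp_apply, liftMap_apply,
    map_zero, mul_one]
  have h1 := (fderivWithin ℝ hb (layerDom H D) (p.1, layerMap H δ p.2, u p.1)).le_opNorm
    (0, 1 / δ, 0)
  have h2 : ‖((0, 1 / δ, 0) : Rn n × ℝ × ℝ)‖ = 1 / δ := by
    simp [Prod.norm_def, abs_of_pos hδ, hδ.le]
  rw [h2, Real.norm_eq_abs] at h1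
  refine h1.trans ?_
  rw [mul_comm]
  exact mul_le_mul_of_nonneg_left (hB _ hp.1 _ (layerMap_mem hδ hp.2.1.le hp.2.2.le))
    (one_div_pos.2 hδ).le

/-- The layer map stretches only the vertical direction, so no factor `1/δ` appears. This makes the
horizontal energy of the layer of order `δ²`. -/
lemma abs_dataGrad_horiz_le {B : ℝ} (hδ : 0 < δ)
    (hB : ∀ x ∈ D, ∀ t ∈ Icc (-H - 1) (-H), ‖fderivWithin ℝ hb (layerDom H D) (x, t, u x)‖ ≤ B)
    {p : Rn n × ℝ} (hp : p ∈ layer H δ D) (i : Fin n) :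
    |dataGrad H δ D u γ hb h p (EuclideanSpace.single i 1, 0)| ≤ B * (1 + ‖γ p.1‖) := by
  simp only [dataGrad, if_pos hp.2.2, pullGrad, ContinuousLinearMap.comp_apply, liftMap_apply,
    mul_zero]
  have hB' := hB _ hp.1 _ (layerMap_mem hδ hp.2.1.le hp.2.2.le)
  refine (((fderivWithin ℝ hb (layerDom H D) (p.1, layerMap H δ p.2, u p.1)).le_opNorm
    _).trans (mul_le_mul hB' ?_ (norm_nonneg _) ((norm_nonneg _).trans hB')))
  have h1 := (γ p.1).le_opNorm (EuclideanSpace.single i 1)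
  have h2 : ‖(EuclideanSpace.single i 1 : Rn n)‖ = 1 := by simp
  rw [h2, mul_one] at h1
  refine norm_prod_le_iff.2 ⟨?_, norm_prod_le_iff.2 ⟨?_, ?_⟩⟩
  · simp only [h2]
    linarith [norm_nonneg (γ p.1)]
  · simp only [norm_zero]
    positivity
  · simp only
    linarith

lemma mem_C1B_of_subgraph (hu : Deflection H M D u γ) (hψ : IsTestFunction (subgraph D u) ψ) :
    ψ ∈ C1B H D u := by
  have h1 : ContDiff ℝ 1 ψ := hψ.1.of_le (by simp)
  refine ⟨⟨h1.contDiffOn, h1.continuous.continuousOn, fderiv ℝ ψ,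
    (h1.continuous_fderiv one_ne_zero).continuousOn, fun _ _ => rfl⟩, fun x hx => ?_,
    fun x hx z hz => ?_⟩
  · exact hψ.eq_zero fun hm => lt_irrefl _ hm.2
  · refine hψ.eq_zero fun hm => ?_
    rw [hu.isOpen.frontier_eq] at hx
    exact hx.2 hm.1

lemma bottomTrace_of_subgraph (hu : Deflection H M D u γ) (hψ : IsTestFunction (subgraph D u) ψ)
    {x : Rn n} (hx : x ∈ D) : bottomTrace H D u (fderiv ℝ ψ) x = ψ (x, -H) := by
  rcases (hu.lower x hx).lt_or_eq with hlt | heq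
  · exact bottomTrace_of_C1B (mem_C1B_of_subgraph hu hψ) hu.isOpen_freeSpace hx hlt
  · have h0 : ψ (x, -H) = 0 := hψ.eq_zero fun hm => by
      have h2 : -H < u x := hm.2
      exact h2.ne heq
    rw [h0, bottomTrace, sliceInt_eq_zero, neg_zero]
    intro z hz
    exact lt_irrefl _ ((hz.2.1.trans hz.2.2).trans_eq heq.symm)

/-- Pointwise bound of the energy density in the layer. -/
lemma density_layer_le (hu : Deflection H M D u γ) (hd : BoundaryPair H D hb h) (hδ : 0 < δ)
    (hχ : IsTestFunction D χ) (hχ1 : ∀ x, χ x ∈ Icc (0 : ℝ) 1)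
    (hψ : IsTestFunction (subgraph D u) ψ) {B B' J₀ S r : ℝ} (hr : 0 ≤ r)
    (hB : ∀ x ∈ D, ∀ t ∈ Icc (-H - 1) (-H), ‖fderivWithin ℝ hb (layerDom H D) (x, t, u x)‖ ≤ B)
    (hB' : ∀ x ∈ D, ∀ t ∈ Icc (-H - 1) (-H),
      ‖fderivWithin ℝ (recLayer H hb h χ ψ) (layerDom H D) (x, t, u x)‖ ≤ B')
    (hJ₀ : ∀ x ∈ D, |dataJump H u hb h x| + |ψ (x, -H)| ≤ J₀) {p : Rn n × ℝ}
    (hp : p ∈ layer H δ D) (hσ0 : 0 ≤ σ p) (hS : σ p ≤ S)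
    (hrσ : σ p ≤ r * σ (p.1, -H)) (hσ0' : 0 ≤ σ (p.1, -H)) :
    δ * σ p * gradSq (dataGrad H δ D u γ (recLayer H hb h χ ψ) (recUpper h ψ) p) ≤
      δ * (S * (n * (B' * (1 + ‖γ p.1‖)) ^ 2)) +
        1 / δ * (r * (σ (p.1, -H) * (dataJump H u hb h p.1 + ψ (p.1, -H)) ^ 2) +
          {x | χ x ≠ 1}.indicator (fun _ => S * (J₀ + B) ^ 2) p.1) := by
  rw [gradSq, mul_add]
  have hS0 : 0 ≤ S := hσ0.trans hS
  refine add_le_add ?_ ?_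
  · rw [mul_assoc]
    refine mul_le_mul_of_nonneg_left ?_ hδ.le
    have h1 : ∑ i : Fin n, (dataGrad H δ D u γ (recLayer H hb h χ ψ) (recUpper h ψ) p
        (EuclideanSpace.single i 1, 0)) ^ 2 ≤ n * (B' * (1 + ‖γ p.1‖)) ^ 2 := by
      refine (Finset.sum_le_card_nsmul _ _ ((B' * (1 + ‖γ p.1‖)) ^ 2) fun i _ => ?_).trans
        (by simp)
      rw [← sq_abs]
      exact pow_le_pow_left₀ (abs_nonneg _) (abs_dataGrad_horiz_le hδ hB' hp i) 2
    exact mul_le_mul hS h1 (Finset.sum_nonneg fun i _ => sq_nonneg _) hS0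
  · rw [dataGrad_vert_rec hu hd hδ hχ hψ hp]
    have hm := abs_dataGrad_vert_le (u := u) (γ := γ) (h := h) hδ hB hp
    set m := dataGrad H δ D u γ hb h p (0, 1) with hmdef
    set j := dataJump H u hb h p.1
    set q := ψ (p.1, -H)
    -- The vertical derivative is of order `1/δ`, and `δ` times its square leaves `1/δ`, which
    -- integration over the layer cancels. The remainder `δ m` stays bounded by `B`.
    have e : δ * σ p * (1 / δ * (χ p.1 * j + q) + (1 - χ p.1) * m) ^ 2 =
        1 / δ * (σ p * (χ p.1 * j + q + (1 - χ p.1) * (δ * m)) ^ 2) := by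
      field_simp
    rw [e]
    refine mul_le_mul_of_nonneg_left ?_ (one_div_pos.2 hδ).le
    have hJ := hJ₀ p.1 hp.1
    have hm' : |δ * m| ≤ B := by
      rw [abs_mul, abs_of_pos hδ]
      calc δ * |m| ≤ δ * (1 / δ * B) := mul_le_mul_of_nonneg_left hm hδ.le
        _ = B := by field_simp
    -- Where `χ = 1` the profile is affine and gives exactly the Robin density; elsewhere a crude
    -- bound suffices, since that set is chosen small.
    by_cases hc : χ p.1 = 1
    · rw [indicator_of_notMem (show p.1 ∉ {x | χ x ≠ 1} from fun hne => hne hc), hc]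
      have : σ p * (1 * j + q + (1 - 1) * (δ * m)) ^ 2 = σ p * (j + q) ^ 2 := by ring
      rw [this, add_zero, ← mul_assoc]
      exact mul_le_mul_of_nonneg_right hrσ (sq_nonneg _)
    · rw [indicator_of_mem (show p.1 ∈ {x | χ x ≠ 1} from hc)]
      have h0 := hχ1 p.1
      have hab : |χ p.1 * j + q + (1 - χ p.1) * (δ * m)| ≤ J₀ + B := by
        have a1 : |χ p.1 * j| ≤ |j| := by
          rw [abs_mul, abs_of_nonneg h0.1]
          exact mul_le_of_le_one_left (abs_nonneg _) h0.2
        have a2 : |(1 - χ p.1) * (δ * m)| ≤ |δ * m| := by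
          rw [abs_mul, abs_of_nonneg (by linarith [h0.2] : 0 ≤ 1 - χ p.1)]
          exact mul_le_of_le_one_left (abs_nonneg _) (by linarith [h0.1])
        refine (abs_add_le _ _).trans ?_
        have := abs_add_le (χ p.1 * j) q
        linarith
      have h2 : σ p * (χ p.1 * j + q + (1 - χ p.1) * (δ * m)) ^ 2 ≤ S * (J₀ + B) ^ 2 := by
        refine mul_le_mul hS ?_ (sq_nonneg _) hS0
        rw [← sq_abs]
        exact pow_le_pow_left₀ (abs_nonneg _) hab 2
      have h3 : 0 ≤ r * (σ (p.1, -H) * (j + q) ^ 2) := by positivity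
      linarith

lemma lintegral_layer {w : Rn n → ℝ≥0∞}
    (hw : AEMeasurable w (volume.restrict D)) :
    ∫⁻ p in layer H δ D, w p.1 = ENNReal.ofReal δ * ∫⁻ x in D, w x := by
  have h : AEMeasurable (fun p : Rn n × ℝ => w p.1)
      ((volume.restrict D).prod (volume.restrict (Ioo (-H - δ) (-H)))) :=
    hw.comp_quasiMeasurePreserving Measure.quasiMeasurePreserving_fst
  rw [layer, Measure.volume_eq_prod, ← Measure.prod_restrict, lintegral_prod _ h]
  simp only [lintegral_const, Measure.restrict_apply_univ, Real.volume_Ioo]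
  rw [lintegral_mul_const'' _ hw, mul_comm]
  congr 2
  ring

end RecoveryEnergy

end MEMS

/-! ### The energy of the recovery family is almost the limit energy -/

namespace MEMS

section RecoveryLimsup

variable {n : ℕ} {H M δ : ℝ} {D : Set (Rn n)} {u : Rn n → ℝ} {γ : Rn n → Rn n →L[ℝ] ℝ}
  {σ : Rn n × ℝ → ℝ} {hb h : Rn n × ℝ × ℝ → ℝ} {χ : Rn n → ℝ} {ψ : Rn n × ℝ → ℝ}

lemma memH1With_of_subgraph (hu : Deflection H M D u γ) (hψ : IsTestFunction (subgraph D u) ψ) :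
    MemH1With (freeSpace H D u) ψ (fderiv ℝ ψ) :=
  have h1 : ContDiff ℝ 1 ψ := hψ.1.of_le (by simp)
  MemH1With.of_weakFormula hψ.memLp hψ.memLp_fderiv
    (weakFormula_of_contDiffOn hu.isOpen_freeSpace h1.contDiffOn)

/-- The recovery family has the energy density of the limit in `Ω(u)`. -/
lemma lintegral_freeSpace_rec (hu : Deflection H M D u γ) (hd : BoundaryPair H D hb h)
    (hχ : IsTestFunction D χ) (hψ : IsTestFunction (subgraph D u) ψ) :
    ∫⁻ p in freeSpace H D u, ENNReal.ofReal (permittivity H δ σ p *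
      gradSq (dataGrad H δ D u γ (recLayer H hb h χ ψ) (recUpper h ψ) p)) =
    ∫⁻ p in freeSpace H D u, ENNReal.ofReal (gradSq (fderiv ℝ ψ p + upperGrad H D u γ h p)) := by
  have hd' := boundaryPair_rec hd (hχ.1.of_le (by simp)) (hψ.1.of_le (by simp))
  have h1 := MemH1With.add_upperData hu hd (memH1With_of_subgraph hu hψ)
  have h2 := (memH1With_upperData hu hd').congr (Eventually.of_forall fun p => add_comm _ _)
    (ae_eq_refl _)
  have e := h2.ae_eq hu.isOpen_freeSpace h1
  refine lintegral_congr_ae ?_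
  filter_upwards [e, ae_restrict_mem hu.isOpen_freeSpace.measurableSet] with p hp hpΩ
  have hz : ¬ p.2 < -H := hpΩ.2.1.le.not_gt
  rw [permittivity, if_neg hz, one_mul, dataGrad, if_neg hz, hp]

/-- Upper bound for the energy of the recovery family. -/
lemma energyDelta_recL2_le (hu : Deflection H M D u γ) (hd : BoundaryPair H D hb h) (hδ : 0 < δ)
    (hδ1 : δ ≤ 1) (hχ : IsTestFunction D χ) (hχ1 : ∀ x, χ x ∈ Icc (0 : ℝ) 1)
    (hψ : IsTestFunction (subgraph D u) ψ) {B B' J₀ S r : ℝ} (hr : 0 ≤ r)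
    (hB : ∀ x ∈ D, ∀ t ∈ Icc (-H - 1) (-H), ‖fderivWithin ℝ hb (layerDom H D) (x, t, u x)‖ ≤ B)
    (hB' : ∀ x ∈ D, ∀ t ∈ Icc (-H - 1) (-H),
      ‖fderivWithin ℝ (recLayer H hb h χ ψ) (layerDom H D) (x, t, u x)‖ ≤ B')
    (hJ₀ : ∀ x ∈ D, |dataJump H u hb h x| + |ψ (x, -H)| ≤ J₀)
    (hσ : LayerPermittivity H D σ) (hS : ∀ p ∈ closure D ×ˢ Icc (-H - 1) (-H), σ p ≤ S)
    (hrσ : ∀ x ∈ D, ∀ z ∈ Ioo (-H - δ) (-H), σ (x, z) ≤ r * σ (x, -H)) :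
    energyDelta H M δ D u σ hb h (recL2 hu hd hδ hχ hψ) ≤
      1 / 2 * (∫⁻ p in freeSpace H D u,
        ENNReal.ofReal (gradSq (fderiv ℝ ψ p + upperGrad H D u γ h p))) +
      1 / 2 * (ENNReal.ofReal (δ * δ) *
          (∫⁻ x in D, ENNReal.ofReal (S * (n * (B' * (1 + ‖γ x‖)) ^ 2))) +
        (ENNReal.ofReal r * (∫⁻ x in D, ENNReal.ofReal
          (σ (x, -H) * (bottomTrace H D u (fderiv ℝ ψ) x + dataJump H u hb h x) ^ 2)) +
        ENNReal.ofReal (S * (J₀ + B) ^ 2) * volume (D ∩ {x | χ x ≠ 1}))) := by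
  have hD := hu.isOpen.measurableSet
  rw [energyDelta_recL2 hu hd hδ hδ1 hχ hψ, ← mul_add]
  refine mul_le_mul_right ?_ _
  have hsub : device H δ D u ⊆ freeSpace H D u ∪ (layer H δ D ∪ {p | p.2 = -H}) := by
    intro p hp
    rcases lt_trichotomy p.2 (-H) with hz | hz | hz
    · exact Or.inr (Or.inl ⟨hp.1, hp.2.1, hz⟩)
    · exact Or.inr (Or.inr hz)
    · exact Or.inl ⟨hp.1, hz, hp.2.2⟩
  refine (lintegral_mono_set hsub).trans ((lintegral_union_le _ _ _).trans
    (add_le_add (lintegral_freeSpace_rec hu hd hχ hψ).le ((lintegral_union_le _ _ _).trans ?_)))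
  rw [setLIntegral_measure_zero _ _ (volume_snd_eq _), add_zero]
  have hmem : ∀ x ∈ D, ∀ z ∈ Icc (-H - 1) (-H), 0 < σ (x, z) ∧ σ (x, z) ≤ S := fun x hx z hz =>
    ⟨hσ.pos _ ⟨subset_closure hx, hz⟩, hS _ ⟨subset_closure hx, hz⟩⟩
  have hb1 : (-H : ℝ) ∈ Icc (-H - 1) (-H) := by constructor <;> linarith
  set w₁ : Rn n → ℝ≥0∞ := fun x => ENNReal.ofReal (S * (n * (B' * (1 + ‖γ x‖)) ^ 2)) with hw₁
  set w₂ : Rn n → ℝ≥0∞ := fun x => ENNReal.ofReal r * ENNReal.ofReal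
    (σ (x, -H) * (bottomTrace H D u (fderiv ℝ ψ) x + dataJump H u hb h x) ^ 2) with hw₂
  set w₃ : Rn n → ℝ≥0∞ := {x | χ x ≠ 1}.indicator fun _ => ENNReal.ofReal (S * (J₀ + B) ^ 2)
    with hw₃
  have hχm : MeasurableSet {x | χ x ≠ 1} :=
    (isOpen_ne_fun hχ.1.continuous continuous_const).measurableSet
  have m₁ : AEMeasurable w₁ (volume.restrict D) := by
    have := hu.meas.measurable.norm
    refine Measurable.aemeasurable ?_
    fun_prop
  have m₂ : AEMeasurable w₂ (volume.restrict D) := by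
    have h1 : AEMeasurable (fun x : Rn n => σ (x, -H)) (volume.restrict D) :=
      ((hσ.cont.comp (f := fun x : Rn n => (x, -H)) (by fun_prop) fun x hx =>
        ⟨hx, hb1⟩).mono subset_closure).aemeasurable hD
    have h2 := (hu.memLp_bottomTrace (memH1With_of_subgraph hu hψ).2.2).1.aemeasurable
    have h3 := (continuousOn_dataJump hu hd).aemeasurable (μ := volume) hD
    exact ((h1.mul ((h2.add h3).pow_const 2)).ennreal_ofReal).const_mul _
  have m₃ : AEMeasurable w₃ (volume.restrict D) :=
    (measurable_const.indicator hχm).aemeasurable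
  have hle : ∀ p ∈ layer H δ D, ENNReal.ofReal (permittivity H δ σ p *
      gradSq (dataGrad H δ D u γ (recLayer H hb h χ ψ) (recUpper h ψ) p)) ≤
      ENNReal.ofReal δ * w₁ p.1 + ENNReal.ofReal (1 / δ) * (w₂ p.1 + w₃ p.1) := by
    intro p hp
    have hz : p.2 ∈ Icc (-H - 1) (-H) := ⟨by linarith [hp.2.1], hp.2.2.le⟩
    have hp1 := hmem p.1 hp.1 p.2 hz
    have hp2 := hmem p.1 hp.1 (-H) hb1
    have key := density_layer_le hu hd hδ hχ hχ1 hψ hr hB hB' hJ₀ hp hp1.1.le hp1.2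
      (hrσ _ hp.1 _ hp.2) hp2.1.le
    rw [permittivity, if_pos hp.2.2]
    refine (ENNReal.ofReal_le_ofReal key).trans ((ENNReal.ofReal_add_le).trans ?_)
    refine add_le_add (ENNReal.ofReal_mul hδ.le).le ?_
    rw [ENNReal.ofReal_mul (one_div_pos.2 hδ).le]
    refine mul_le_mul_right (ENNReal.ofReal_add_le.trans (add_le_add ?_ ?_)) _
    · rw [ENNReal.ofReal_mul hr, hw₂]
      simp only
      rw [bottomTrace_of_subgraph hu hψ hp.1, add_comm (ψ _)]
    · simp only [hw₃]
      by_cases hc : p.1 ∈ {x | χ x ≠ 1}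
      · rw [indicator_of_mem hc, indicator_of_mem hc]
      · rw [indicator_of_notMem hc, indicator_of_notMem hc, ENNReal.ofReal_zero]
  refine (setLIntegral_mono' hu.measurableSet_layer hle).trans (le_of_eq ?_)
  have m₂₃ : AEMeasurable (fun x => w₂ x + w₃ x) (volume.restrict D) := m₂.add m₃
  have hm : AEMeasurable (fun x => ENNReal.ofReal δ * w₁ x + ENNReal.ofReal (1 / δ) *
      (w₂ x + w₃ x)) (volume.restrict D) :=
    (m₁.const_mul _).add (m₂₃.const_mul _)
  rw [lintegral_layer (w := fun x => ENNReal.ofReal δ * w₁ x + ENNReal.ofReal (1 / δ) *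
      (w₂ x + w₃ x)) hm, lintegral_add_left' (m₁.const_mul _),
    lintegral_const_mul'' _ m₁, lintegral_const_mul'' _ m₂₃, mul_add, ← mul_assoc,
    ← mul_assoc, ← ENNReal.ofReal_mul hδ.le, ← ENNReal.ofReal_mul hδ.le, mul_one_div,
    div_self hδ.ne', ENNReal.ofReal_one, one_mul, lintegral_add_left' m₂,
    lintegral_const_mul' _ _ ENNReal.ofReal_ne_top, lintegral_indicator hχm, setLIntegral_const,
    Measure.restrict_apply hχm, inter_comm]

/-- For a suitable cutoff, the energy of the recovery family is almost the limit energy. -/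
lemma exists_cutoff_energyDelta_le (hu : Deflection H M D u γ) (hd : BoundaryPair H D hb h)
    (hσ : LayerPermittivity H D σ) (hψ : IsTestFunction (subgraph D u) ψ) {ε : ℝ≥0∞}
    (hε : ε ≠ 0) : ∃ (χ : Rn n → ℝ) (hχ : IsTestFunction D χ), ∀ᶠ δ in 𝓝[>] (0 : ℝ),
      ∀ hδ : 0 < δ, energyDelta H M δ D u σ hb h (recL2 hu hd hδ hχ hψ) ≤
        gradEnergy H D u γ σ hb h (fderiv ℝ ψ) + ε := by
  have hfin := isFiniteMeasure_restrict_of_isBounded hu.isBounded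
  set R := ∫⁻ x in D, ENNReal.ofReal
    (σ (x, -H) * (bottomTrace H D u (fderiv ℝ ψ) x + dataJump H u hb h x) ^ 2) with hR
  have half : (1 / 2 : ℝ≥0∞) ≠ 0 := by simp
  by_cases hRt : R = ⊤
  · have e : gradEnergy H D u γ σ hb h (fderiv ℝ ψ) = ⊤ := by
      rw [gradEnergy, ← hR, hRt, ENNReal.mul_top half, add_top]
    refine ⟨fun _ => 0, ⟨contDiff_const, HasCompactSupport.zero, by simp [tsupport]⟩,
      Eventually.of_forall fun δ hδ => ?_⟩
    rw [e, top_add]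
    exact le_top
  obtain ⟨S, hS⟩ := (hu.isBounded.isCompact_closure.prod isCompact_Icc).exists_bound_of_continuousOn
    hσ.cont
  obtain ⟨B, -, hB, -⟩ := exists_bound_dataGrad hu hd
  obtain ⟨J₁, hJ₁⟩ := exists_bound_dataJump hu hd
  obtain ⟨J₂, hJ₂⟩ := hψ.2.1.exists_bound_of_continuous hψ.1.continuous
  -- The order of choices matters: this bound for the density where `χ ≠ 1` involves only the data
  -- and `ψ`, so `χ` can be adapted to it. The bound `B'` below depends on `χ` but is multiplied by
  -- `δ²`.
  set C := ENNReal.ofReal (S * (J₁ + J₂ + B) ^ 2) with hC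
  have hC0 : C + 1 ≠ 0 := by simp
  have hCt : C + 1 ≠ ⊤ := by simp [hC]
  have hε3 : ε / 3 ≠ 0 := by simp [hε]
  -- Division by `C + 1` rather than `C` avoids a zero denominator. Each of the three errors
  -- receives `ε / 3`.
  obtain ⟨K, hKD, hK, hvol⟩ := hu.isOpen.measurableSet.exists_isCompact_sdiff_lt
    (μ := volume) hu.isBounded.measure_lt_top.ne (ENNReal.div_ne_zero.2 ⟨hε3, hCt⟩)
  obtain ⟨χ, hχ, hχK, hχ1⟩ := exists_cutoff hK hu.isOpen hKD
  obtain ⟨B', -, hB', -⟩ := exists_bound_dataGrad hu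
    (boundaryPair_rec hd (hχ.1.of_le (by simp)) (hψ.1.of_le (by simp)))
  refine ⟨χ, hχ, ?_⟩
  have hvol' : C * volume (D ∩ {x | χ x ≠ 1}) ≤ ε / 3 := by
    have h1 : D ∩ {x | χ x ≠ 1} ⊆ D \ K := fun x hx =>
      ⟨hx.1, fun hxK => hx.2 (hχK.self_of_nhdsSet x hxK)⟩
    calc C * volume (D ∩ {x | χ x ≠ 1}) ≤ (C + 1) * (ε / 3 / (C + 1)) :=
          mul_le_mul' le_self_add ((measure_mono h1).trans hvol.le)
      _ = ε / 3 := ENNReal.mul_div_cancel hC0 hCt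
  set K₁ := ∫⁻ x in D, ENNReal.ofReal (S * (n * (B' * (1 + ‖γ x‖)) ^ 2)) with hK₁
  have hK₁t : K₁ ≠ ⊤ := by
    have m1 : MemLp (fun x => 1 + ‖γ x‖) 2 (volume.restrict D) :=
      memLp_fun_add (memLp_const 1) hu.memH1.2.2.norm
    have m2 := ((m1.integrable_sq).const_mul (S * n * B' ^ 2)).lintegral_lt_top
    refine ne_of_eq_of_ne (lintegral_congr fun x => ?_) m2.ne
    congr 1
    ring
  have hr : ∃ r : ℝ, 1 < r ∧ ENNReal.ofReal r * R ≤ R + ε / 3 := by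
    have ht : Tendsto (fun r : ℝ => ENNReal.ofReal r * R) (𝓝[>] 1) (𝓝 (ENNReal.ofReal 1 * R)) :=
      ENNReal.Tendsto.mul_const
        ((ENNReal.continuous_ofReal.tendsto 1).mono_left nhdsWithin_le_nhds) (Or.inr hRt)
    rw [ENNReal.ofReal_one, one_mul] at ht
    obtain ⟨r, h1, h2⟩ := ((ht.eventually (ge_mem_nhds (ENNReal.lt_add_right hRt hε3))).and
      self_mem_nhdsWithin).exists
    exact ⟨r, h2, h1⟩
  obtain ⟨r, hr1, hrR⟩ := hr
  obtain ⟨δ₀, h0, h1, hrat⟩ := hσ.exists_ratio hu.isBounded hr1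
  have hδK : ∀ᶠ δ : ℝ in 𝓝[>] 0, ENNReal.ofReal (δ * δ) * K₁ ≤ ε / 3 := by
    have c : Continuous fun δ : ℝ => ENNReal.ofReal (δ * δ) :=
      ENNReal.continuous_ofReal.comp (by fun_prop)
    have ht : Tendsto (fun δ : ℝ => ENNReal.ofReal (δ * δ) * K₁) (𝓝[>] 0)
        (𝓝 (ENNReal.ofReal (0 * 0) * K₁)) :=
      ENNReal.Tendsto.mul_const ((c.tendsto 0).mono_left nhdsWithin_le_nhds) (Or.inr hK₁t)
    rw [mul_zero, ENNReal.ofReal_zero, zero_mul] at ht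
    exact ht.eventually (ge_mem_nhds (pos_iff_ne_zero.2 hε3))
  filter_upwards [hδK, nhdsWithin_le_nhds (Iio_mem_nhds h0)] with δ hδK hδ₀ hδ
  have hδ₀' : δ < δ₀ := hδ₀
  refine (energyDelta_recL2_le hu hd hδ (hδ₀'.le.trans h1) hχ hχ1 hψ (by linarith) hB hB'
    (J₀ := J₁ + J₂) (fun x hx => add_le_add (hJ₁ x hx) (hJ₂ _)) hσ
    (fun p hp => (le_abs_self _).trans (hS p hp))
    fun x hx z hz => (hrat δ hδ₀'.le x hx z hz).2).trans ?_
  rw [gradEnergy, ← hR, ← hC, ← hK₁, add_assoc]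
  refine add_le_add le_rfl ?_
  have e3 : ε / 3 + (R + ε / 3 + ε / 3) = R + ε := by
    rw [add_assoc, add_left_comm, ← add_assoc (ε / 3), ENNReal.add_thirds]
  refine (mul_le_mul_right (add_le_add hδK (add_le_add hrR hvol')) _).trans ?_
  rw [e3, mul_add]
  refine add_le_add le_rfl ?_
  calc 1 / 2 * ε ≤ 1 * ε := mul_le_mul_left (by simp) _
    _ = ε := one_mul _

end RecoveryLimsup

end MEMS

namespace MEMS

/-! ### The recovery condition -/

/-- A diagonal argument: approximate recovery families yield a recovery family. -/
lemma exists_recovery_of_approx {X : Type*} [PseudoMetricSpace X] {F : ℝ → X → ℝ≥0∞} {θ : X}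
    {c : ℝ≥0∞} (H : ∀ ε : ℝ≥0∞, 0 < ε → ∃ y : ℝ → X, ∀ᶠ δ in 𝓝[>] (0 : ℝ),
      edist (y δ) θ ≤ ε ∧ F δ (y δ) ≤ c + ε) :
    ∃ y : ℝ → X, Tendsto y (𝓝[>] 0) (𝓝 θ) ∧ limsup (fun δ => F δ (y δ)) (𝓝[>] 0) ≤ c := by
  -- The larger of the distance and the excess energy. Choosing a near minimiser for each `δ`
  -- separately, with tolerance `δ`, makes it unnecessary to patch the approximate families
  -- together.
  set m : ℝ → X → ℝ≥0∞ := fun δ x => max (edist x θ) (F δ x - c) with hm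
  have hex : ∀ δ : ℝ, ∃ x, 0 < δ → m δ x ≤ (⨅ x, m δ x) + ENNReal.ofReal δ := by
    intro δ
    by_cases hδ : 0 < δ
    · by_cases ht : (⨅ x, m δ x) = ⊤
      · exact ⟨θ, fun _ => by rw [ht, top_add]; exact le_top⟩
      · obtain ⟨x, hx⟩ := iInf_lt_iff.1
          (ENNReal.lt_add_right ht (ENNReal.ofReal_pos.2 hδ).ne')
        exact ⟨x, fun _ => hx.le⟩
    · exact ⟨θ, fun h => absurd h hδ⟩
  choose y hy using hex
  have hlim : Tendsto (fun δ => m δ (y δ)) (𝓝[>] 0) (𝓝 0) := by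
    refine ENNReal.tendsto_nhds_zero.2 fun ε hε => ?_
    have hε2 : 0 < ε / 2 := ENNReal.half_pos hε.ne'
    obtain ⟨y', hy'⟩ := H _ hε2
    have h1 : Tendsto (fun δ : ℝ => ENNReal.ofReal δ) (𝓝[>] 0) (𝓝 0) := by
      have := (ENNReal.continuous_ofReal.tendsto 0).mono_left
        (nhdsWithin_le_nhds (s := Ioi (0 : ℝ)))
      rwa [ENNReal.ofReal_zero] at this
    filter_upwards [hy', ENNReal.tendsto_nhds_zero.1 h1 _ hε2, self_mem_nhdsWithin]
      with δ h2 h3 h4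
    refine (hy δ h4).trans ?_
    rw [← ENNReal.add_halves ε]
    exact add_le_add ((iInf_le _ (y' δ)).trans (max_le h2.1 (tsub_le_iff_left.2 h2.2))) h3
  refine ⟨y, tendsto_iff_edist_tendsto_0.2 ?_, ?_⟩
  · exact tendsto_of_tendsto_of_tendsto_of_le_of_le tendsto_const_nhds hlim
      (fun _ => zero_le) fun _ => le_max_left _ _
  · have h1 := hlim.const_add c
    rw [add_zero] at h1
    rw [← h1.limsup_eq]
    exact limsup_le_limsup (Eventually.of_forall fun δ =>
      tsub_le_iff_left.1 (le_max_right (edist (y δ) θ) (F δ (y δ) - c)))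

lemma eLpNorm_le_add_sub {α E : Type*} [MeasurableSpace α] {μ : Measure α} [NormedAddCommGroup E]
    {f g : α → E} (hf : AEStronglyMeasurable f μ) (hg : AEStronglyMeasurable g μ) :
    eLpNorm f 2 μ ≤ eLpNorm g 2 μ + eLpNorm (fun x => f x - g x) 2 μ := by
  have h := eLpNorm_add_le hg (hf.sub hg) (p := 2) (by norm_num)
  rwa [add_sub_cancel] at h

section Recovery

variable {n : ℕ} {H M δ : ℝ} {D : Set (Rn n)} {u : Rn n → ℝ} {γ : Rn n → Rn n →L[ℝ] ℝ}
  {σ : Rn n × ℝ → ℝ} {hb h : Rn n × ℝ × ℝ → ℝ} {χ : Rn n → ℝ} {ψ : Rn n × ℝ → ℝ}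

lemma eventually_recFun_eq {p : Rn n × ℝ} (hp : p.2 ≠ -H) :
    ∀ᶠ δ in 𝓝[>] (0 : ℝ), recFun H δ D u hb h χ ψ p = (freeSpace H D u).indicator ψ p := by
  rcases lt_or_gt_of_ne hp with hz | hz
  · have h1 : (0 : ℝ) < -H - p.2 := by linarith
    filter_upwards [nhdsWithin_le_nhds (Iio_mem_nhds h1)] with δ hδ
    have hδ' : δ < -H - p.2 := hδ
    rw [recFun, indicator_of_notMem fun hm => by linarith [hm.2.1],
      indicator_of_notMem fun hm => hz.not_gt hm.2.1]
  · filter_upwards [self_mem_nhdsWithin] with δ hδ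
    have hδ' : 0 < δ := hδ
    by_cases hm : p ∈ freeSpace H D u
    · rw [indicator_of_mem hm, recFun, indicator_of_mem (freeSpace_subset_device hδ'.le hm)]
      simp only [boundaryData, if_neg hz.not_gt, recUpper]
      ring
    · rw [indicator_of_notMem hm, recFun, indicator_of_notMem fun hd => hm ⟨hd.1, hz, hd.2.2⟩]

/-- Off the plate, a null set, the family is eventually constant in `δ`; the bound uniform in `δ`
permits dominated convergence. -/
lemma tendsto_eLpNorm_recFun (hu : Deflection H M D u γ) (hd : BoundaryPair H D hb h)
    (hχ : IsTestFunction D χ) (hψ : IsTestFunction (subgraph D u) ψ) :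
    Tendsto (fun δ => eLpNorm (fun p => recFun H δ D u hb h χ ψ p -
      (freeSpace H D u).indicator ψ p) 2 (volume.restrict (container H M D)))
      (𝓝[>] 0) (𝓝 0) := by
  have hfin := isFiniteMeasure_restrict_of_isBounded hu.isBounded_container
  obtain ⟨B, hB⟩ := exists_bound_recFun hu hd hχ hψ
  obtain ⟨B', hB'⟩ := hψ.2.1.exists_bound_of_continuous hψ.1.continuous
  refine tendsto_of_seq_tendsto fun x hx => ?_
  -- A shift of the sequence makes all thicknesses positive, as continuity and the bounds require.
  obtain ⟨N, hN⟩ := eventually_atTop.1 (hx.eventually self_mem_nhdsWithin)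
  have hpos : ∀ k, 0 < x (k + N) := fun k => hN _ (Nat.le_add_left _ _)
  refine (tendsto_add_atTop_iff_nat N).1 ?_
  refine tendsto_eLpNorm_of_dominated (b := fun _ => B + B') (memLp_const _) (fun k => ?_)
    (fun k => Eventually.of_forall fun p => ?_) ?_
  · exact (continuous_recFun hu hd (hpos k) hχ hψ).aestronglyMeasurable.sub
      (hψ.1.continuous.aestronglyMeasurable.indicator hu.isOpen_freeSpace.measurableSet)
  · refine (norm_sub_le _ _).trans (add_le_add (hB _ (hpos k) p) ?_)
    exact (norm_indicator_le_norm_self _ _).trans (hB' p)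
  · have hne : ∀ᵐ p ∂(volume.restrict (container H M D)), p.2 ≠ -H :=
      ae_restrict_of_ae (ae_iff.2 (by simpa using volume_snd_eq (n := n) (-H)))
    filter_upwards [hne] with p hp
    have hx' := hx.comp (tendsto_add_atTop_nat N)
    refine tendsto_const_nhds.congr' ?_
    filter_upwards [hx'.eventually 
      (eventually_recFun_eq (D := D) (u := u) (hb := hb) (h := h) (χ := χ) (ψ := ψ) hp)] with k hk
    have hk' : recFun H (x (k + N)) D u hb h χ ψ p = (freeSpace H D u).indicator ψ p := hk
    rw [hk', sub_self]

lemma edist_recL2_le (hu : Deflection H M D u γ) (hd : BoundaryPair H D hb h) (hδ : 0 < δ)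
    (hχ : IsTestFunction D χ) (hψ : IsTestFunction (subgraph D u) ψ) {θ : L2M H M D}
    (h0 : ∀ᵐ p ∂(volume.restrict (container H M D \ freeSpace H D u)), θ p = 0) :
    edist (recL2 hu hd hδ hχ hψ) θ ≤ eLpNorm (fun p => recFun H δ D u hb h χ ψ p -
        (freeSpace H D u).indicator ψ p) 2 (volume.restrict (container H M D)) +
      eLpNorm (fun p => ψ p - θ p) 2 (volume.restrict (freeSpace H D u)) := by
  have hΩ := hu.isOpen_freeSpace.measurableSet
  have hC : MeasurableSet (container H M D) := hu.isOpen.measurableSet.prod measurableSet_Ioo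
  have mi : AEStronglyMeasurable ((freeSpace H D u).indicator ψ)
      (volume.restrict (container H M D)) := hψ.1.continuous.aestronglyMeasurable.indicator hΩ
  have mr := (continuous_recFun hu hd hδ hχ hψ).aestronglyMeasurable
    (μ := volume.restrict (container H M D))
  have e1 : eLpNorm (fun p => ψ p - θ p) 2 (volume.restrict (freeSpace H D u)) =
      eLpNorm (fun p => (freeSpace H D u).indicator ψ p - θ p) 2
        (volume.restrict (container H M D)) := by
    have e2 : (volume.restrict (container H M D)).restrict (freeSpace H D u) =
        volume.restrict (freeSpace H D u) := by
      rw [Measure.restrict_restrict hΩ, inter_eq_left.2 hu.freeSpace_subset]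
    rw [← e2, ← eLpNorm_indicator_eq_eLpNorm_restrict hΩ]
    refine eLpNorm_congr_ae ?_
    filter_upwards [ae_restrict_of_ae ((ae_restrict_iff' (hC.diff hΩ)).1 h0), ae_restrict_mem hC]
      with p hp hpC
    by_cases hm : p ∈ freeSpace H D u
    · rw [indicator_of_mem hm, indicator_of_mem hm]
    · rw [indicator_of_notMem hm, indicator_of_notMem hm, hp ⟨hpC, hm⟩, sub_zero]
  rw [e1, Lp.edist_def]
  refine (eLpNorm_congr_ae ?_).trans_le
    (eLpNorm_triangle_sub (mr.sub mi) (mi.sub (Lp.memLp θ).1))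
  filter_upwards [recL2_ae hu hd hδ hχ hψ] with p hp
  rw [Pi.sub_apply, hp]

/-- Upper semicontinuity of the energy with respect to the gradient. -/
lemma eventually_gradEnergy_le (hu : Deflection H M D u γ) (hd : BoundaryPair H D hb h)
    (hσ : LayerPermittivity H D σ) {g : ℕ → Rn n × ℝ → Rn n × ℝ →L[ℝ] ℝ}
    {g₀ : Rn n × ℝ → Rn n × ℝ →L[ℝ] ℝ}
    (hg : ∀ k, MemLp (g k) 2 (volume.restrict (freeSpace H D u)))
    (hg₀ : MemLp g₀ 2 (volume.restrict (freeSpace H D u)))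
    (t : Tendsto (fun k => eLpNorm (fun p => g k p - g₀ p) 2
      (volume.restrict (freeSpace H D u))) atTop (𝓝 0)) {ε : ℝ≥0∞} (hε : ε ≠ 0) :
    ∀ᶠ k in atTop, gradEnergy H D u γ σ hb h (g k) ≤ gradEnergy H D u γ σ hb h g₀ + ε := by
  have mV := memLp_upperGrad hu hd
  have mg₀ : MemLp (fun p => g₀ p + upperGrad H D u γ h p) 2
    (volume.restrict (freeSpace H D u)) := memLp_fun_add hg₀ mV
  have mg : ∀ k, MemLp (fun p => g k p + upperGrad H D u γ h p) 2
    (volume.restrict (freeSpace H D u)) := fun k => memLp_fun_add (hg k) mV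
  have v₀ : MemLp (fun p => toVec (g₀ p + upperGrad H D u γ h p)) 2
    (volume.restrict (freeSpace H D u)) := toVec.comp_memLp' mg₀
  have v : ∀ k, MemLp (fun p => toVec (g k p + upperGrad H D u γ h p)) 2
    (volume.restrict (freeSpace H D u)) := fun k => toVec.comp_memLp' (mg k)
  have r₀ := memLp_robinTerm (hb := hb) (h := h) hu hd hσ hg₀
  have r := fun k => memLp_robinTerm (hb := hb) (h := h) hu hd hσ (hg k)
  have t1 : Tendsto (fun k => eLpNorm (fun p => toVec (g k p + upperGrad H D u γ h p) -
      toVec (g₀ p + upperGrad H D u γ h p)) 2 (volume.restrict (freeSpace H D u)))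
      atTop (𝓝 0) := by
    refine tendsto_eLpNorm_clm toVec (t.congr fun k => eLpNorm_congr_ae
      (Eventually.of_forall fun p => ?_))
    exact (add_sub_add_right_eq_sub _ _ _).symm
  have t2 := tendsto_robinTerm (hb := hb) (h := h) hu hσ hg hg₀ t
  have half : (1 / 2 : ℝ≥0∞) ≠ ⊤ := by simp
  have tt := ENNReal.Tendsto.const_mul (a := 1 / 2)
    ((ENNReal.Tendsto.pow (n := 2) (t1.const_add (eLpNorm
      (fun p => toVec (g₀ p + upperGrad H D u γ h p)) 2 (volume.restrict (freeSpace H D u))))).add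
      (ENNReal.Tendsto.pow (n := 2) (t2.const_add
        (eLpNorm (robinTerm H D u σ hb h g₀) 2 (volume.restrict D))))) (Or.inr half)
  rw [add_zero, add_zero, ← gradEnergy_eq hu hσ g₀] at tt
  have hfin : gradEnergy H D u γ σ hb h g₀ ≠ ⊤ := by
    rw [gradEnergy_eq hu hσ]
    exact ENNReal.mul_ne_top half (ENNReal.add_ne_top.2
      ⟨ENNReal.pow_ne_top v₀.eLpNorm_ne_top, ENNReal.pow_ne_top r₀.eLpNorm_ne_top⟩)
  filter_upwards [tt.eventually (ge_mem_nhds (ENNReal.lt_add_right hfin hε))] with k hk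
  refine le_trans ?_ hk
  rw [gradEnergy_eq hu hσ]
  exact mul_le_mul_right (add_le_add
    (pow_le_pow_left' (eLpNorm_le_add_sub (v k).1 v₀.1) 2)
    (pow_le_pow_left' (eLpNorm_le_add_sub (r k).1 r₀.1) 2)) _

/-- Of a tolerance `ε`, one half pays for replacing `θ` by a test function close to it in `H¹` and
in energy, the other for the cutoff and the passage to small `δ`. The diagonal argument removes `ε`.
-/
lemma exists_recovery (hu : Deflection H M D u γ) (hd : BoundaryPair H D hb h)
    (hσ : LayerPermittivity H D σ) (θ : L2M H M D) :
    ∃ y : ℝ → L2M H M D, Tendsto y (𝓝[>] 0) (𝓝 θ) ∧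
      limsup (fun δ => energyDelta H M δ D u σ hb h (y δ)) (𝓝[>] 0) ≤
        energyLimit H M D u σ hb h θ := by
  by_cases hin : InH1B H M D u θ
  swap
  · refine ⟨fun _ => θ, tendsto_const_nhds, ?_⟩
    rw [energyLimit, if_neg hin]
    exact le_top
  obtain ⟨⟨g, hg⟩, h0⟩ := hin
  rw [energyLimit_eq hu hd h0 hg]
  obtain ⟨hm, ψ, hψ, ht⟩ := H1ClosureWith.subgraph hu hg
  refine exists_recovery_of_approx fun ε hε => ?_
  have hε2 : 0 < ε / 2 := ENNReal.half_pos hε.ne'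
  obtain ⟨k, hk1, hk2⟩ := ((ENNReal.tendsto_nhds_zero.1 ht.1 _ hε2).and
    (eventually_gradEnergy_le (σ := σ) hu hd hσ (fun k => (hψ k).memLp_fderiv) hm.2.2 ht.2
      hε2.ne')).exists
  obtain ⟨χ, hχ, hE⟩ := exists_cutoff_energyDelta_le hu hd hσ (hψ k) hε2.ne'
  refine ⟨fun δ => if hδ : 0 < δ then recL2 hu hd hδ hχ (hψ k) else θ, ?_⟩
  filter_upwards [hE, self_mem_nhdsWithin,
    ENNReal.tendsto_nhds_zero.1 (tendsto_eLpNorm_recFun (M := M) hu hd hχ (hψ k)) _ hε2]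
    with δ h1 h2 h3
  have hδ : 0 < δ := h2
  simp only [dif_pos hδ]
  constructor
  · refine (edist_recL2_le hu hd hδ hχ (hψ k) h0).trans ?_
    rw [← ENNReal.add_halves ε]
    exact add_le_add h3 hk1
  · refine (h1 hδ).trans ((add_le_add hk2 le_rfl).trans ?_)
    rw [add_assoc, ENNReal.add_halves]

end Recovery

end MEMS

theorem theorem3p1 {n : ℕ} (hn : 1 ≤ n) (D : Set (MEMS.Rn n)) (hD : MEMS.IsBoundedC2Domain D)
    (H : ℝ) (hH : 0 < H)
    -- the deflection
    (u : MEMS.Rn n → ℝ) (hu_H10 : MEMS.MemH10 D u) (hu_cont : ContinuousOn u (closure D))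
    (hu_bdry : ∀ x ∈ frontier D, u x = 0) (hu_lower : ∀ x ∈ D, -H ≤ u x)
    (hu_seg : MEMS.SegmentProperty (MEMS.freeSpace H D u))
    (M : ℝ) (hM : ∀ x ∈ D, |u x| + H ≤ M)
    -- the permittivity of the layer
    (σ : MEMS.Rn n × ℝ → ℝ) (hσ_cont : ContinuousOn σ (closure D ×ˢ Icc (-H - 1) (-H)))
    (hσ_pos : ∀ p ∈ closure D ×ˢ Icc (-H - 1) (-H), 0 < σ p)
    -- the boundary data
    (hb h : MEMS.Rn n × ℝ × ℝ → ℝ)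
    (hb_C2 : ContDiffOn ℝ 2 hb (closure D ×ˢ Icc (-H - 1) (-H) ×ˢ Ici (-H)))
    (h_C2 : ContDiffOn ℝ 2 h (closure D ×ˢ Ici (-H) ×ˢ Ici (-H)))
    (h_match : ∀ x ∈ D, ∀ w ∈ Ici (-H), hb (x, -H, w) = h (x, -H, w))
    (h_flux : ∀ x ∈ D, ∀ w ∈ Ici (-H),
      σ (x, -H) * derivWithin (fun z => hb (x, z, w)) (Icc (-H - 1) (-H)) (-H) =
        derivWithin (fun z => h (x, z, w)) (Ici (-H)) (-H)) :
    MEMS.GammaConverges (𝓝[>] (0 : ℝ)) (fun δ => MEMS.energyDelta H M δ D u σ hb h)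
        (MEMS.energyLimit H M D u σ hb h) ∧
      ∀ θ : MEMS.L2M H M D,
        MEMS.energyLimit H M D u σ hb h θ < ⊤ ↔ MEMS.InH1B H M D u θ := by
  obtain ⟨γ, hγ, -⟩ := hu_H10
  have hγm := hγ.2.2.1
  -- A strongly measurable representative of `∇u` makes its pullbacks to `ℝⁿ × ℝ` measurable.
  have hu : MEMS.Deflection H M D u (hγm.mk γ) := by
    refine ⟨hD.isOpen, hD.isBounded, hH, hγ.congr (ae_eq_refl _) hγm.ae_eq_mk,
      hγm.stronglyMeasurable_mk, hu_cont, hu_bdry, hu_lower, hM⟩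
  have hd : MEMS.BoundaryPair H D hb h :=
    ⟨hb_C2.of_le (by norm_num), h_C2.of_le (by norm_num), h_match⟩
  have hσ : MEMS.LayerPermittivity H D σ := ⟨hσ_cont, hσ_pos⟩
  exact ⟨fun θ => ⟨fun _ hy => MEMS.energyLimit_le_liminf hu hd hσ hy,
    MEMS.exists_recovery hu hd hσ θ⟩, MEMS.energyLimit_lt_top_iff hu hd hσ⟩
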